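/- Let $m\ge 1$, $n\ge 0$, and let $M^{m+1}$, $N^{n+1}$ be compact smooth manifolds with boundary, with interiors $M^\circ,N^\circ$. A bounded polyhomogeneous function is one that is smooth in the interior and near the boundary has an expansion $\sum a_{\alpha,l}\,x^{\alpha}(\log x)^l$ with $a_{\alpha,l}$ smooth up to the boundary, $x$ a boundary defining function, real exponents $\alpha\ge 0$ (finitely many terms below each order), and no logarithms at order $\alpha=0$; the remainders after truncation at order $\delta$ are $O(x^\delta)$ together with all their derivatives along vector fields tangent to the boundary. Let $g,h$ be conformally compact metrics on $M,N$: smooth Riemannian metrics on $M^\circ,N^\circ$ such that $x^2g$, $X^2h$ extend to polyhomogeneous metrics up to the boundary, for boundary defining functions $x$ of $M$ and $X$ of $N$. Near the boundary ${}^0TM$ denotes the bundle with frame $x\partial_x,x\partial_{y^1},\dots,x\partial_{y^m}$, where $(x,y)$ are half-space coordinates, and similarly for ${}^0TN$; then $g,h$ extend to bundle metrics on ${}^0TM,{}^0TN$. A simple $b$-map is a map $u:M\to N$ which, together with its first derivatives in local coordinates, is bounded polyhomogeneous (in particular $u$ is $C^1$ up to the boundary), which maps $\partial M$ to $\partial N$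 and $M^\circ$ to $N^\circ$, and is transversal to $\partial N$. Its differential extends to a bundle map ${}^0du:{}^0TM\to{}^0TN$ over $u$. Its tension field is $\tau(u)=\operatorname{tr}_g\nabla du$, its Jacobi operator is $J_u=\Delta+\operatorname{tr}_gR_h(du,\cdot)du$, with $\Delta=\nabla^*\nabla$ the positive rough Laplacian on $u^*TN$ and $R_h(V,W)=[\nabla_V,\nabla_W]-\nabla_{[V,W]}$; $u$ is biharmonic if $J_u\tau(u)=0$ on $M^\circ$. Both $\tau(u)$ and $J_u$ extend to $M$, as a section of $u^*\,{}^0TN$ and as a $0$-differential operator on such sections. Along $\partial M$, let $\nu_M\in{}^0TM$ be the vector that is $g$-orthogonal to $\ker(dx/x)$ with $(dx/x)(\nu_M)=1$, and define $\nu_N$ likewise from $h$ and $dX/X$. Put $\beta_u={}^0du(\nu_M)-\nu_N$ along $\partial M$, let $\Lambda_u:\ker(dx/x)\to\ker(dX/X)$ be the restriction of ${}^0du$, and let $\Lambda_u^*$ be its adjoint with respect to the normalized metrics $|dx/x|_g^2\,g$ and $|dX/X|_h^2\,h$. For $p\in\partial M$, write $J_u=\sum_{j+|\alpha|\le 2}L_{j,\alpha}(x,y)(x\partial_x)^j(x\partial_y)^\alpha$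 in half-space coordinates near $p$ and a local frame of $u^*\,{}^0TN$; the indicial roots of $J_u$ at $p$ are the $z\in\mathbb C$ for which $\sum_{j\le 2}L_{j,0}(p)z^j$ is not invertible. **Proposition.** Let $u:M\to N$ be a biharmonic simple $b$-map that is not constant on any connected component of $\partial M$. Then $\tau(u)$, as a section of $u^*\,{}^0TN$, vanishes along $\partial M$, and $\beta_u=0$ and $\operatorname{tr}(\Lambda_u^*\Lambda_u)=m$ at every point of $\partial M$. Moreover, at every $p\in\partial M$ the set of indicial roots of $J_u$ is exactly $$\left\{\tfrac{m+\sqrt{m^2+8m}}2,\ \tfrac{m-\sqrt{m^2+8m}}2,\ -1,\ m+1\right\}.$$ -/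

import Mathlib

open Set Filter Topology
open scoped Manifold ContDiff Matrix

noncomputable section

namespace SimpleBMap

/-! ## Coordinates and polyhomogeneous functions

Manifolds with boundary of dimension `d + 1` are modelled on the half-space
`{z ∈ ℝ ^ (d + 1) | 0 ≤ z 0}`. In any chart, `z 0` is a local boundary defining function `x`, and
`z 1, …, z d` are the remaining half-space coordinates `y`. -/

/-- The coordinate space `ℝ ^ (d + 1)`. -/
abbrev Coord (d : ℕ) : Type := EuclideanSpace ℝ (Fin (d + 1))

/-- The `i`-th coordinate vector. -/
def basisVec {d : ℕ} (i : Fin (d + 1)) : Coord d := EuclideanSpace.single i 1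

/-- The partial derivative `∂ f / ∂ z i`. -/
def pd {d : ℕ} (i : Fin (d + 1)) (f : Coord d → ℝ) (z : Coord d) : ℝ :=
  fderiv ℝ f z (basisVec i)

/-- The open half-space `{0 < x}`. -/
def posHalf (d : ℕ) : Set (Coord d) := {z | 0 < z 0}

/-- Derivative along the vector fields `x ∂_x, ∂_{y 1}, …, ∂_{y d}`, which generate the vector
fields tangent to the boundary `{x = 0}`. -/
def bDeriv {d : ℕ} (i : Fin (d + 1)) (f : Coord d → ℝ) (z : Coord d) : ℝ :=
  if i = 0 then z 0 * pd 0 f z else pd i f z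

/-- Iterated tangential derivative along the fields listed in `L`. -/
def bDerivs {d : ℕ} (L : List (Fin (d + 1))) (f : Coord d → ℝ) : Coord d → ℝ :=
  L.foldr bDeriv f

/-- Index sets of bounded real-valued polyhomogeneous functions: exponents are real and
nonnegative, and the exponent `0` carries no logarithm. -/
structure BoundedIndexSet where
  carrier : Set (ℝ × ℕ)
  shift : ∀ α l, (α, l) ∈ carrier → ∀ k l' : ℕ, l' ≤ l → (α + k, l') ∈ carrier
  finite_le : ∀ δ : ℝ, {e ∈ carrier | e.1 ≤ δ}.Finite
  nonneg : ∀ e ∈ carrier, 0 ≤ e.1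
  no_leading_log : ∀ e ∈ carrier, e.1 = 0 → e.2 = 0

/-- The truncated sum `∑ a_{α,l} x ^ α (log x) ^ l` over the `(α, l)` in the index set with
`α ≤ δ`. -/
def phgTruncation {d : ℕ} (S : BoundedIndexSet) (a : ℝ × ℕ → Coord d → ℝ) (δ : ℝ)
    (z : Coord d) : ℝ :=
  ∑ e ∈ (S.finite_le δ).toFinset, a e z * (z 0) ^ e.1 * (Real.log (z 0)) ^ e.2

/-- `f`, a function on the open half-space, is (bounded, real-valued) polyhomogeneous near the
boundary point `z₀`: it is smooth in the interior and has an asymptotic expansion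
`f ∼ ∑ a_{α,l} x ^ α (log x) ^ l` with coefficients smooth up to the boundary, the truncated
differences being `O(x ^ δ)` together with all their tangential derivatives. -/
def IsPhgAt {d : ℕ} (f : Coord d → ℝ) (z₀ : Coord d) : Prop :=
  ∃ (S : BoundedIndexSet) (a : ℝ × ℕ → Coord d → ℝ) (V : Set (Coord d)),
    IsOpen V ∧ z₀ ∈ V ∧
    (∀ e ∈ S.carrier, ContDiffOn ℝ ∞ (a e) (V ∩ {z | 0 ≤ z 0})) ∧
    ContDiffOn ℝ ∞ f (V ∩ posHalf d) ∧
    ∀ (δ : ℝ) (L : List (Fin (d + 1))), ∃ C : ℝ, ∀ z ∈ V ∩ posHalf d,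
      |bDerivs L (fun w => f w - phgTruncation S a δ w) z| ≤ C * (z 0) ^ δ

/-- The boundary value at `z₀` of a matrix-valued function of the open half-space. -/
def bdryValue {d : ℕ} {ι κ : Type*} (F : Coord d → Matrix ι κ ℝ) (z₀ : Coord d) :
    Matrix ι κ ℝ :=
  Matrix.of fun i j => limUnder (𝓝[posHalf d] z₀) (fun z => F z i j)

/-! ## Riemannian geometry in coordinates -/

section LocalGeometry

variable {d e : ℕ}

/-- Christoffel symbols `Γ^k_{ij}` of a metric with components `G`. -/
def christoffel (G : Coord d → Matrix (Fin (d + 1)) (Fin (d + 1)) ℝ)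
    (k i j : Fin (d + 1)) (z : Coord d) : ℝ :=
  (1 / 2) * ∑ l, (G z)⁻¹ k l *
    (pd i (fun w => G w l j) z + pd j (fun w => G w i l) z - pd l (fun w => G w i j) z)

/-- Components of the Riemann tensor: `R(∂_i, ∂_j) ∂_k = ∑ l, riemann G l i j k • ∂_l`, where
`R(X, Y) = ∇_X ∇_Y - ∇_Y ∇_X - ∇_{[X, Y]}`. -/
def riemann (G : Coord d → Matrix (Fin (d + 1)) (Fin (d + 1)) ℝ)
    (l i j k : Fin (d + 1)) (z : Coord d) : ℝ :=
  pd i (christoffel G l j k) z - pd j (christoffel G l i k) z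
    + ∑ r, (christoffel G l i r z * christoffel G r j k z
        - christoffel G l j r z * christoffel G r i k z)

/-- The pulled-back Levi-Civita connection: the components of `∇_{∂_i} s`, for a section `s` of
`u^* T N` with components `s^a` in the frame `∂_a`. -/
def pullbackCov (H : Coord e → Matrix (Fin (e + 1)) (Fin (e + 1)) ℝ) (U : Coord d → Coord e)
    (i : Fin (d + 1)) (s : Coord d → Fin (e + 1) → ℝ) (z : Coord d) (a : Fin (e + 1)) : ℝ :=
  pd i (fun w => s w a) z
    + ∑ b, ∑ c, christoffel H a b c (U z) * pd i (fun w => U w b) z * s z c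

/-- The trace `tr_g ∇ η` of the covariant derivative of a `u^* T N`-valued one-form
`η = ∑ η_j dz^j`. -/
def traceCov (G : Coord d → Matrix (Fin (d + 1)) (Fin (d + 1)) ℝ)
    (H : Coord e → Matrix (Fin (e + 1)) (Fin (e + 1)) ℝ) (U : Coord d → Coord e)
    (η : Fin (d + 1) → Coord d → Fin (e + 1) → ℝ) (z : Coord d) (a : Fin (e + 1)) : ℝ :=
  ∑ i, ∑ j, (G z)⁻¹ i j *
    (pullbackCov H U i (η j) z a - ∑ k, christoffel G k i j z * η k z a)

/-- The tension field `τ(u) = tr_g ∇ du`. -/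
def tension (G : Coord d → Matrix (Fin (d + 1)) (Fin (d + 1)) ℝ)
    (H : Coord e → Matrix (Fin (e + 1)) (Fin (e + 1)) ℝ) (U : Coord d → Coord e) :
    Coord d → Fin (e + 1) → ℝ :=
  traceCov G H U fun j z a => pd j (fun w => U w a) z

/-- The Jacobi operator `J_u s = Δ s + tr_g R_h(du, s) du`, where `Δ = ∇^* ∇ = - tr_g ∇ ∇` is the
(positive) rough Laplacian. -/
def jacobi (G : Coord d → Matrix (Fin (d + 1)) (Fin (d + 1)) ℝ)
    (H : Coord e → Matrix (Fin (e + 1)) (Fin (e + 1)) ℝ) (U : Coord d → Coord e)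
    (s : Coord d → Fin (e + 1) → ℝ) (z : Coord d) (a : Fin (e + 1)) : ℝ :=
  - traceCov G H U (fun j => pullbackCov H U j s) z a
    + ∑ i, ∑ j, (G z)⁻¹ i j * ∑ b, ∑ c, ∑ f, riemann H a b c f (U z)
        * pd i (fun w => U w b) z * s z c * pd j (fun w => U w f) z

/-- The tension field as a section of `u^* ⁰TN`: its components in the frame `X ∂_a`, where `X` is
the first coordinate of the target chart. -/
def zeroTension (G : Coord d → Matrix (Fin (d + 1)) (Fin (d + 1)) ℝ)
    (H : Coord e → Matrix (Fin (e + 1)) (Fin (e + 1)) ℝ) (U : Coord d → Coord e)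
    (z : Coord d) (a : Fin (e + 1)) : ℝ :=
  tension G H U z a / U z 0

/-- The Jacobi operator on sections of `u^* ⁰TN`, written in the frame `X ∂_a`. -/
def zeroJacobi (G : Coord d → Matrix (Fin (d + 1)) (Fin (d + 1)) ℝ)
    (H : Coord e → Matrix (Fin (e + 1)) (Fin (e + 1)) ℝ) (U : Coord d → Coord e)
    (s : Coord d → Fin (e + 1) → ℝ) (z : Coord d) (a : Fin (e + 1)) : ℝ :=
  jacobi G H U (fun w b => U w 0 * s w b) z a / U z 0

/-- The components of a metric `G` in the frame `x ∂_x, x ∂_{y 1}, …` of `⁰TM`. -/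
def zeroMetric (G : Coord d → Matrix (Fin (d + 1)) (Fin (d + 1)) ℝ) (z : Coord d) :
    Matrix (Fin (d + 1)) (Fin (d + 1)) ℝ :=
  (z 0) ^ 2 • G z

/-- The `0`-differential `⁰du`: the matrix of `du` in the frames `x ∂_j` and `X ∂_a`. -/
def zeroDiff (U : Coord d → Coord e) (z : Coord d) : Matrix (Fin (e + 1)) (Fin (d + 1)) ℝ :=
  Matrix.of fun a j => (z 0 / U z 0) * pd j (fun w => U w a) z

end LocalGeometry

/-! ## Linear algebra on the fibre of the `0`-tangent bundle at a boundary point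

`K` is the Gram matrix of the metric on the fibre in the frame `x ∂_x, x ∂_{y 1}, …`, so that
`dx / x` is the covector `(1, 0, …, 0)` and its kernel is spanned by the last `d` frame vectors. -/

/-- The squared norm `|dx / x|²`. -/
def conormalSq {d : ℕ} (K : Matrix (Fin (d + 1)) (Fin (d + 1)) ℝ) : ℝ := K⁻¹ 0 0

/-- The vector dual to `dx / x`: it is orthogonal to `ker (dx / x)` and is normalized by
`(dx / x)(ν) = 1`. -/
def normalVec {d : ℕ} (K : Matrix (Fin (d + 1)) (Fin (d + 1)) ℝ) : Fin (d + 1) → ℝ :=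
  fun i => K⁻¹ i 0 / K⁻¹ 0 0

/-- The Gram matrix on `ker (dx / x)` of the metric rescaled by `|dx / x|²` (so that `dx / x` has
norm one). -/
def kerGram {d : ℕ} (K : Matrix (Fin (d + 1)) (Fin (d + 1)) ℝ) : Matrix (Fin d) (Fin d) ℝ :=
  conormalSq K • K.submatrix Fin.succ Fin.succ

/-- `β = D ν_M - ν_N`, for a linear map `D` between fibres with Gram matrices `K`, `K'`. -/
def betaVec {d e : ℕ} (K : Matrix (Fin (d + 1)) (Fin (d + 1)) ℝ)
    (K' : Matrix (Fin (e + 1)) (Fin (e + 1)) ℝ) (D : Matrix (Fin (e + 1)) (Fin (d + 1)) ℝ) :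
    Fin (e + 1) → ℝ :=
  D *ᵥ normalVec K - normalVec K'

/-- `Λ`: the restriction of `D` to a map `ker (dx / x) → ker (dX / X)`. -/
def lambdaMat {d e : ℕ} (D : Matrix (Fin (e + 1)) (Fin (d + 1)) ℝ) : Matrix (Fin e) (Fin d) ℝ :=
  D.submatrix Fin.succ Fin.succ

/-- The adjoint `Λ^* : ker (dX / X) → ker (dx / x)` of `Λ` with respect to the normalized metrics
on the two kernels. -/
def lambdaAdj {d e : ℕ} (K : Matrix (Fin (d + 1)) (Fin (d + 1)) ℝ)
    (K' : Matrix (Fin (e + 1)) (Fin (e + 1)) ℝ) (D : Matrix (Fin (e + 1)) (Fin (d + 1)) ℝ) :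
    Matrix (Fin d) (Fin e) ℝ :=
  (kerGram K)⁻¹ * (lambdaMat D)ᵀ * kerGram K'

/-! ## Indicial roots of second order `0`-differential operators -/

section Indicial

variable {d r : ℕ}

/-- For a `0`-differential operator `L = ∑ L_{j,α}(z) (x ∂_x)^j (x ∂_y)^α` of order `≤ 2` acting on
sections of a bundle with a fixed local frame of rank `r`, the matrix `L_{j,0}(z)`, for `j ≤ 2`. It
is read off by applying `L` to the sections `(log (x / x(z)))^j / j! • E_b`, because
`(x ∂_x)^k (log (x / x(z)))^j / j!` equals `1` at `z` if `k = j` and `0` at `z` otherwise, and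
`x ∂_y` annihilates these sections. -/
def zeroCoeff (L : (Coord d → Fin r → ℝ) → Coord d → Fin r → ℝ) (j : ℕ) (z : Coord d) :
    Matrix (Fin r) (Fin r) ℝ :=
  Matrix.of fun a b =>
    L (fun w c => if c = b then (Real.log (w 0 / z 0)) ^ j / (j.factorial : ℝ) else 0) z a

/-- `P 0 + P 1 ζ + P 2 ζ²` is the indicial polynomial at the boundary point `z₀` of the operator
`L` of order `≤ 2`: the matrices `P j` are the boundary values at `z₀` of the coefficients
`L_{j,0}`. -/
def HasIndicialPolynomial (L : (Coord d → Fin r → ℝ) → Coord d → Fin r → ℝ) (z₀ : Coord d)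
    (P : Fin 3 → Matrix (Fin r) (Fin r) ℝ) : Prop :=
  ∀ j : Fin 3, Tendsto (zeroCoeff L j) (𝓝[posHalf d] z₀) (𝓝 (P j))

/-- The value at `ζ ∈ ℂ` of the polynomial with matrix coefficients `P`. -/
def indicialEval (P : Fin 3 → Matrix (Fin r) (Fin r) ℝ) (ζ : ℂ) : Matrix (Fin r) (Fin r) ℂ :=
  ∑ j : Fin 3, ζ ^ (j : ℕ) • (P j).map Complex.ofReal

/-- `Z ⊆ ℂ` is the set of indicial roots of `L` at the boundary point `z₀`. -/
def HasIndicialRoots (L : (Coord d → Fin r → ℝ) → Coord d → Fin r → ℝ) (z₀ : Coord d)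
    (Z : Set ℂ) : Prop :=
  ∃ P, HasIndicialPolynomial L z₀ P ∧ {ζ | ¬ IsUnit (indicialEval P ζ)} = Z

end Indicial

/-! ## Manifolds with boundary, conformally compact metrics, simple `b`-maps -/

section Manifold

variable {d : ℕ} {M : Type*} [TopologicalSpace M] [ChartedSpace (EuclideanHalfSpace (d + 1)) M]

/-- The smooth charts of `M` (half-space coordinates). -/
def smoothCharts (d : ℕ) (M : Type*) [TopologicalSpace M]
    [ChartedSpace (EuclideanHalfSpace (d + 1)) M] :
    Set (OpenPartialHomeomorph M (EuclideanHalfSpace (d + 1))) :=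
  IsManifold.maximalAtlas (𝓡∂ (d + 1)) ∞ M

/-- The coordinate map of a chart, with values in `ℝ ^ (d + 1)`. -/
def toCoord (φ : OpenPartialHomeomorph M (EuclideanHalfSpace (d + 1))) (p : M) : Coord d :=
  φ.extend (𝓡∂ (d + 1)) p

/-- The inverse of the coordinate map of a chart. -/
def ofCoord (φ : OpenPartialHomeomorph M (EuclideanHalfSpace (d + 1))) (z : Coord d) : M :=
  (φ.extend (𝓡∂ (d + 1))).symm z

/-- The image of a chart in `ℝ ^ (d + 1)`; it is contained in `{0 ≤ x}`. -/
def coordTarget (φ : OpenPartialHomeomorph M (EuclideanHalfSpace (d + 1))) : Set (Coord d) :=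
  (φ.extend (𝓡∂ (d + 1))).target

/-- The tangent vector `∂_i` of a chart, at the point with coordinates `z`. -/
def chartVec (φ : OpenPartialHomeomorph M (EuclideanHalfSpace (d + 1))) (i : Fin (d + 1))
    (z : Coord d) : TangentSpace (𝓡∂ (d + 1)) (ofCoord φ z) :=
  mfderivWithin 𝓘(ℝ, Coord d) (𝓡∂ (d + 1)) (ofCoord φ) (range (𝓡∂ (d + 1))) z (basisVec i)

/-- The components `g(∂_i, ∂_j)` in a chart of a family `g` of bilinear forms on the tangent
spaces. -/
def chartMetric (g : ∀ p : M, LinearMap.BilinForm ℝ (TangentSpace (𝓡∂ (d + 1)) p))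
    (φ : OpenPartialHomeomorph M (EuclideanHalfSpace (d + 1))) (z : Coord d) :
    Matrix (Fin (d + 1)) (Fin (d + 1)) ℝ :=
  Matrix.of fun i j => g (ofCoord φ z) (chartVec φ i z) (chartVec φ j z)

/-- `g` is a conformally compact metric on `M`: a smooth Riemannian metric on the interior
such that `x² g` extends to a polyhomogeneous metric up to the boundary, i.e. the components
`x² g(∂_i, ∂_j)` in half-space coordinates are polyhomogeneous and their boundary values form a
positive definite matrix. (The values of `g` at boundary points are irrelevant.) -/
structure IsConformallyCompact
    (g : ∀ p : M, LinearMap.BilinForm ℝ (TangentSpace (𝓡∂ (d + 1)) p)) : Prop where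
  symm : ∀ p ∈ (𝓡∂ (d + 1)).interior M, ∀ v w, g p v w = g p w v
  pos : ∀ p ∈ (𝓡∂ (d + 1)).interior M, ∀ v, v ≠ 0 → 0 < g p v v
  smooth : ∀ φ ∈ smoothCharts d M, ∀ i j,
    ContDiffOn ℝ ∞ (fun z => chartMetric g φ z i j) (coordTarget φ ∩ posHalf d)
  phg : ∀ φ ∈ smoothCharts d M, ∀ z₀ ∈ coordTarget φ, z₀ 0 = 0 → ∀ i j,
    IsPhgAt (fun z => zeroMetric (chartMetric g φ) z i j) z₀
  bdry_posDef : ∀ φ ∈ smoothCharts d M, ∀ z₀ ∈ coordTarget φ, z₀ 0 = 0 →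
    (bdryValue (zeroMetric (chartMetric g φ)) z₀).PosDef

variable {e : ℕ} {N : Type*} [TopologicalSpace N] [ChartedSpace (EuclideanHalfSpace (e + 1)) N]

/-- The coordinate expression of a map in charts of source and target. -/
def chartMap (u : M → N) (φ : OpenPartialHomeomorph M (EuclideanHalfSpace (d + 1)))
    (ψ : OpenPartialHomeomorph N (EuclideanHalfSpace (e + 1))) (z : Coord d) : Coord e :=
  toCoord ψ (u (ofCoord φ z))

/-- Simple `b`-maps: polyhomogeneous maps, with polyhomogeneous (bounded) differential, which send
the interior to the interior and the boundary to the boundary, and for which the local boundary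
defining functions of `N` pull back to local boundary defining functions of `M`: the
first component `u⁰` of `u` satisfies `∂_x u⁰ > 0` at the boundary (transversality to `∂N`). -/
structure IsSimpleBMap (u : M → N) : Prop where
  continuous : Continuous u
  maps_interior : MapsTo u ((𝓡∂ (d + 1)).interior M) ((𝓡∂ (e + 1)).interior N)
  maps_boundary : MapsTo u ((𝓡∂ (d + 1)).boundary M) ((𝓡∂ (e + 1)).boundary N)
  smooth_interior : ContMDiffOn (𝓡∂ (d + 1)) (𝓡∂ (e + 1)) ∞ u ((𝓡∂ (d + 1)).interior M)
  phg : ∀ φ ∈ smoothCharts d M, ∀ ψ ∈ smoothCharts e N, ∀ z₀ ∈ coordTarget φ, z₀ 0 = 0 →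
    u (ofCoord φ z₀) ∈ ψ.source → ∀ a, IsPhgAt (fun z => chartMap u φ ψ z a) z₀
  phg_diff : ∀ φ ∈ smoothCharts d M, ∀ ψ ∈ smoothCharts e N, ∀ z₀ ∈ coordTarget φ, z₀ 0 = 0 →
    u (ofCoord φ z₀) ∈ ψ.source → ∀ a j, IsPhgAt (pd j fun z => chartMap u φ ψ z a) z₀
  transversal : ∀ φ ∈ smoothCharts d M, ∀ ψ ∈ smoothCharts e N, ∀ z₀ ∈ coordTarget φ, z₀ 0 = 0 →
    u (ofCoord φ z₀) ∈ ψ.source →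
      ∃ γ : ℝ, 0 < γ ∧ Tendsto (pd 0 fun z => chartMap u φ ψ z 0) (𝓝[posHalf d] z₀) (𝓝 γ)

/-- `u` is biharmonic: `J_u τ(u) = 0` on the interior of `M`. -/
def IsBiharmonic (g : ∀ p : M, LinearMap.BilinForm ℝ (TangentSpace (𝓡∂ (d + 1)) p))
    (h : ∀ q : N, LinearMap.BilinForm ℝ (TangentSpace (𝓡∂ (e + 1)) q)) (u : M → N) : Prop :=
  ∀ φ ∈ smoothCharts d M, ∀ ψ ∈ smoothCharts e N, ∀ z ∈ coordTarget φ ∩ posHalf d,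
    u (ofCoord φ z) ∈ ψ.source → ∀ a,
      jacobi (chartMetric g φ) (chartMetric h ψ) (chartMap u φ ψ)
        (tension (chartMetric g φ) (chartMetric h ψ) (chartMap u φ ψ)) z a = 0

/-- `u` is asymptotically harmonic: the tension field, as a section of `u^* ⁰TN`, vanishes along
the boundary. -/
def IsAsymptoticallyHarmonic (g : ∀ p : M, LinearMap.BilinForm ℝ (TangentSpace (𝓡∂ (d + 1)) p))
    (h : ∀ q : N, LinearMap.BilinForm ℝ (TangentSpace (𝓡∂ (e + 1)) q)) (u : M → N) : Prop :=
  ∀ p ∈ (𝓡∂ (d + 1)).boundary M, ∀ φ ∈ smoothCharts d M, ∀ ψ ∈ smoothCharts e N,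
    p ∈ φ.source → u p ∈ ψ.source → ∀ a,
      Tendsto (fun z => zeroTension (chartMetric g φ) (chartMetric h ψ) (chartMap u φ ψ) z a)
        (𝓝[posHalf d] (toCoord φ p)) (𝓝 0)

/-- The tensor `β_u` at `p ∈ ∂M`, in the frame `X ∂_a` of the chart `ψ`. -/
def betaAt (g : ∀ p : M, LinearMap.BilinForm ℝ (TangentSpace (𝓡∂ (d + 1)) p))
    (h : ∀ q : N, LinearMap.BilinForm ℝ (TangentSpace (𝓡∂ (e + 1)) q)) (u : M → N)
    (φ : OpenPartialHomeomorph M (EuclideanHalfSpace (d + 1)))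
    (ψ : OpenPartialHomeomorph N (EuclideanHalfSpace (e + 1))) (p : M) : Fin (e + 1) → ℝ :=
  betaVec (bdryValue (zeroMetric (chartMetric g φ)) (toCoord φ p))
    (bdryValue (zeroMetric (chartMetric h ψ)) (toCoord ψ (u p)))
    (bdryValue (zeroDiff (chartMap u φ ψ)) (toCoord φ p))

/-- The endomorphism `Λ_u^* Λ_u` of `ker (dx / x)` at `p ∈ ∂M`, in the frame `x ∂_{y j}` of the
chart `φ`. -/
def lambdaStarLambdaAt (g : ∀ p : M, LinearMap.BilinForm ℝ (TangentSpace (𝓡∂ (d + 1)) p))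
    (h : ∀ q : N, LinearMap.BilinForm ℝ (TangentSpace (𝓡∂ (e + 1)) q)) (u : M → N)
    (φ : OpenPartialHomeomorph M (EuclideanHalfSpace (d + 1)))
    (ψ : OpenPartialHomeomorph N (EuclideanHalfSpace (e + 1))) (p : M) :
    Matrix (Fin d) (Fin d) ℝ :=
  lambdaAdj (bdryValue (zeroMetric (chartMetric g φ)) (toCoord φ p))
      (bdryValue (zeroMetric (chartMetric h ψ)) (toCoord ψ (u p)))
      (bdryValue (zeroDiff (chartMap u φ ψ)) (toCoord φ p)) *
    lambdaMat (bdryValue (zeroDiff (chartMap u φ ψ)) (toCoord φ p))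

end Manifold

end SimpleBMap

end

/-!
Near a boundary point all data are written in the frames `x ∂_x, x ∂_y` of `⁰TM` and `X ∂_X, X ∂_Y`
of `⁰TN`. In these frames the components of the metrics and of `⁰du` are *zero-regular* (`ZReg`):
they have boundary values, and all their iterated derivatives along `x ∂_x, x ∂_y` tend to zero
there. Bounded polyhomogeneous functions are zero-regular because the expansion has the form
`smooth + O(x ^ δ)` for some `δ > 0` (`IsPhgAt.exists_zReg`). Zero-regular functions form an algebra
that is closed under zero derivatives, composition with `u` and inversion where the boundary value
is nonzero, so the boundary value of any `0`-differential expression is obtained by keeping the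
boundary values `K`, `K'`, `D` of `g`, `h`, `⁰du` and dropping their derivatives. Only the Lie brackets `[x ∂_x, x ∂_y] = x ∂_y` survive:
the Levi-Civita connection and the curvature become those of a metric of constant curvature
`-|dx/x|²` (`zReg_christoffel`, `zReg_riemann`).

Put `κ = |dx/x|²` and `κ' = |dX/X|²` (entries `(0, 0)` of `K⁻¹`, `K'⁻¹`), let `n'` be the vector
dual to `dX/X` with respect to `K'`, let `w` be the image under `⁰du` of the vector dual to `dx/x`,
and let `E = |⁰du|²`. The boundary value of the tension field is `τ = E n' - (m + 1) w`
(`BoundaryModel.zReg_zeroTension`). The biharmonic map equation becomes `P₀ τ = 0`, where `P₀` is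
the indicial polynomial of the Jacobi operator at zero (`BoundaryModel.jacobiLim_tensionLim`). Its
component transversal to `n'` forces `w` to be a multiple of `n'`, which means `β = 0`. The rest is
the quadratic equation `(E κ' - κ) (E κ' - (m + 1) κ) = 0`, so the normalized tangential energy
`tr (Λ^* Λ)` is `0` or `m` (`BoundaryModel.dichotomy`). In the second case `τ = 0`, and the indicial
polynomial is `κ` times a rank one perturbation of a multiple of the identity, whose determinant has
the stated roots (`BoundaryModel.hasIndicialRoots`).

It remains to exclude the first case. The normalized energy density extends continuously to the
boundary and takes only the values `1` and `m + 1` there, so both alternatives are open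
(`eventually_tangentialEnergyAt_iff`). The first one holds at a boundary point exactly if `u` is
constant on the boundary near that point (`isLocallyConstAt_iff_tangentialEnergyAt`). On a connected
component of `∂M` it therefore holds nowhere or everywhere, and in the latter case `u` is constant
on the component (`eq_of_isLocallyConstAt`).
-/

noncomputable section

namespace SimpleBMap

/-! ### Zero derivatives and zero-regular functions -/

section ZeroRegular

variable {d : ℕ} {z₀ : Coord d}

/-- The derivative along the `i`-th member `x ∂_i` of the coordinate frame of `⁰TM`. -/
def zD (i : Fin (d + 1)) (f : Coord d → ℝ) (z : Coord d) : ℝ := z 0 * pd i f z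

/-- `f` has the boundary value `c` at `z₀`, and its iterated zero derivatives of orders
`1, …, k` exist near `z₀` in the open half-space and tend to `0` at `z₀`. -/
def ZRegN (z₀ : Coord d) : ℕ → (Coord d → ℝ) → ℝ → Prop
  | 0, f, c => Tendsto f (𝓝[posHalf d] z₀) (𝓝 c)
  | k + 1, f, c => Tendsto f (𝓝[posHalf d] z₀) (𝓝 c) ∧
      (∀ᶠ z in 𝓝[posHalf d] z₀, DifferentiableAt ℝ f z) ∧ ∀ i, ZRegN z₀ k (zD i f) 0

/-- `f` has the boundary value `c` at `z₀`, and all its iterated zero derivatives tend to `0`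
there. To leading order, every zero-differential expression in such functions is obtained by
replacing them with their boundary values. -/
def ZReg (z₀ : Coord d) (f : Coord d → ℝ) (c : ℝ) : Prop := ∀ k, ZRegN z₀ k f c

theorem isOpen_posHalf (d : ℕ) : IsOpen (posHalf d) :=
  isOpen_lt continuous_const (by fun_prop)

theorem mem_posHalf {z : Coord d} : z ∈ posHalf d ↔ 0 < z 0 := Iff.rfl

theorem posHalf_subset : posHalf d ⊆ {z | 0 ≤ z 0} := fun _ hz => (mem_posHalf.1 hz).le

theorem eventually_mem_posHalf : ∀ᶠ z in 𝓝[posHalf d] z₀, z ∈ posHalf d :=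
  eventually_mem_nhdsWithin

/-- An eventual property near the boundary holds, eventually, in a full neighbourhood of each
point, since the half-space is open. -/
theorem eventually_nhds_of_eventually {p : Coord d → Prop}
    (h : ∀ᶠ z in 𝓝[posHalf d] z₀, p z) :
    ∀ᶠ z in 𝓝[posHalf d] z₀, ∀ᶠ w in 𝓝 z, p w := by
  filter_upwards [eventually_eventually_nhdsWithin.2 h, eventually_mem_posHalf] with z hz hz'
  rwa [(isOpen_posHalf d).nhdsWithin_eq hz'] at hz

theorem pd_congr {i : Fin (d + 1)} {f g : Coord d → ℝ} {z : Coord d} (h : f =ᶠ[𝓝 z] g) :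
    pd i f z = pd i g z := by
  unfold pd; rw [h.fderiv_eq]

theorem zD_congr {i : Fin (d + 1)} {f g : Coord d → ℝ} {z : Coord d} (h : f =ᶠ[𝓝 z] g) :
    zD i f z = zD i g z := by
  unfold zD; rw [pd_congr h]

theorem zD_congr_eventually {i : Fin (d + 1)} {f g : Coord d → ℝ}
    (h : f =ᶠ[𝓝[posHalf d] z₀] g) : zD i f =ᶠ[𝓝[posHalf d] z₀] zD i g := by
  filter_upwards [eventually_nhds_of_eventually h] with z hz using zD_congr hz

theorem pd_add {i : Fin (d + 1)} {f g : Coord d → ℝ} {z : Coord d}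
    (hf : DifferentiableAt ℝ f z) (hg : DifferentiableAt ℝ g z) :
    pd i (fun w => f w + g w) z = pd i f z + pd i g z := by
  unfold pd; rw [fderiv_fun_add hf hg]; rfl

theorem pd_mul {i : Fin (d + 1)} {f g : Coord d → ℝ} {z : Coord d}
    (hf : DifferentiableAt ℝ f z) (hg : DifferentiableAt ℝ g z) :
    pd i (fun w => f w * g w) z = f z * pd i g z + g z * pd i f z := by
  unfold pd; rw [fderiv_fun_mul hf hg]; simp

theorem pd_inv {i : Fin (d + 1)} {f : Coord d → ℝ} {z : Coord d}
    (hf : DifferentiableAt ℝ f z) (h0 : f z ≠ 0) :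
    pd i (fun w => (f w)⁻¹) z = -(pd i f z * ((f z)⁻¹ * (f z)⁻¹)) := by
  have h := (hasDerivAt_inv h0).comp_hasFDerivAt z hf.hasFDerivAt
  have h2 : pd i (fun w => (f w)⁻¹) z = _ := congrArg (fun T => T (basisVec i)) h.fderiv
  rw [h2]; simp [pd]; ring

theorem pd_const (i : Fin (d + 1)) (c : ℝ) (z : Coord d) : pd i (fun _ => c) z = 0 := by
  simp [pd]

theorem pd_coord (i j : Fin (d + 1)) (z : Coord d) :
    pd i (fun w => w j) z = if i = j then 1 else 0 := by
  have h : HasFDerivAt (fun w : Coord d => w j) (EuclideanSpace.proj j : Coord d →L[ℝ] ℝ) z :=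
    (EuclideanSpace.proj j : Coord d →L[ℝ] ℝ).hasFDerivAt
  unfold pd; rw [h.fderiv]
  simp [basisVec, eq_comm]

theorem differentiableAt_coord (j : Fin (d + 1)) (z : Coord d) :
    DifferentiableAt ℝ (fun w : Coord d => w j) z := by fun_prop

theorem differentiableAt_inv_coord {z : Coord d} (hz : z 0 ≠ 0) :
    DifferentiableAt ℝ (fun w : Coord d => (w 0)⁻¹) z := (differentiableAt_coord 0 z).inv hz

theorem zD_add {i : Fin (d + 1)} {f g : Coord d → ℝ} {z : Coord d}
    (hf : DifferentiableAt ℝ f z) (hg : DifferentiableAt ℝ g z) :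
    zD i (fun w => f w + g w) z = zD i f z + zD i g z := by
  unfold zD; rw [pd_add hf hg]; ring

theorem zD_mul {i : Fin (d + 1)} {f g : Coord d → ℝ} {z : Coord d}
    (hf : DifferentiableAt ℝ f z) (hg : DifferentiableAt ℝ g z) :
    zD i (fun w => f w * g w) z = f z * zD i g z + g z * zD i f z := by
  unfold zD; rw [pd_mul hf hg]; ring

theorem zD_const (i : Fin (d + 1)) (c : ℝ) (z : Coord d) : zD i (fun _ => c) z = 0 := by
  simp [zD, pd_const]

theorem ZRegN.tendsto {k : ℕ} {f : Coord d → ℝ} {c : ℝ} (h : ZRegN z₀ k f c) :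
    Tendsto f (𝓝[posHalf d] z₀) (𝓝 c) := by
  cases k with
  | zero => exact h
  | succ k => exact h.1

theorem ZRegN.congr {k : ℕ} {f g : Coord d → ℝ} {c : ℝ} (h : ZRegN z₀ k f c)
    (hfg : f =ᶠ[𝓝[posHalf d] z₀] g) : ZRegN z₀ k g c := by
  induction k generalizing f g c with
  | zero => exact Tendsto.congr' hfg h
  | succ k ih =>
    refine ⟨h.1.congr' hfg, ?_, fun i => ih (h.2.2 i) (zD_congr_eventually hfg)⟩
    filter_upwards [h.2.1, eventually_nhds_of_eventually hfg] with z hz hz'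
    exact hz.congr_of_eventuallyEq (EventuallyEq.symm hz')

theorem ZRegN.of_succ {k : ℕ} {f : Coord d → ℝ} {c : ℝ} (h : ZRegN z₀ (k + 1) f c) :
    ZRegN z₀ k f c := by
  induction k generalizing f c with
  | zero => exact h.1
  | succ k ih => exact ⟨h.1, h.2.1, fun i => ih (h.2.2 i)⟩

theorem ZRegN.const (k : ℕ) (c : ℝ) : ZRegN z₀ k (fun _ => c) c := by
  induction k generalizing c with
  | zero => exact tendsto_const_nhds
  | succ k ih =>
    refine ⟨tendsto_const_nhds, by simp, fun i => (ih 0).congr ?_⟩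
    exact Eventually.of_forall fun z => (zD_const i c z).symm

theorem ZRegN.add {k : ℕ} {f g : Coord d → ℝ} {c c' : ℝ} (hf : ZRegN z₀ k f c)
    (hg : ZRegN z₀ k g c') : ZRegN z₀ k (fun z => f z + g z) (c + c') := by
  induction k generalizing f g c c' with
  | zero => exact Tendsto.add hf hg
  | succ k ih =>
    refine ⟨hf.1.add hg.1, ?_, fun i => ?_⟩
    · filter_upwards [hf.2.1, hg.2.1] with z h1 h2 using h1.add h2
    · have := ih (hf.2.2 i) (hg.2.2 i)
      rw [add_zero] at this
      refine this.congr ?_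
      filter_upwards [hf.2.1, hg.2.1] with z h1 h2 using (zD_add h1 h2).symm

theorem ZRegN.mul {k : ℕ} {f g : Coord d → ℝ} {c c' : ℝ} (hf : ZRegN z₀ k f c)
    (hg : ZRegN z₀ k g c') : ZRegN z₀ k (fun z => f z * g z) (c * c') := by
  induction k generalizing f g c c' with
  | zero => exact Tendsto.mul hf hg
  | succ k ih =>
    refine ⟨hf.1.mul hg.1, ?_, fun i => ?_⟩
    · filter_upwards [hf.2.1, hg.2.1] with z h1 h2 using h1.mul h2
    · have := (ih hf.of_succ (hg.2.2 i)).add (ih hg.of_succ (hf.2.2 i))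
      rw [mul_zero, mul_zero, add_zero] at this
      refine this.congr ?_
      filter_upwards [hf.2.1, hg.2.1] with z h1 h2 using (zD_mul h1 h2).symm

theorem ZRegN.inv {k : ℕ} {f : Coord d → ℝ} {c : ℝ} (hf : ZRegN z₀ k f c) (hc : c ≠ 0) :
    ZRegN z₀ k (fun z => (f z)⁻¹) c⁻¹ := by
  induction k with
  | zero => exact Tendsto.inv₀ hf hc
  | succ k ih =>
    have hne : ∀ᶠ z in 𝓝[posHalf d] z₀, f z ≠ 0 := hf.1.eventually_ne hc
    refine ⟨hf.1.inv₀ hc, ?_, fun i => ?_⟩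
    · filter_upwards [hf.2.1, hne] with z h1 h2 using h1.inv h2
    · have := ((ZRegN.const k (-1)).mul ((hf.2.2 i).mul ((ih hf.of_succ).mul (ih hf.of_succ))))
      rw [zero_mul, mul_zero] at this
      refine this.congr ?_
      filter_upwards [hf.2.1, hne] with z h1 h2
      unfold zD
      rw [pd_inv h1 h2]; ring

namespace ZReg

variable {f g : Coord d → ℝ} {c c' : ℝ}

theorem tendsto (h : ZReg z₀ f c) : Tendsto f (𝓝[posHalf d] z₀) (𝓝 c) := h 0

theorem differentiable (h : ZReg z₀ f c) : ∀ᶠ z in 𝓝[posHalf d] z₀, DifferentiableAt ℝ f z :=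
  (h 1).2.1

theorem zeroDeriv (h : ZReg z₀ f c) (i : Fin (d + 1)) : ZReg z₀ (zD i f) 0 :=
  fun k => (h (k + 1)).2.2 i

theorem congr (h : ZReg z₀ f c) (hfg : f =ᶠ[𝓝[posHalf d] z₀] g) : ZReg z₀ g c :=
  fun k => (h k).congr hfg

theorem const (c : ℝ) : ZReg z₀ (fun _ => c) c := fun k => ZRegN.const k c

theorem add (hf : ZReg z₀ f c) (hg : ZReg z₀ g c') : ZReg z₀ (fun z => f z + g z) (c + c') :=
  fun k => (hf k).add (hg k)

theorem mul (hf : ZReg z₀ f c) (hg : ZReg z₀ g c') : ZReg z₀ (fun z => f z * g z) (c * c') :=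
  fun k => (hf k).mul (hg k)

theorem neg (hf : ZReg z₀ f c) : ZReg z₀ (fun z => -f z) (-c) := by
  have := (ZReg.const (z₀ := z₀) (-1)).mul hf
  simpa using this

theorem sub (hf : ZReg z₀ f c) (hg : ZReg z₀ g c') : ZReg z₀ (fun z => f z - g z) (c - c') := by
  simpa [sub_eq_add_neg] using hf.add hg.neg

theorem inv (hf : ZReg z₀ f c) (hc : c ≠ 0) : ZReg z₀ (fun z => (f z)⁻¹) c⁻¹ :=
  fun k => (hf k).inv hc

theorem sum {ι : Type*} {s : Finset ι} {F : ι → Coord d → ℝ} {C : ι → ℝ}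
    (h : ∀ j ∈ s, ZReg z₀ (F j) (C j)) : ZReg z₀ (fun z => ∑ j ∈ s, F j z) (∑ j ∈ s, C j) := by
  classical
  induction s using Finset.induction_on with
  | empty => simpa using ZReg.const 0
  | insert a s ha ih =>
    simp only [Finset.sum_insert ha]
    exact (h a (by simp)).add (ih fun j hj => h j (by simp [hj]))

theorem prod {ι : Type*} {s : Finset ι} {F : ι → Coord d → ℝ} {C : ι → ℝ}
    (h : ∀ j ∈ s, ZReg z₀ (F j) (C j)) : ZReg z₀ (fun z => ∏ j ∈ s, F j z) (∏ j ∈ s, C j) := by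
  classical
  induction s using Finset.induction_on with
  | empty => simpa using ZReg.const 1
  | insert a s ha ih =>
    simp only [Finset.prod_insert ha]
    exact (h a (by simp)).mul (ih fun j hj => h j (by simp [hj]))

end ZReg

/-- A matrix of zero-regular functions. -/
def ZRegMat {ι κ : Type*} (z₀ : Coord d) (F : Coord d → Matrix ι κ ℝ) (C : Matrix ι κ ℝ) : Prop :=
  ∀ i j, ZReg z₀ (fun z => F z i j) (C i j)

namespace ZRegMat

variable {ι : Type*} [Fintype ι] [DecidableEq ι] {F : Coord d → Matrix ι ι ℝ} {C : Matrix ι ι ℝ}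

theorem det (h : ZRegMat z₀ F C) : ZReg z₀ (fun z => (F z).det) C.det := by
  simp only [Matrix.det_apply']
  exact ZReg.sum fun σ _ => (ZReg.const _).mul (ZReg.prod fun i _ => h _ _)

theorem adjugate (h : ZRegMat z₀ F C) :
    ZRegMat z₀ (fun z => (F z).adjugate) C.adjugate := by
  intro i j
  simp only [Matrix.adjugate_apply]
  refine ZRegMat.det fun k l => ?_
  simp only [Matrix.updateRow_apply]
  split_ifs
  · exact ZReg.const _
  · exact h k l

theorem inv (h : ZRegMat z₀ F C) (hC : C.det ≠ 0) : ZRegMat z₀ (fun z => (F z)⁻¹) C⁻¹ := by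
  intro i j
  simp only [Matrix.inv_def, Ring.inverse_eq_inv', Matrix.smul_apply, smul_eq_mul]
  exact (h.det.inv hC).mul (h.adjugate i j)

end ZRegMat

end ZeroRegular

/-! ### Polyhomogeneous functions are zero-regular -/

section Polyhomogeneous

variable {d : ℕ} {z₀ : Coord d}

theorem uniqueDiffOn_inter_halfSpace {V : Set (Coord d)} (hV : IsOpen V) :
    UniqueDiffOn ℝ (V ∩ {z | 0 ≤ z 0}) := by
  have h : UniqueDiffOn ℝ (range (𝓡∂ (d + 1))) := (𝓡∂ (d + 1)).uniqueDiffOn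
  rw [range_modelWithCornersEuclideanHalfSpace] at h
  rw [inter_comm]
  exact h.inter hV

/-- Functions smooth up to the boundary are zero-regular. -/
theorem ZReg.of_contDiffOn {V : Set (Coord d)} (hV : IsOpen V) (hz : z₀ ∈ V) (h0 : z₀ 0 = 0)
    {a : Coord d → ℝ} (ha : ContDiffOn ℝ ∞ a (V ∩ {z | 0 ≤ z 0})) : ZReg z₀ a (a z₀) := by
  intro k
  have hev : ∀ᶠ z in 𝓝[posHalf d] z₀, V ∩ {z | 0 ≤ z 0} ∈ 𝓝 z := by
    filter_upwards [eventually_mem_posHalf,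
      eventually_nhdsWithin_of_eventually_nhds (hV.eventually_mem hz)] with z h1 h2
    exact inter_mem (hV.mem_nhds h2)
      (mem_of_superset ((isOpen_posHalf d).mem_nhds h1) posHalf_subset)
  induction k generalizing a with
  | zero =>
    have h1 : Tendsto a (𝓝[V ∩ {z | 0 ≤ z 0}] z₀) (𝓝 (a z₀)) :=
      ha.continuousOn z₀ ⟨hz, h0.ge⟩
    refine h1.mono_left (nhdsWithin_le_iff.2 ?_)
    filter_upwards [hev] with z hz using mem_of_mem_nhds hz
  | succ k ih =>
    refine ⟨(ih ha).tendsto, ?_, fun i => ?_⟩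
    · filter_upwards [hev] with z hz
      exact (ha.contDiffAt hz).differentiableAt (by simp)
    · have hu := uniqueDiffOn_inter_halfSpace (d := d) hV
      have h1 : ContDiffOn ℝ ∞ (fun z : Coord d =>
          z 0 * fderivWithin ℝ a (V ∩ {z | 0 ≤ z 0}) z (basisVec i)) (V ∩ {z | 0 ≤ z 0}) := by
        refine ContDiffOn.mul (by fun_prop) ?_
        exact (ha.fderivWithin hu (m := ∞) (by simp)).clm_apply contDiffOn_const
      have h2 := ih h1
      rw [h0, zero_mul] at h2
      refine h2.congr ?_
      filter_upwards [hev] with z hz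
      simp only [zD, pd, fderivWithin_of_mem_nhds hz]

theorem bDerivs_cons (i : Fin (d + 1)) (L : List (Fin (d + 1))) (f : Coord d → ℝ) :
    bDerivs (i :: L) f = bDeriv i (bDerivs L f) := rfl

theorem bDerivs_append_singleton (i : Fin (d + 1)) (L : List (Fin (d + 1))) (f : Coord d → ℝ) :
    bDerivs (L ++ [i]) f = bDerivs L (bDeriv i f) := by
  simp [bDerivs]

theorem contDiffOn_bDeriv {S : Set (Coord d)} (hS : IsOpen S) {f : Coord d → ℝ}
    (hf : ContDiffOn ℝ ∞ f S) (i : Fin (d + 1)) : ContDiffOn ℝ ∞ (bDeriv i f) S := by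
  have hp : ∀ j, ContDiffOn ℝ ∞ (pd j f) S := fun j =>
    (hf.fderiv_of_isOpen hS (m := ∞) (by simp)).clm_apply contDiffOn_const
  unfold bDeriv
  by_cases hi : i = 0
  · simp only [hi, if_true]
    exact ContDiffOn.mul (by fun_prop) (hp 0)
  · simp only [hi, if_false]
    exact hp i

theorem contDiffOn_bDerivs {S : Set (Coord d)} (hS : IsOpen S) {f : Coord d → ℝ}
    (hf : ContDiffOn ℝ ∞ f S) (L : List (Fin (d + 1))) : ContDiffOn ℝ ∞ (bDerivs L f) S := by
  induction L with
  | nil => exact hf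
  | cons i L ih => exact contDiffOn_bDeriv hS ih i

theorem bDeriv_eqOn {S : Set (Coord d)} (hS : IsOpen S) {f g : Coord d → ℝ} (h : EqOn f g S)
    (i : Fin (d + 1)) : EqOn (bDeriv i f) (bDeriv i g) S := by
  intro z hz
  have h1 : f =ᶠ[𝓝 z] g := h.eventuallyEq_of_mem (hS.mem_nhds hz)
  simp only [bDeriv, pd_congr h1]

theorem bDerivs_eqOn {S : Set (Coord d)} (hS : IsOpen S) {f g : Coord d → ℝ} (h : EqOn f g S)
    (L : List (Fin (d + 1))) : EqOn (bDerivs L f) (bDerivs L g) S := by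
  induction L with
  | nil => exact h
  | cons i L ih => exact bDeriv_eqOn hS ih i

theorem bDerivs_add {S : Set (Coord d)} (hS : IsOpen S) {f g : Coord d → ℝ}
    (hf : ContDiffOn ℝ ∞ f S) (hg : ContDiffOn ℝ ∞ g S) (L : List (Fin (d + 1))) :
    EqOn (bDerivs L (fun z => f z + g z)) (fun z => bDerivs L f z + bDerivs L g z) S := by
  induction L with
  | nil => exact fun z _ => rfl
  | cons i L ih =>
    intro z hz
    rw [bDerivs_cons, bDeriv_eqOn hS ih i hz]
    have h1 := ((contDiffOn_bDerivs hS hf L).contDiffAt (hS.mem_nhds hz)).differentiableAt (by simp)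
    have h2 := ((contDiffOn_bDerivs hS hg L).contDiffAt (hS.mem_nhds hz)).differentiableAt (by simp)
    simp only [bDeriv, bDerivs_cons, pd_add h1 h2]
    split_ifs <;> ring

/-- `r` is smooth on `S` and `O(x ^ δ)` there, together with all its tangential derivatives. -/
def IsConormal (S : Set (Coord d)) (δ : ℝ) (r : Coord d → ℝ) : Prop :=
  ContDiffOn ℝ ∞ r S ∧ ∀ L, ∃ C, ∀ z ∈ S, |bDerivs L r z| ≤ C * (z 0) ^ δ

theorem IsConormal.bDeriv {S : Set (Coord d)} (hS : IsOpen S) {δ : ℝ} {r : Coord d → ℝ}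
    (h : IsConormal S δ r) (i : Fin (d + 1)) : IsConormal S δ (bDeriv i r) := by
  refine ⟨contDiffOn_bDeriv hS h.1 i, fun L => ?_⟩
  obtain ⟨C, hC⟩ := h.2 (L ++ [i])
  exact ⟨C, fun z hz => by rw [← bDerivs_append_singleton]; exact hC z hz⟩

theorem IsConormal.coord_mul {S : Set (Coord d)} (hS : IsOpen S)
    (hS1 : ∀ z ∈ S, 0 < z 0 ∧ z 0 < 1) {δ : ℝ} {r : Coord d → ℝ}
    (h : IsConormal S δ r) : IsConormal S δ (fun z => z 0 * r z) := by
  refine ⟨ContDiffOn.mul (by fun_prop) h.1, fun L => ?_⟩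
  induction L using List.reverseRecOn generalizing r with
  | nil =>
    obtain ⟨C, hC⟩ := h.2 []
    refine ⟨C, fun z hz => ?_⟩
    have h1 : |z 0 * r z| ≤ |r z| := by
      rw [abs_mul, abs_of_pos (hS1 z hz).1]
      exact mul_le_of_le_one_left (abs_nonneg _) (hS1 z hz).2.le
    exact h1.trans (hC z hz)
  | append_singleton L i ih =>
    by_cases hi : i = 0
    · subst hi
      -- The commutator with `x` produces a second term: `x ∂_x (x r) = x r + x (x ∂_x r)`.
      obtain ⟨C, hC⟩ := ih h
      obtain ⟨C', hC'⟩ := ih (h.bDeriv hS 0)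
      refine ⟨C + C', fun z hz => ?_⟩
      have heq : EqOn (SimpleBMap.bDeriv 0 fun z => z 0 * r z)
          (fun z => z 0 * r z + z 0 * SimpleBMap.bDeriv 0 r z) S := by
        intro w hw
        have h1 := (h.1.contDiffAt (hS.mem_nhds hw)).differentiableAt (by simp)
        simp only [SimpleBMap.bDeriv, if_true, pd_mul (differentiableAt_coord 0 w) h1, pd_coord]
        ring
      rw [bDerivs_append_singleton, bDerivs_eqOn hS heq L hz,
        bDerivs_add hS (ContDiffOn.mul (by fun_prop) h.1)
          (ContDiffOn.mul (by fun_prop) (h.bDeriv hS 0).1) L hz, add_mul]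
      exact (abs_add_le _ _).trans (add_le_add (hC z hz) (hC' z hz))
    · obtain ⟨C, hC⟩ := ih (h.bDeriv hS i)
      refine ⟨C, fun z hz => ?_⟩
      have heq : EqOn (SimpleBMap.bDeriv i fun z => z 0 * r z)
          (fun z => z 0 * SimpleBMap.bDeriv i r z) S := by
        intro w hw
        have h1 := (h.1.contDiffAt (hS.mem_nhds hw)).differentiableAt (by simp)
        simp only [SimpleBMap.bDeriv, hi, if_false, pd_mul (differentiableAt_coord 0 w) h1,
          pd_coord]
        ring
      rw [bDerivs_append_singleton, bDerivs_eqOn hS heq L hz]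
      exact hC z hz

/-- Conormal functions of positive order are zero-regular with boundary value `0`. -/
theorem IsConormal.zReg {V : Set (Coord d)} (hV : IsOpen V) (hz : z₀ ∈ V) (h0 : z₀ 0 = 0)
    (hV1 : ∀ z ∈ V, z 0 < 1) {δ : ℝ} (hδ : 0 < δ) {r : Coord d → ℝ}
    (h : IsConormal (V ∩ posHalf d) δ r) : ZReg z₀ r 0 := by
  have hS : IsOpen (V ∩ posHalf d) := hV.inter (isOpen_posHalf d)
  have hev : ∀ᶠ z in 𝓝[posHalf d] z₀, z ∈ V ∩ posHalf d := by
    filter_upwards [eventually_mem_posHalf,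
      eventually_nhdsWithin_of_eventually_nhds (hV.eventually_mem hz)] with z h1 h2 using ⟨h2, h1⟩
  intro k
  induction k generalizing r with
  | zero =>
    obtain ⟨C, hC⟩ := h.2 []
    have h1 : Tendsto (fun z : Coord d => C * (z 0) ^ δ) (𝓝[posHalf d] z₀) (𝓝 0) := by
      have h2 : Continuous fun z : Coord d => C * (z 0) ^ δ :=
        continuous_const.mul ((by fun_prop : Continuous fun z : Coord d => z 0).rpow_const
          fun _ => Or.inr hδ.le)
      have h3 := (h2.tendsto z₀).mono_left (nhdsWithin_le_nhds (s := posHalf d))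
      simpa [h0, Real.zero_rpow hδ.ne'] using h3
    exact squeeze_zero_norm' (hev.mono fun z hz => hC z hz) h1
  | succ k ih =>
    refine ⟨(ih h).tendsto, ?_, fun i => ?_⟩
    · filter_upwards [hev] with z hz
      exact (h.1.contDiffAt (hS.mem_nhds hz)).differentiableAt (by simp)
    · by_cases hi : i = 0
      · subst hi
        refine (ih (h.bDeriv hS 0)).congr (Eventually.of_forall fun z => ?_)
        simp [SimpleBMap.bDeriv, zD]
      · -- `x ∂_y = x · ∂_y`, and `∂_y` is tangent to the boundary.
        refine (ih ((h.bDeriv hS i).coord_mul hS fun z hz => ⟨hz.2, hV1 z hz.1⟩)).congr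
          (Eventually.of_forall fun z => ?_)
        simp [SimpleBMap.bDeriv, zD, hi]

/-- Truncating the expansion below the first positive exponent: a bounded polyhomogeneous function
is the sum of a function smooth up to the boundary and a conormal function of positive order. -/
theorem IsPhgAt.exists_smooth_add_conormal {f : Coord d → ℝ} (h : IsPhgAt f z₀) :
    ∃ (a : Coord d → ℝ) (V : Set (Coord d)) (δ : ℝ), 0 < δ ∧ IsOpen V ∧ z₀ ∈ V ∧
      ContDiffOn ℝ ∞ a (V ∩ {z | 0 ≤ z 0}) ∧
      IsConormal (V ∩ posHalf d) δ (fun z => f z - a z) := by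
  classical
  obtain ⟨S, a, V, hV, hz, ha, hf, hr⟩ := h
  -- Finitely many exponents are at most `1`, so some `δ > 0` lies below all the positive ones.
  obtain ⟨δ, hδ, hδ1⟩ : ∃ δ : ℝ, 0 < δ ∧ ∀ e ∈ S.carrier, e.1 ≤ δ → e.1 = 0 := by
    have h1 : ∀ᶠ δ : ℝ in 𝓝[>] 0, ∀ e ∈ {e ∈ S.carrier | e.1 ≤ 1}, e.1 ≤ δ → e.1 = 0 := by
      rw [eventually_all_finite (S.finite_le 1)]
      intro e he
      rcases (S.nonneg e he.1).eq_or_lt with h | h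
      · exact Eventually.of_forall fun _ _ => h.symm
      · filter_upwards [Ioo_mem_nhdsGT h] with δ hδ hle
        exact absurd hle (not_le.2 hδ.2)
    obtain ⟨δ, h2, h3⟩ := (h1.and (Ioo_mem_nhdsGT (zero_lt_one' ℝ))).exists
    exact ⟨δ, h3.1, fun e he hle => h2 e ⟨he, hle.trans h3.2.le⟩ hle⟩
  -- The truncation at order `δ` is the single term of exponent `0`, which has no logarithm.
  have htr : ∃ b : Coord d → ℝ, ContDiffOn ℝ ∞ b (V ∩ {z | 0 ≤ z 0}) ∧
      ∀ z, phgTruncation S a δ z = b z := by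
    by_cases h0 : ((0 : ℝ), 0) ∈ S.carrier
    · refine ⟨a (0, 0), ha _ h0, fun z => ?_⟩
      have : (S.finite_le δ).toFinset = {((0 : ℝ), 0)} := by
        ext e
        simp only [Finite.mem_toFinset, Finset.mem_singleton]
        constructor
        · rintro ⟨he, hle⟩
          have h1 := hδ1 e he hle
          exact Prod.ext h1 (S.no_leading_log e he h1)
        · rintro rfl
          exact ⟨h0, hδ.le⟩
      simp [phgTruncation, this]
    · refine ⟨fun _ => 0, contDiffOn_const, fun z => ?_⟩
      have : (S.finite_le δ).toFinset = ∅ := by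
        ext e
        simp only [Finite.mem_toFinset, Finset.notMem_empty, iff_false]
        rintro ⟨he, hle⟩
        have h1 := hδ1 e he hle
        exact h0 ((Prod.ext h1 (S.no_leading_log e he h1) : e = (0, 0)) ▸ he)
      simp [phgTruncation, this]
  obtain ⟨b, hb, hbe⟩ := htr
  refine ⟨b, V, δ, hδ, hV, hz, hb, hf.sub (hb.mono (inter_subset_inter_right V posHalf_subset)),
    fun L => ?_⟩
  obtain ⟨C, hC⟩ := hr δ L
  refine ⟨C, fun z hz => ?_⟩
  have := hC z hz
  simpa only [hbe] using this

theorem IsPhgAt.exists_zReg {f : Coord d → ℝ} (h : IsPhgAt f z₀) (h0 : z₀ 0 = 0) :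
    ∃ c, ZReg z₀ f c := by
  obtain ⟨a, V, δ, hδ, hV, hz, ha, hr⟩ := h.exists_smooth_add_conormal
  have hW : IsOpen (V ∩ {z | z 0 < 1}) := hV.inter (isOpen_lt (by fun_prop) continuous_const)
  have h1 : IsConormal ((V ∩ {z | z 0 < 1}) ∩ posHalf d) δ (fun z => f z - a z) :=
    ⟨hr.1.mono fun w hw => ⟨hw.1.1, hw.2⟩, fun L => by
      obtain ⟨C, hC⟩ := hr.2 L
      exact ⟨C, fun z hz => hC z ⟨hz.1.1, hz.2⟩⟩⟩
  have h2 := h1.zReg hW ⟨hz, by simp [h0]⟩ h0 (fun z hz => hz.2) hδ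
  exact ⟨a z₀ + 0, ((ZReg.of_contDiffOn hV hz h0 ha).add h2).congr
    (Eventually.of_forall fun z => by ring)⟩

end Polyhomogeneous

/-! ### Boundary values of first derivatives -/

section BoundaryDerivative

variable {d : ℕ} {z₀ : Coord d}

theorem nhdsWithin_posHalf_neBot (h0 : 0 ≤ z₀ 0) : (𝓝[posHalf d] z₀).NeBot := by
  rw [← mem_closure_iff_nhdsWithin_neBot]
  have : closure (posHalf d) = {z | 0 ≤ z 0} := closure_open_halfSpace 2 0 0
  rw [this]
  exact h0

/-- The orthogonal projection to the boundary hyperplane. -/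
def bdryProj (d : ℕ) : Coord d →L[ℝ] Coord d :=
  ContinuousLinearMap.id ℝ (Coord d) -
    (EuclideanSpace.proj 0 : Coord d →L[ℝ] ℝ).smulRight (basisVec 0)

theorem bdryProj_apply (z : Coord d) : bdryProj d z = z - z 0 • basisVec 0 := by
  simp [bdryProj]

@[simp]
theorem bdryProj_coord (z : Coord d) (i : Fin (d + 1)) :
    bdryProj d z i = if i = 0 then 0 else z i := by
  rw [bdryProj_apply]
  by_cases hi : i = 0 <;> simp [basisVec, hi]

theorem bdryProj_eq_self {z : Coord d} (h0 : z 0 = 0) : bdryProj d z = z := by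
  simp [bdryProj_apply, h0]

theorem norm_bdryProj_le (z : Coord d) : ‖bdryProj d z‖ ≤ ‖z‖ := by
  rw [EuclideanSpace.norm_eq, EuclideanSpace.norm_eq]
  refine Real.sqrt_le_sqrt (Finset.sum_le_sum fun i _ => ?_)
  rw [bdryProj_coord]
  split_ifs
  · simp [sq_nonneg]
  · exact le_rfl

theorem bdryProj_mem_ball (h0 : z₀ 0 = 0) {r : ℝ} {z : Coord d} (hz : z ∈ Metric.ball z₀ r) :
    bdryProj d z ∈ Metric.ball z₀ r := by
  rw [mem_ball_iff_norm] at hz ⊢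
  rw [← bdryProj_eq_self h0, ← map_sub]
  exact (norm_bdryProj_le _).trans_lt hz

theorem sum_smul_proj_apply (c : Fin (d + 1) → ℝ) (v : Coord d) :
    (∑ j, c j • (EuclideanSpace.proj j : Coord d →L[ℝ] ℝ)) v = ∑ j, c j * v j := by
  simp

theorem fderiv_eq_sum_pd (f : Coord d → ℝ) (z : Coord d) :
    fderiv ℝ f z = ∑ j, pd j f z • (EuclideanSpace.proj j : Coord d →L[ℝ] ℝ) := by
  ext v
  rw [sum_smul_proj_apply]
  have hv : v = ∑ j, v j • basisVec j := by
    ext i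
    simp [basisVec, Pi.single_apply]
  conv_lhs => rw [hv]
  rw [map_sum]
  exact Finset.sum_congr rfl fun j _ => by simp [pd, mul_comm]

/-- A function that is continuous up to the boundary and whose partial derivatives have limits at
a boundary point is differentiable there, within the closed half-space. -/
theorem hasFDerivWithinAt_of_tendsto_pd {f : Coord d → ℝ} {V : Set (Coord d)} (hV : IsOpen V)
    (hz : z₀ ∈ V) (hc : ContinuousOn f (V ∩ {z | 0 ≤ z 0}))
    (hd : DifferentiableOn ℝ f (V ∩ posHalf d)) {c : Fin (d + 1) → ℝ}
    (h : ∀ j, Tendsto (pd j f) (𝓝[posHalf d] z₀) (𝓝 (c j))) :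
    HasFDerivWithinAt f (∑ j, c j • (EuclideanSpace.proj j : Coord d →L[ℝ] ℝ))
      {z | 0 ≤ z 0} z₀ := by
  obtain ⟨r, hr, hrV⟩ := Metric.nhds_basis_closedBall.mem_iff.1 (hV.mem_nhds hz)
  have hcl : closure (posHalf d) = {z | 0 ≤ z 0} := closure_open_halfSpace 2 0 0
  have hconv : Convex ℝ (posHalf d) :=
    convex_halfSpace_gt (f := fun z : Coord d => z 0) ⟨fun _ _ => rfl, fun _ _ => rfl⟩ 0
  have hsub : Metric.ball z₀ r ∩ posHalf d ⊆ V ∩ {z | 0 ≤ z 0} :=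
    inter_subset_inter (Metric.ball_subset_closedBall.trans hrV) posHalf_subset
  have key := hasFDerivWithinAt_closure_of_tendsto_fderiv (f := f) (x := z₀)
    (s := Metric.ball z₀ r ∩ posHalf d)
    (f' := ∑ j, c j • (EuclideanSpace.proj j : Coord d →L[ℝ] ℝ))
    (hd.mono (inter_subset_inter_left _ (Metric.ball_subset_closedBall.trans hrV)))
    ((convex_ball _ _).inter hconv) (Metric.isOpen_ball.inter (isOpen_posHalf d))
    (fun y hy => by
      have h1 : y ∈ Metric.closedBall z₀ r :=
        Metric.closure_ball_subset_closedBall (closure_mono inter_subset_left hy)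
      have h2 : y ∈ {z : Coord d | 0 ≤ z 0} := hcl ▸ closure_mono inter_subset_right hy
      exact (hc y ⟨hrV h1, h2⟩).mono hsub)
    (by
      have h1 : Tendsto (fun z => ∑ j, pd j f z • (EuclideanSpace.proj j : Coord d →L[ℝ] ℝ))
          (𝓝[posHalf d] z₀) (𝓝 (∑ j, c j • (EuclideanSpace.proj j : Coord d →L[ℝ] ℝ))) :=
        tendsto_finsetSum _ fun j _ => (h j).smul_const _
      refine (h1.congr fun z => (fderiv_eq_sum_pd f z).symm).mono_left ?_
      exact nhdsWithin_mono _ inter_subset_right)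
  have hsub2 : Metric.ball z₀ r ∩ {z | 0 ≤ z 0} ⊆ closure (Metric.ball z₀ r ∩ posHalf d) :=
    hcl ▸ Metric.isOpen_ball.inter_closure
  refine (key.mono hsub2).mono_of_mem_nhdsWithin ?_
  rw [inter_comm]
  exact inter_mem_nhdsWithin _ (Metric.ball_mem_nhds z₀ hr)

/-- Tangential derivatives of a function that is constant along the boundary vanish there. -/
theorem tangential_limit_eq_zero {f : Coord d → ℝ} {V : Set (Coord d)} (hV : IsOpen V)
    (hz : z₀ ∈ V) (h0 : z₀ 0 = 0) (hc : ContinuousOn f (V ∩ {z | 0 ≤ z 0}))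
    (hd : DifferentiableOn ℝ f (V ∩ posHalf d)) {c : Fin (d + 1) → ℝ}
    (h : ∀ j, Tendsto (pd j f) (𝓝[posHalf d] z₀) (𝓝 (c j)))
    (hconst : ∀ᶠ z in 𝓝 z₀, z 0 = 0 → f z = f z₀) {j : Fin (d + 1)} (hj : j ≠ 0) : c j = 0 := by
  have h1 := hasFDerivWithinAt_of_tendsto_pd hV hz hc hd h
  have hl : HasDerivAt (fun t : ℝ => z₀ + t • basisVec j) (basisVec j) 0 := by
    simpa using ((hasDerivAt_id (0 : ℝ)).smul_const (basisVec j)).const_add z₀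
  have hl0 : ∀ t : ℝ, (z₀ + t • basisVec j : Coord d) 0 = 0 := fun t => by
    simp [basisVec, h0, hj.symm]
  have h2 : HasDerivWithinAt (fun t : ℝ => f (z₀ + t • basisVec j))
      ((∑ j, c j • (EuclideanSpace.proj j : Coord d →L[ℝ] ℝ)) (basisVec j)) univ 0 := by
    refine HasFDerivWithinAt.comp_hasDerivWithinAt (t := {z | 0 ≤ z 0}) (0 : ℝ) ?_
      hl.hasDerivWithinAt fun t _ => (hl0 t).ge
    simpa using h1
  have h3 : (fun t : ℝ => f (z₀ + t • basisVec j)) =ᶠ[𝓝 0] fun _ => f z₀ := by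
    have : Tendsto (fun t : ℝ => z₀ + t • basisVec j) (𝓝 0) (𝓝 z₀) := by
      simpa using hl.continuousAt.tendsto
    filter_upwards [this.eventually hconst] with t ht using ht (hl0 t)
  have h4 := (hasDerivWithinAt_univ.1 h2).unique
    ((hasDerivAt_const (0 : ℝ) (f z₀)).congr_of_eventuallyEq h3)
  rw [sum_smul_proj_apply] at h4
  simpa [basisVec] using h4

/-- Conversely, if the tangential derivatives vanish along the boundary near `z₀`, then the
function is constant along the boundary near `z₀`. -/
theorem const_of_tangential_limit_eq_zero {f : Coord d → ℝ} {V : Set (Coord d)} {r : ℝ}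
    (hV : IsOpen V) (hr : Metric.ball z₀ r ⊆ V) (h0 : z₀ 0 = 0)
    (hc : ContinuousOn f (V ∩ {z | 0 ≤ z 0})) (hd : DifferentiableOn ℝ f (V ∩ posHalf d))
    {c : Coord d → Fin (d + 1) → ℝ}
    (h : ∀ z ∈ Metric.ball z₀ r, z 0 = 0 → ∀ j, Tendsto (pd j f) (𝓝[posHalf d] z) (𝓝 (c z j)))
    (hzero : ∀ z ∈ Metric.ball z₀ r, z 0 = 0 → ∀ j ≠ 0, c z j = 0) :
    ∀ z ∈ Metric.ball z₀ r, z 0 = 0 → f z = f z₀ := by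
  -- The extension of `f` from the boundary that is constant in the normal direction has zero
  -- derivative on the whole ball.
  have hder : ∀ z ∈ Metric.ball z₀ r,
      HasFDerivWithinAt (fun w => f (bdryProj d w)) (0 : Coord d →L[ℝ] ℝ) univ z := by
    intro z hz
    have hpz := bdryProj_mem_ball h0 hz
    have hp0 : bdryProj d z 0 = 0 := by simp
    have h1 := hasFDerivWithinAt_of_tendsto_pd hV (hr hpz) hc hd (h _ hpz hp0)
    have h2 := h1.comp z (bdryProj d).hasFDerivAt.hasFDerivWithinAt
      (fun w (_ : w ∈ univ) => (by simp : (0 : ℝ) ≤ bdryProj d w 0))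
    have h3 : (∑ j, c (bdryProj d z) j • (EuclideanSpace.proj j : Coord d →L[ℝ] ℝ)).comp
        (bdryProj d) = 0 := by
      refine ContinuousLinearMap.ext fun v => ?_
      rw [ContinuousLinearMap.comp_apply, sum_smul_proj_apply]
      refine Finset.sum_eq_zero fun j _ => ?_
      by_cases hj : j = 0
      · simp [hj]
      · simp [hzero _ hpz hp0 j hj]
    rwa [h3] at h2
  intro z hz hz0
  have hz₀ : z₀ ∈ Metric.ball z₀ r := Metric.mem_ball_self (Metric.pos_of_mem_ball hz)
  have h3 := (convex_ball z₀ r).norm_image_sub_le_of_norm_hasFDerivWithin_le (C := 0)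
    (fun w hw => (hder w hw).mono (subset_univ _)) (by simp) hz₀ hz
  rw [bdryProj_eq_self hz0, bdryProj_eq_self h0, zero_mul] at h3
  exact sub_eq_zero.1 (norm_le_zero_iff.1 h3)

/-- If `f` vanishes on the boundary, then `f / x` has the boundary value `∂_x f`. -/
theorem tendsto_div_coord {f : Coord d → ℝ} {V : Set (Coord d)} (hV : IsOpen V)
    (hz : z₀ ∈ V) (h0 : z₀ 0 = 0) (hc : ContinuousOn f (V ∩ {z | 0 ≤ z 0}))
    (hd : DifferentiableOn ℝ f (V ∩ posHalf d)) (hb : ∀ z ∈ V, z 0 = 0 → f z = 0) {γ : ℝ}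
    (h : Tendsto (pd 0 f) (𝓝[posHalf d] z₀) (𝓝 γ)) :
    Tendsto (fun z => f z / z 0) (𝓝[posHalf d] z₀) (𝓝 γ) := by
  rw [Metric.tendsto_nhds]
  intro ε hε
  have h1 : ∀ᶠ z in 𝓝 z₀, z ∈ V ∧ (z ∈ posHalf d → dist (pd 0 f z) γ < ε) :=
    (hV.eventually_mem hz).and (eventually_nhdsWithin_iff.1 (Metric.tendsto_nhds.1 h ε hε))
  obtain ⟨r, hr, hrV⟩ := Metric.eventually_nhds_iff_ball.1 h1
  filter_upwards [eventually_mem_posHalf,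
    eventually_nhdsWithin_of_eventually_nhds (Metric.ball_mem_nhds z₀ hr)] with z hzp hzr
  have hz0 : 0 < z 0 := hzp
  -- The mean value theorem is applied on the segment from the projection of `z` to `z`.
  set p : ℝ → Coord d := fun t => bdryProj d z + t • (z 0 • basisVec 0) with hp
  have hp0 : ∀ t, p t 0 = t * z 0 := fun t => by simp [hp, basisVec]
  have hpr : ∀ t ∈ Icc (0 : ℝ) 1, p t ∈ Metric.ball z₀ r := by
    intro t ht
    have h2 := (convex_ball z₀ r).add_smul_sub_mem (bdryProj_mem_ball h0 hzr) hzr ht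
    convert h2 using 3
    rw [bdryProj_apply, sub_sub_cancel]
  have hpd : ∀ t, HasDerivAt p (z 0 • basisVec 0) t := fun t => by
    have := ((hasDerivAt_id t).smul_const (z 0 • (basisVec 0 : Coord d))).const_add
      (bdryProj d z)
    rwa [one_smul] at this
  have hpos : ∀ t ∈ Ioo (0 : ℝ) 1, p t ∈ posHalf d := fun t ht =>
    mem_posHalf.2 (by rw [hp0]; exact mul_pos ht.1 hz0)
  obtain ⟨t, ht, hteq⟩ := exists_hasDerivAt_eq_slope (fun t => f (p t))
    (fun t => z 0 * pd 0 f (p t)) zero_lt_one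
    (hc.comp (fun t _ => (hpd t).continuousAt.continuousWithinAt) fun t ht =>
      ⟨(hrV _ (hpr t ht)).1, by
        change 0 ≤ p t 0
        rw [hp0]; exact mul_nonneg ht.1 hz0.le⟩)
    (fun t ht => by
      have hm : p t ∈ V ∩ posHalf d := ⟨(hrV _ (hpr t (Ioo_subset_Icc_self ht))).1, hpos t ht⟩
      have h3 := ((hd _ hm).differentiableAt
        ((hV.inter (isOpen_posHalf d)).mem_nhds hm)).hasFDerivAt.comp_hasDerivAt t (hpd t)
      rw [map_smul] at h3
      exact h3)
  have hp1 : p 1 = z := by simp [hp, bdryProj_apply]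
  have hpz : p 0 = bdryProj d z := by simp [hp]
  rw [hp1, hpz, hb _ (hrV _ (bdryProj_mem_ball h0 hzr)).1 (by simp), sub_zero, sub_zero,
    div_one] at hteq
  have h4 : f z / z 0 = pd 0 f (p t) := by
    rw [← hteq]; field_simp
  rw [h4]
  exact (hrV _ (hpr t (Ioo_subset_Icc_self ht))).2 (hpos t ht)

/-- If `f` vanishes on the boundary and has zero-regular partial derivatives, then `f / x` is
zero-regular: `x ∂_x (f / x) = ∂_x f - f / x` and `x ∂_y (f / x) = ∂_y f`. -/
theorem ZReg.div_coord {f : Coord d → ℝ} {V : Set (Coord d)} (hV : IsOpen V)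
    (hz : z₀ ∈ V) (h0 : z₀ 0 = 0) (hc : ContinuousOn f (V ∩ {z | 0 ≤ z 0}))
    (hd : DifferentiableOn ℝ f (V ∩ posHalf d)) (hb : ∀ z ∈ V, z 0 = 0 → f z = 0)
    {c : Fin (d + 1) → ℝ} (h : ∀ j, ZReg z₀ (pd j f) (c j)) :
    ZReg z₀ (fun z => f z / z 0) (c 0) := by
  have ht := tendsto_div_coord hV hz h0 hc hd hb (h 0).tendsto
  have hcj : ∀ j ≠ 0, c j = 0 := fun j hj =>
    tangential_limit_eq_zero hV hz h0 hc hd (fun j => (h j).tendsto)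
      ((hV.eventually_mem hz).mono fun w hw hw0 => by rw [hb w hw hw0, hb z₀ hz h0]) hj
  have hdiff : ∀ᶠ z in 𝓝[posHalf d] z₀, z 0 ≠ 0 ∧ DifferentiableAt ℝ f z := by
    filter_upwards [eventually_mem_posHalf,
      eventually_nhdsWithin_of_eventually_nhds (hV.eventually_mem hz)] with z h1 h2
    exact ⟨(mem_posHalf.1 h1).ne', (hd z ⟨h2, h1⟩).differentiableAt
      ((hV.inter (isOpen_posHalf d)).mem_nhds ⟨h2, h1⟩)⟩
  intro k
  induction k with
  | zero => exact ht
  | succ k ih =>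
    refine ⟨ht, ?_, fun i => ?_⟩
    · filter_upwards [hdiff] with z hz
      simp only [div_eq_mul_inv]
      exact hz.2.mul (differentiableAt_inv_coord hz.1)
    · have hzd : ∀ᶠ z in 𝓝[posHalf d] z₀,
          pd i f z - (if i = 0 then f z / z 0 else 0) = zD i (fun w => f w / w 0) z := by
        filter_upwards [hdiff] with z hz
        simp only [div_eq_mul_inv]
        rw [zD, pd_mul hz.2 (differentiableAt_inv_coord hz.1),
          pd_inv (differentiableAt_coord 0 z) hz.1, pd_coord]
        have := hz.1
        split_ifs <;> field_simp <;> ring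
      refine ZRegN.congr ?_ hzd
      by_cases hi : i = 0
      · subst hi
        have := (h 0 k).add ((ZRegN.const k (-1)).mul ih)
        simp only [if_true]
        convert this using 1
        · ext z; ring
        · ring
      · simp only [hi, if_false, sub_zero]
        have := h i k
        rwa [hcj i hi] at this

end BoundaryDerivative

/-! ### The geometry of the zero frame: metrics -/

section ZeroFrameMetric

variable {d : ℕ} {z₀ : Coord d}

/-- The boundary values of `x Γ^k_{ij}`, for a metric whose components in the zero frame have the
boundary values `K`. -/
def chrLim (K : Matrix (Fin (d + 1)) (Fin (d + 1)) ℝ) (k i j : Fin (d + 1)) : ℝ :=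
  K⁻¹ k 0 * K i j - (if i = 0 then if k = j then 1 else 0 else 0)
    - (if j = 0 then if k = i then 1 else 0 else 0)

/-- The boundary values of `x ^ 2 R`. They are those of the metric of constant curvature
`-|dx / x|²`. -/
def riemLim (K : Matrix (Fin (d + 1)) (Fin (d + 1)) ℝ) (l i j k : Fin (d + 1)) : ℝ :=
  -(K⁻¹ 0 0) * ((if l = i then K j k else 0) - (if l = j then K i k else 0))

theorem metric_inv_eq {G : Coord d → Matrix (Fin (d + 1)) (Fin (d + 1)) ℝ} {z : Coord d}
    (hz : z 0 ≠ 0) (hK : (zeroMetric G z).det ≠ 0) : (G z)⁻¹ = (z 0) ^ 2 • (zeroMetric G z)⁻¹ := by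
  have h : G z = ((z 0) ^ 2)⁻¹ • zeroMetric G z := by
    rw [zeroMetric, smul_smul, inv_mul_cancel₀ (pow_ne_zero 2 hz), one_smul]
  have h2 : IsUnit (zeroMetric G z).det := isUnit_iff_ne_zero.2 hK
  rw [h]
  refine Matrix.inv_eq_right_inv ?_
  rw [Matrix.smul_mul, Matrix.mul_smul, smul_smul, Matrix.mul_nonsing_inv _ h2,
    inv_mul_cancel₀ (pow_ne_zero 2 hz), one_smul]

theorem pd_metric {G : Coord d → Matrix (Fin (d + 1)) (Fin (d + 1)) ℝ} {z : Coord d}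
    (hz : 0 < z 0) {l j : Fin (d + 1)}
    (hd : DifferentiableAt ℝ (fun w => zeroMetric G w l j) z) (i : Fin (d + 1)) :
    (z 0) ^ 3 * pd i (fun w => G w l j) z
      = zD i (fun w => zeroMetric G w l j) z - (if i = 0 then 2 else 0) * zeroMetric G z l j := by
  have hG : (fun w => G w l j) =ᶠ[𝓝 z]
      fun w => (w 0)⁻¹ * ((w 0)⁻¹ * zeroMetric G w l j) := by
    filter_upwards [(isOpen_posHalf d).mem_nhds (mem_posHalf.2 hz)] with w hw
    have hw0 : w 0 ≠ 0 := (mem_posHalf.1 hw).ne'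
    simp only [zeroMetric, Matrix.smul_apply, smul_eq_mul]
    field_simp
  have hz0 := hz.ne'
  have hinv := differentiableAt_inv_coord hz0
  rw [pd_congr hG, pd_mul hinv (hinv.fun_mul hd), pd_mul hinv hd,
    pd_inv (differentiableAt_coord 0 z) hz0, pd_coord, zD]
  split_ifs <;> field_simp <;> ring

theorem coord_mul_christoffel {G : Coord d → Matrix (Fin (d + 1)) (Fin (d + 1)) ℝ} {z : Coord d}
    (hz : 0 < z 0) (hK : (zeroMetric G z).det ≠ 0)
    (hd : ∀ l j, DifferentiableAt ℝ (fun w => zeroMetric G w l j) z) (k i j : Fin (d + 1)) :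
    z 0 * christoffel G k i j z = 1 / 2 * ∑ l, (zeroMetric G z)⁻¹ k l *
      (zD i (fun w => zeroMetric G w l j) z - (if i = 0 then 2 else 0) * zeroMetric G z l j
        + (zD j (fun w => zeroMetric G w i l) z - (if j = 0 then 2 else 0) * zeroMetric G z i l)
        - (zD l (fun w => zeroMetric G w i j) z
          - (if l = 0 then 2 else 0) * zeroMetric G z i j)) := by
  rw [christoffel, metric_inv_eq hz.ne' hK, ← mul_assoc, mul_comm (z 0), mul_assoc,
    Finset.mul_sum]
  congr 1
  refine Finset.sum_congr rfl fun l _ => ?_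
  rw [← pd_metric hz (hd l j) i, ← pd_metric hz (hd i l) j, ← pd_metric hz (hd i j) l]
  simp only [Matrix.smul_apply, smul_eq_mul]
  ring

theorem chrLim_eq {K : Matrix (Fin (d + 1)) (Fin (d + 1)) ℝ} (hdet : K.det ≠ 0)
    (hs : K.IsSymm) (k i j : Fin (d + 1)) :
    1 / 2 * ∑ l, K⁻¹ k l * (0 - (if i = 0 then 2 else 0) * K l j
      + (0 - (if j = 0 then 2 else 0) * K i l) - (0 - (if l = 0 then 2 else 0) * K i j))
      = chrLim K k i j := by
  have h1 : ∀ j, ∑ l, K⁻¹ k l * K l j = if k = j then 1 else 0 := fun j => by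
    rw [← Matrix.mul_apply, Matrix.nonsing_inv_mul K (isUnit_iff_ne_zero.2 hdet), Matrix.one_apply]
  have h2 : ∑ l, K⁻¹ k l * (if l = 0 then 2 else 0) = 2 * K⁻¹ k 0 := by
    simp [mul_comm]
  have h3 : ∀ l, K⁻¹ k l * (0 - (if i = 0 then 2 else 0) * K l j
      + (0 - (if j = 0 then 2 else 0) * K i l) - (0 - (if l = 0 then 2 else 0) * K i j))
      = -(if i = 0 then 2 else 0) * (K⁻¹ k l * K l j) - (if j = 0 then 2 else 0) * (K⁻¹ k l * K l i)
        + K⁻¹ k l * (if l = 0 then 2 else 0) * K i j := fun l => by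
    rw [hs.apply l i]; ring
  simp only [h3, Finset.sum_add_distrib, Finset.sum_sub_distrib, ← Finset.mul_sum,
    ← Finset.sum_mul, h1, h2, chrLim]
  split_ifs <;> ring

theorem zReg_christoffel {G : Coord d → Matrix (Fin (d + 1)) (Fin (d + 1)) ℝ}
    {K : Matrix (Fin (d + 1)) (Fin (d + 1)) ℝ} (hG : ZRegMat z₀ (zeroMetric G) K)
    (hdet : K.det ≠ 0) (hs : K.IsSymm) (k i j : Fin (d + 1)) :
    ZReg z₀ (fun z => z 0 * christoffel G k i j z) (chrLim K k i j) := by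
  have hev : ∀ᶠ z in 𝓝[posHalf d] z₀, 0 < z 0 ∧ (zeroMetric G z).det ≠ 0 ∧
      ∀ l j, DifferentiableAt ℝ (fun w => zeroMetric G w l j) z :=
    eventually_mem_posHalf.and ((hG.det.tendsto.eventually_ne hdet).and
      (eventually_all.2 fun l => eventually_all.2 fun j => (hG l j).differentiable))
  have h : ZReg z₀ (fun z => 1 / 2 * ∑ l, (zeroMetric G z)⁻¹ k l *
      (zD i (fun w => zeroMetric G w l j) z - (if i = 0 then 2 else 0) * zeroMetric G z l j
        + (zD j (fun w => zeroMetric G w i l) z - (if j = 0 then 2 else 0) * zeroMetric G z i l)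
        - (zD l (fun w => zeroMetric G w i j) z
          - (if l = 0 then 2 else 0) * zeroMetric G z i j)))
      (1 / 2 * ∑ l, K⁻¹ k l * (0 - (if i = 0 then 2 else 0) * K l j
      + (0 - (if j = 0 then 2 else 0) * K i l) - (0 - (if l = 0 then 2 else 0) * K i j))) := by
    refine (ZReg.const _).mul (ZReg.sum fun l _ => (hG.inv hdet k l).mul ?_)
    exact ((((hG l j).zeroDeriv i).sub ((ZReg.const _).mul (hG l j))).add
      (((hG i l).zeroDeriv j).sub ((ZReg.const _).mul (hG i l)))).sub
      (((hG i j).zeroDeriv l).sub ((ZReg.const _).mul (hG i j)))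
  rw [chrLim_eq hdet hs] at h
  refine h.congr ?_
  filter_upwards [hev] with z hz
  exact (coord_mul_christoffel hz.1 hz.2.1 hz.2.2 k i j).symm

theorem zD_coord_mul {f : Coord d → ℝ} {z : Coord d} (hf : DifferentiableAt ℝ f z)
    (i : Fin (d + 1)) :
    zD i (fun w => w 0 * f w) z = (z 0) ^ 2 * pd i f z + if i = 0 then z 0 * f z else 0 := by
  rw [zD, pd_mul (differentiableAt_coord 0 z) hf, pd_coord]
  split_ifs <;> ring

theorem sum_chrLim_mul_chrLim {K : Matrix (Fin (d + 1)) (Fin (d + 1)) ℝ} (hdet : K.det ≠ 0)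
    (l i j k : Fin (d + 1)) :
    ∑ r, chrLim K l i r * chrLim K r j k =
      K⁻¹ l 0 * ((if i = 0 then K j k else 0) - (if j = 0 then K i k else 0)
          - (if k = 0 then K i j else 0))
        - (if i = 0 then chrLim K l j k else 0)
        - (if l = i then chrLim K 0 j k else 0) := by
  have h1 : ∑ r, K i r * K⁻¹ r 0 = if i = 0 then 1 else 0 := by
    rw [← Matrix.mul_apply, Matrix.mul_nonsing_inv K (isUnit_iff_ne_zero.2 hdet), Matrix.one_apply]
  have h2 : ∀ r, chrLim K l i r * chrLim K r j k =
      K⁻¹ l 0 * (K j k * (K i r * K⁻¹ r 0) - (if j = 0 then if r = k then K i r else 0 else 0)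
        - (if k = 0 then if r = j then K i r else 0 else 0))
      - (if i = 0 then if l = r then chrLim K r j k else 0 else 0)
      - (if r = 0 then if l = i then chrLim K r j k else 0 else 0) := by
    intro r
    rw [chrLim, sub_mul, sub_mul]
    congr 1
    · congr 1
      · rw [chrLim]; split_ifs <;> ring
      · split_ifs <;> ring
    · split_ifs <;> ring
  simp only [h2, Finset.sum_sub_distrib, ← Finset.mul_sum, h1]
  have h3 : ∑ r, (if j = 0 then if r = k then K i r else 0 else 0)
      = if j = 0 then K i k else 0 := by
    split_ifs <;> simp
  have h4 : ∑ r, (if k = 0 then if r = j then K i r else 0 else 0)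
      = if k = 0 then K i j else 0 := by
    split_ifs <;> simp
  have h5 : ∑ r, (if i = 0 then if l = r then chrLim K r j k else 0 else 0)
      = if i = 0 then chrLim K l j k else 0 := by
    split_ifs <;> simp
  have h6 : ∑ r, (if r = 0 then if l = i then chrLim K r j k else 0 else 0)
      = if l = i then chrLim K 0 j k else 0 := by
    split_ifs <;> simp
  rw [h3, h4, h5, h6]
  split_ifs <;> ring

theorem riemLim_eq {K : Matrix (Fin (d + 1)) (Fin (d + 1)) ℝ} (hdet : K.det ≠ 0)
    (hs : K.IsSymm) (l i j k : Fin (d + 1)) :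
    0 - (if i = 0 then chrLim K l j k else 0) - (0 - (if j = 0 then chrLim K l i k else 0))
      + ∑ r, (chrLim K l i r * chrLim K r j k - chrLim K l j r * chrLim K r i k)
      = riemLim K l i j k := by
  rw [Finset.sum_sub_distrib, sum_chrLim_mul_chrLim hdet, sum_chrLim_mul_chrLim hdet, riemLim,
    hs.apply i j]
  simp only [chrLim]
  have h0 : ∀ a : Fin (d + 1), (0 = a) = (a = 0) := fun a => propext eq_comm
  simp only [h0]
  by_cases hi : i = 0 <;> by_cases hj : j = 0 <;> by_cases hk : k = 0 <;>
    by_cases hli : l = i <;> by_cases hlj : l = j <;>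
    simp only [hi, hj, hk, hli, hlj, if_true, if_false] <;> grind

theorem zReg_riemann {G : Coord d → Matrix (Fin (d + 1)) (Fin (d + 1)) ℝ}
    {K : Matrix (Fin (d + 1)) (Fin (d + 1)) ℝ} (hG : ZRegMat z₀ (zeroMetric G) K)
    (hdet : K.det ≠ 0) (hs : K.IsSymm) (l i j k : Fin (d + 1)) :
    ZReg z₀ (fun z => (z 0) ^ 2 * riemann G l i j k z) (riemLim K l i j k) := by
  have hΓ := zReg_christoffel hG hdet hs
  have hdiff : ∀ k i j, ∀ᶠ z in 𝓝[posHalf d] z₀, DifferentiableAt ℝ (christoffel G k i j) z := by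
    intro k i j
    filter_upwards [eventually_mem_posHalf, (hΓ k i j).differentiable] with z hz h
    refine ((differentiableAt_inv_coord (mem_posHalf.1 hz).ne').fun_mul h).congr_of_eventuallyEq ?_
    filter_upwards [(isOpen_posHalf d).mem_nhds hz] with w hw
    rw [inv_mul_cancel_left₀ (mem_posHalf.1 hw).ne']
  have hif : ∀ i l j k : Fin (d + 1),
      ZReg z₀ (fun z => if i = 0 then z 0 * christoffel G l j k z else 0)
      (if i = 0 then chrLim K l j k else 0) := by
    intro i l j k
    by_cases hi : i = 0
    · simpa only [hi, if_true] using hΓ l j k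
    · simpa only [hi, if_false] using ZReg.const 0
  have h := ((((hΓ l j k).zeroDeriv i).sub (hif i l j k)).sub
    (((hΓ l i k).zeroDeriv j).sub (hif j l i k))).add
    (ZReg.sum (s := Finset.univ) fun r _ => ((hΓ l i r).mul (hΓ r j k)).sub
      ((hΓ l j r).mul (hΓ r i k)))
  rw [riemLim_eq hdet hs] at h
  refine h.congr ?_
  filter_upwards [hdiff l j k, hdiff l i k] with z h1 h2
  -- `x² ∂_i Γ = x ∂_i (x Γ) - (∂_i x) x Γ`.
  rw [zD_coord_mul h1, zD_coord_mul h2, riemann, mul_add, Finset.mul_sum]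
  congr 1
  · ring
  · exact Finset.sum_congr rfl fun r _ => by ring

end ZeroFrameMetric

/-! ### The geometry of the zero frame: maps -/

section ZeroFrameMap

variable {d e : ℕ}

/-- The connection matrix of the pulled-back connection in the frame `X ∂_a` of `u^* ⁰TN`, in the
direction `x ∂_i`. The first term comes from differentiating the factor `X`. -/
def connMat (H : Coord e → Matrix (Fin (e + 1)) (Fin (e + 1)) ℝ) (U : Coord d → Coord e)
    (i : Fin (d + 1)) (z : Coord d) : Matrix (Fin (e + 1)) (Fin (e + 1)) ℝ :=
  Matrix.of fun a c => (if a = c then zeroDiff U z 0 i else 0)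
    + ∑ b, (U z 0 * christoffel H a b c (U z)) * zeroDiff U z b i

/-- The covariant derivative in the direction `x ∂_i` of a section of `u^* ⁰TN` with components
`σ` in the frame `X ∂_a`. -/
def zeroCov (H : Coord e → Matrix (Fin (e + 1)) (Fin (e + 1)) ℝ) (U : Coord d → Coord e)
    (i : Fin (d + 1)) (σ : Coord d → Fin (e + 1) → ℝ) (z : Coord d) (a : Fin (e + 1)) : ℝ :=
  zD i (fun w => σ w a) z + ∑ c, connMat H U i z a c * σ z c

/-- The trace `tr_g ∇ ξ` of a `u^* ⁰TN`-valued one-form with components `ξ j` in the zero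
frames. -/
def zeroTrace (G : Coord d → Matrix (Fin (d + 1)) (Fin (d + 1)) ℝ)
    (H : Coord e → Matrix (Fin (e + 1)) (Fin (e + 1)) ℝ) (U : Coord d → Coord e)
    (ξ : Fin (d + 1) → Coord d → Fin (e + 1) → ℝ) (z : Coord d) (a : Fin (e + 1)) : ℝ :=
  ∑ i, ∑ j, (zeroMetric G z)⁻¹ i j *
    (zeroCov H U i (ξ j) z a - (if i = 0 then ξ j z a else 0)
      - ∑ k, (z 0 * christoffel G k i j z) * ξ k z a)

/-- The curvature term `tr_g R_h(du, σ) du` in the zero frames. -/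
def zeroCurv (G : Coord d → Matrix (Fin (d + 1)) (Fin (d + 1)) ℝ)
    (H : Coord e → Matrix (Fin (e + 1)) (Fin (e + 1)) ℝ) (U : Coord d → Coord e)
    (σ : Coord d → Fin (e + 1) → ℝ) (z : Coord d) (a : Fin (e + 1)) : ℝ :=
  ∑ i, ∑ j, (zeroMetric G z)⁻¹ i j * ∑ b, ∑ c, ∑ f, ((U z 0) ^ 2 * riemann H a b c f (U z))
    * zeroDiff U z b i * σ z c * zeroDiff U z f j

variable {G : Coord d → Matrix (Fin (d + 1)) (Fin (d + 1)) ℝ}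
  {H : Coord e → Matrix (Fin (e + 1)) (Fin (e + 1)) ℝ} {U : Coord d → Coord e} {z : Coord d}

theorem pd_eq_mul_zeroDiff (hz : z 0 ≠ 0) (hU : U z 0 ≠ 0) (a : Fin (e + 1)) (j : Fin (d + 1)) :
    pd j (fun w => U w a) z = U z 0 / z 0 * zeroDiff U z a j := by
  simp only [zeroDiff, Matrix.of_apply]
  field_simp

theorem differentiableAt_comp_coord (hd : DifferentiableAt ℝ U z) (a : Fin (e + 1)) :
    DifferentiableAt ℝ (fun w => U w a) z :=
  (differentiableAt_coord a (U z)).comp z hd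

theorem pullbackCov_congr {i : Fin (d + 1)} {s s' : Coord d → Fin (e + 1) → ℝ}
    (h : ∀ a, (fun w => s w a) =ᶠ[𝓝 z] fun w => s' w a) (a : Fin (e + 1)) :
    pullbackCov H U i s z a = pullbackCov H U i s' z a := by
  have h' : s z = s' z := funext fun c => (h c).eq_of_nhds
  rw [pullbackCov, pullbackCov, pd_congr (h a), h']

theorem traceCov_congr {η η' : Fin (d + 1) → Coord d → Fin (e + 1) → ℝ}
    (h : ∀ j a, (fun w => η j w a) =ᶠ[𝓝 z] fun w => η' j w a) (a : Fin (e + 1)) :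
    traceCov G H U η z a = traceCov G H U η' z a := by
  have h' : ∀ j, η j z a = η' j z a := fun j => (h j a).eq_of_nhds
  simp only [traceCov, pullbackCov_congr (h _), h']

theorem pullbackCov_eventually_congr {i : Fin (d + 1)} {s s' : Coord d → Fin (e + 1) → ℝ}
    (h : ∀ a, (fun w => s w a) =ᶠ[𝓝 z] fun w => s' w a) (a : Fin (e + 1)) :
    (fun w => pullbackCov H U i s w a) =ᶠ[𝓝 z] fun w => pullbackCov H U i s' w a := by
  filter_upwards [(eventually_all.2 h).eventually_nhds] with w hw
  exact pullbackCov_congr (fun a => hw.mono fun _ hv => hv a) a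

theorem jacobi_congr {s s' : Coord d → Fin (e + 1) → ℝ}
    (h : ∀ a, (fun w => s w a) =ᶠ[𝓝 z] fun w => s' w a) (a : Fin (e + 1)) :
    jacobi G H U s z a = jacobi G H U s' z a := by
  have h' : s z = s' z := funext fun c => (h c).eq_of_nhds
  rw [jacobi, jacobi, traceCov_congr (fun j => pullbackCov_eventually_congr h), h']

theorem pullbackCov_eq (hz : z 0 ≠ 0) (hU : U z 0 ≠ 0) (hd : DifferentiableAt ℝ U z)
    {σ : Coord d → Fin (e + 1) → ℝ} {a : Fin (e + 1)}
    (hσ : DifferentiableAt ℝ (fun w => σ w a) z) (i : Fin (d + 1)) :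
    pullbackCov H U i (fun w b => U w 0 * σ w b) z a = U z 0 / z 0 * zeroCov H U i σ z a := by
  have h1 : pd i (fun w => U w 0 * σ w a) z
      = U z 0 / z 0 * (zD i (fun w => σ w a) z + zeroDiff U z 0 i * σ z a) := by
    rw [pd_mul (differentiableAt_comp_coord hd 0) hσ, pd_eq_mul_zeroDiff hz hU, zD]
    field_simp
  have h2 : ∑ b, ∑ c, christoffel H a b c (U z) * pd i (fun w => U w b) z * (U z 0 * σ z c)
      = U z 0 / z 0 * ∑ c, (∑ b, (U z 0 * christoffel H a b c (U z)) * zeroDiff U z b i)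
        * σ z c := by
    rw [Finset.sum_comm, Finset.mul_sum]
    refine Finset.sum_congr rfl fun c _ => ?_
    rw [Finset.sum_mul, Finset.mul_sum]
    refine Finset.sum_congr rfl fun b _ => ?_
    rw [pd_eq_mul_zeroDiff hz hU]
    ring
  have h3 : ∑ c, connMat H U i z a c * σ z c = zeroDiff U z 0 i * σ z a
      + ∑ c, (∑ b, (U z 0 * christoffel H a b c (U z)) * zeroDiff U z b i) * σ z c := by
    simp only [connMat, Matrix.of_apply, add_mul, Finset.sum_add_distrib, ite_mul, zero_mul,
      Finset.sum_ite_eq, Finset.mem_univ, if_true]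
  rw [pullbackCov, h1, h2, zeroCov, h3]
  ring

theorem traceCov_eq (hz : z 0 ≠ 0) (hK : (zeroMetric G z).det ≠ 0) (hU : U z 0 ≠ 0)
    (hd : DifferentiableAt ℝ U z) {ξ : Fin (d + 1) → Coord d → Fin (e + 1) → ℝ} {a : Fin (e + 1)}
    (hξ : ∀ j, DifferentiableAt ℝ (fun w => ξ j w a) z) :
    traceCov G H U (fun j w b => U w 0 / w 0 * ξ j w b) z a
      = U z 0 * zeroTrace G H U ξ z a := by
  have hinv := differentiableAt_inv_coord hz
  have h1 : ∀ i j, pullbackCov H U i (fun w b => U w 0 / w 0 * ξ j w b) z a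
      = U z 0 / (z 0) ^ 2 * (zeroCov H U i (ξ j) z a - if i = 0 then ξ j z a else 0) := by
    intro i j
    have h2 : (fun w b => U w 0 / w 0 * ξ j w b)
        = fun w b => U w 0 * ((fun w b => (w 0)⁻¹ * ξ j w b) w b) := by
      funext w b; rw [div_eq_mul_inv, mul_assoc]
    rw [h2, pullbackCov_eq hz hU hd (hinv.fun_mul (hξ j)), zeroCov, zeroCov,
      zD_mul hinv (hξ j), zD, zD, pd_inv (differentiableAt_coord 0 z) hz, pd_coord]
    simp only [mul_left_comm _ (z 0)⁻¹, ← Finset.mul_sum]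
    split_ifs <;> field_simp <;> ring
  rw [traceCov, zeroTrace, Finset.mul_sum]
  refine Finset.sum_congr rfl fun i _ => ?_
  rw [Finset.mul_sum]
  refine Finset.sum_congr rfl fun j _ => ?_
  have h3 : ∑ k, christoffel G k i j z * (U z 0 / z 0 * ξ k z a)
      = U z 0 / (z 0) ^ 2 * ∑ k, (z 0 * christoffel G k i j z) * ξ k z a := by
    rw [Finset.mul_sum]
    exact Finset.sum_congr rfl fun k _ => by field_simp
  rw [h1, h3, metric_inv_eq hz hK, Matrix.smul_apply, smul_eq_mul]
  field_simp

/-- The conditions at a point of the open half-space under which the zero frame formulas hold. -/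
structure ZeroFrameAt (G : Coord d → Matrix (Fin (d + 1)) (Fin (d + 1)) ℝ)
    (U : Coord d → Coord e) (z : Coord d) : Prop where
  pos : 0 < z 0
  det_ne : (zeroMetric G z).det ≠ 0
  map_pos : 0 < U z 0
  diff : DifferentiableAt ℝ U z
  zeroDiff_diff : ∀ a j, DifferentiableAt ℝ (fun w => zeroDiff U w a j) z

theorem ZeroFrameAt.eventually_ne (h : ZeroFrameAt G U z) :
    ∀ᶠ w in 𝓝 z, w 0 ≠ 0 ∧ U w 0 ≠ 0 :=
  ((by fun_prop : Continuous fun w : Coord d => w 0).continuousAt.eventually_ne h.pos.ne').and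
    ((differentiableAt_comp_coord h.diff 0).continuousAt.eventually_ne h.map_pos.ne')

theorem zeroTension_eq (h : ZeroFrameAt G U z) (a : Fin (e + 1)) :
    zeroTension G H U z a = zeroTrace G H U (fun j w a => zeroDiff U w a j) z a := by
  rw [zeroTension, tension, traceCov_congr (η' := fun j w b => U w 0 / w 0 * zeroDiff U w b j),
    traceCov_eq h.pos.ne' h.det_ne h.map_pos.ne' h.diff (fun j => h.zeroDiff_diff a j),
    mul_div_cancel_left₀ _ h.map_pos.ne']
  intro j b
  filter_upwards [h.eventually_ne] with w hw using pd_eq_mul_zeroDiff hw.1 hw.2 b j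

theorem zeroJacobi_eq (h : ZeroFrameAt G U z) (hd : ∀ᶠ w in 𝓝 z, DifferentiableAt ℝ U w)
    {σ : Coord d → Fin (e + 1) → ℝ}
    (hσ : ∀ a, ∀ᶠ w in 𝓝 z, DifferentiableAt ℝ (fun v => σ v a) w) (a : Fin (e + 1))
    (hc : ∀ j, DifferentiableAt ℝ (fun w => zeroCov H U j σ w a) z) :
    zeroJacobi G H U σ z a
      = -zeroTrace G H U (fun j => zeroCov H U j σ) z a + zeroCurv G H U σ z a := by
  have hz := h.pos.ne'
  have hU := h.map_pos.ne'
  have h1 : traceCov G H U (fun j => pullbackCov H U j fun w b => U w 0 * σ w b) z a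
      = U z 0 * zeroTrace G H U (fun j => zeroCov H U j σ) z a := by
    rw [traceCov_congr (η' := fun j w b => U w 0 / w 0 * zeroCov H U j σ w b),
      traceCov_eq hz h.det_ne hU h.diff hc]
    intro j b
    filter_upwards [h.eventually_ne, hd, hσ b] with w hw hw' hσw
    exact pullbackCov_eq hw.1 hw.2 hw' hσw j
  have h2 : ∑ i, ∑ j, (G z)⁻¹ i j * ∑ b, ∑ c, ∑ f, riemann H a b c f (U z)
        * pd i (fun w => U w b) z * (U z 0 * σ z c) * pd j (fun w => U w f) z
      = U z 0 * zeroCurv G H U σ z a := by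
    rw [zeroCurv, Finset.mul_sum]
    refine Finset.sum_congr rfl fun i _ => ?_
    rw [Finset.mul_sum]
    refine Finset.sum_congr rfl fun j _ => ?_
    rw [metric_inv_eq hz h.det_ne, Matrix.smul_apply, smul_eq_mul, mul_left_comm (U z 0),
      mul_comm ((z 0) ^ 2), mul_assoc]
    congr 1
    simp only [Finset.mul_sum]
    refine Finset.sum_congr rfl fun b _ => Finset.sum_congr rfl fun c _ =>
      Finset.sum_congr rfl fun f _ => ?_
    rw [pd_eq_mul_zeroDiff hz hU, pd_eq_mul_zeroDiff hz hU]
    field_simp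
  rw [zeroJacobi, jacobi, h1, h2]
  field_simp

theorem zeroJacobi_zeroTension (hU : ∀ᶠ w in 𝓝 z, U w 0 ≠ 0) (a : Fin (e + 1))
    (hbi : jacobi G H U (tension G H U) z a = 0) :
    zeroJacobi G H U (zeroTension G H U) z a = 0 := by
  rw [zeroJacobi, jacobi_congr (s' := tension G H U), hbi, zero_div]
  intro b
  filter_upwards [hU] with w hw
  rw [zeroTension, mul_div_cancel₀ _ hw]

end ZeroFrameMap

/-! ### Boundary limits of the tension field and of the Jacobi operator -/

section BoundaryModel

variable {d e : ℕ}

theorem isSymm_of_posDef {K : Matrix (Fin (d + 1)) (Fin (d + 1)) ℝ} (hK : K.PosDef) : K.IsSymm := by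
  have := hK.isHermitian
  rwa [Matrix.IsHermitian, Matrix.conjTranspose_eq_transpose_of_trivial] at this

theorem inv_apply_comm {K : Matrix (Fin (d + 1)) (Fin (d + 1)) ℝ} (hs : K.IsSymm)
    (i j : Fin (d + 1)) : K⁻¹ i j = K⁻¹ j i := by
  have h := Matrix.transpose_nonsing_inv K
  rw [hs.eq] at h
  exact congrFun (congrFun h j) i

/-- `U` maps a neighbourhood of the boundary point `z₀` to one of the boundary point `w₀`. The
metrics `G`, `H` and the differential of `U` are zero-regular in the zero frames, with boundary
values `K`, `K'` and `D`. -/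
structure BoundaryModel (z₀ : Coord d) (w₀ : Coord e)
    (G : Coord d → Matrix (Fin (d + 1)) (Fin (d + 1)) ℝ)
    (H : Coord e → Matrix (Fin (e + 1)) (Fin (e + 1)) ℝ) (U : Coord d → Coord e)
    (K : Matrix (Fin (d + 1)) (Fin (d + 1)) ℝ) (K' : Matrix (Fin (e + 1)) (Fin (e + 1)) ℝ)
    (D : Matrix (Fin (e + 1)) (Fin (d + 1)) ℝ) : Prop where
  source_zero : z₀ 0 = 0
  metric : ZRegMat z₀ (zeroMetric G) K
  metric' : ZRegMat w₀ (zeroMetric H) K'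
  posDef : K.PosDef
  posDef' : K'.PosDef
  tendsto : Tendsto U (𝓝[posHalf d] z₀) (𝓝[posHalf e] w₀)
  diff : ∀ᶠ z in 𝓝[posHalf d] z₀, DifferentiableAt ℝ U z
  zeroDiff : ZRegMat z₀ (zeroDiff U) D
  row_zero : ∀ j, D 0 j = if j = 0 then 1 else 0

theorem ZRegN.comp {z₀ : Coord d} {w₀ : Coord e} {U : Coord d → Coord e}
    {D : Matrix (Fin (e + 1)) (Fin (d + 1)) ℝ}
    (hU : Tendsto U (𝓝[posHalf d] z₀) (𝓝[posHalf e] w₀))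
    (hd : ∀ᶠ z in 𝓝[posHalf d] z₀, DifferentiableAt ℝ U z)
    (hD : ZRegMat z₀ (zeroDiff U) D) {k : ℕ} {F : Coord e → ℝ} {c : ℝ} (hF : ZRegN w₀ k F c) :
    ZRegN z₀ k (fun z => F (U z)) c := by
  induction k generalizing F c with
  | zero => exact Tendsto.comp hF hU
  | succ k ih =>
    refine ⟨hF.1.comp hU, ?_, fun i => ?_⟩
    · filter_upwards [hU.eventually hF.2.1, hd] with z h1 h2 using h1.comp z h2
    · have h : ZRegN z₀ k (fun z => ∑ a, zeroDiff U z a i * zD a F (U z)) 0 := by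
        have : ∀ s : Finset (Fin (e + 1)),
            ZRegN z₀ k (fun z => ∑ a ∈ s, zeroDiff U z a i * zD a F (U z)) 0 := by
          intro s
          induction s using Finset.induction_on with
          | empty => simpa using ZRegN.const k 0
          | insert a s ha ihs =>
            simp only [Finset.sum_insert ha]
            have := ((hD a i k).mul (ih (hF.2.2 a))).add ihs
            rwa [mul_zero, add_zero] at this
        exact this Finset.univ
      refine h.congr ?_
      filter_upwards [hU.eventually hF.2.1, hd, eventually_mem_posHalf,
        hU.eventually eventually_mem_posHalf] with z h1 h2 h3 h4
      have h3' := (mem_posHalf.1 h3).ne'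
      have h4' := (mem_posHalf.1 h4).ne'
      have hchain : pd i (fun w => F (U w)) z = ∑ a, pd a F (U z) * pd i (fun w => U w a) z := by
        have h5 := (h1.hasFDerivAt.comp z h2.hasFDerivAt).fderiv
        have h6 : pd i (fun w => F (U w)) z = fderiv ℝ F (U z) (fderiv ℝ U z (basisVec i)) :=
          congrArg (fun T => T (basisVec i)) h5
        rw [h6, fderiv_eq_sum_pd, sum_smul_proj_apply]
        refine Finset.sum_congr rfl fun a _ => ?_
        have h7 : HasFDerivAt (fun w => U w a)
            ((EuclideanSpace.proj a : Coord e →L[ℝ] ℝ).comp (fderiv ℝ U z)) z :=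
          (EuclideanSpace.proj a : Coord e →L[ℝ] ℝ).hasFDerivAt.comp z h2.hasFDerivAt
        have h8 : pd i (fun w => U w a) z = fderiv ℝ U z (basisVec i) a :=
          congrArg (fun T => T (basisVec i)) h7.fderiv
        rw [h8]
      rw [zD, hchain, Finset.mul_sum]
      refine Finset.sum_congr rfl fun a _ => ?_
      rw [pd_eq_mul_zeroDiff h3' h4', zD]
      field_simp

/-- The inner product of a vector with the image of the `i`-th frame vector. -/
def pairing (K' : Matrix (Fin (e + 1)) (Fin (e + 1)) ℝ) (D : Matrix (Fin (e + 1)) (Fin (d + 1)) ℝ)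
    (i : Fin (d + 1)) (σ : Fin (e + 1) → ℝ) : ℝ := ∑ c, (∑ b, K' b c * D b i) * σ c

/-- The image under the differential of the vector dual to `dx / x`. -/
def imageNormal (K : Matrix (Fin (d + 1)) (Fin (d + 1)) ℝ)
    (D : Matrix (Fin (e + 1)) (Fin (d + 1)) ℝ) (a : Fin (e + 1)) : ℝ := ∑ k, K⁻¹ k 0 * D a k

/-- The energy density `|⁰du|²`. -/
def energy (K : Matrix (Fin (d + 1)) (Fin (d + 1)) ℝ) (K' : Matrix (Fin (e + 1)) (Fin (e + 1)) ℝ)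
    (D : Matrix (Fin (e + 1)) (Fin (d + 1)) ℝ) : ℝ :=
  ∑ i, ∑ j, K⁻¹ i j * pairing K' D i fun a => D a j

/-- The boundary value of the covariant derivative of a section with boundary value `σ`. -/
def covLim (K' : Matrix (Fin (e + 1)) (Fin (e + 1)) ℝ) (D : Matrix (Fin (e + 1)) (Fin (d + 1)) ℝ)
    (i : Fin (d + 1)) (σ : Fin (e + 1) → ℝ) (a : Fin (e + 1)) : ℝ :=
  K'⁻¹ a 0 * pairing K' D i σ - σ 0 * D a i

/-- The boundary value of the tension field. -/
def tensionLim (K : Matrix (Fin (d + 1)) (Fin (d + 1)) ℝ)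
    (K' : Matrix (Fin (e + 1)) (Fin (e + 1)) ℝ) (D : Matrix (Fin (e + 1)) (Fin (d + 1)) ℝ)
    (a : Fin (e + 1)) : ℝ :=
  energy K K' D * K'⁻¹ a 0 - (d + 1) * imageNormal K D a

/-- The inner product of a section with the image of the vector dual to `dx / x`. -/
def normalPairing (K : Matrix (Fin (d + 1)) (Fin (d + 1)) ℝ)
    (K' : Matrix (Fin (e + 1)) (Fin (e + 1)) ℝ) (D : Matrix (Fin (e + 1)) (Fin (d + 1)) ℝ)
    (σ : Fin (e + 1) → ℝ) : ℝ := ∑ k, K⁻¹ k 0 * pairing K' D k σ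

/-- The value at `0` of the indicial polynomial of the Jacobi operator. -/
def jacobiLim (K : Matrix (Fin (d + 1)) (Fin (d + 1)) ℝ)
    (K' : Matrix (Fin (e + 1)) (Fin (e + 1)) ℝ) (D : Matrix (Fin (e + 1)) (Fin (d + 1)) ℝ)
    (σ : Fin (e + 1) → ℝ) (a : Fin (e + 1)) : ℝ :=
  (d - 1) * normalPairing K K' D σ * K'⁻¹ a 0 + σ 0 * energy K K' D * K'⁻¹ a 0
    - (d + 1) * σ 0 * imageNormal K D a + K'⁻¹ 0 0 * energy K K' D * σ a

theorem sum_connLim_mul {K' : Matrix (Fin (e + 1)) (Fin (e + 1)) ℝ}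
    {D : Matrix (Fin (e + 1)) (Fin (d + 1)) ℝ} (i : Fin (d + 1)) (σ : Fin (e + 1) → ℝ)
    (a : Fin (e + 1)) :
    ∑ c, ((if a = c then D 0 i else 0) + ∑ b, chrLim K' a b c * D b i) * σ c
      = covLim K' D i σ a := by
  have h1 : ∀ c, ∑ b, chrLim K' a b c * D b i = K'⁻¹ a 0 * ∑ b, K' b c * D b i
      - (if a = c then D 0 i else 0) - (if c = 0 then D a i else 0) := by
    intro c
    simp only [chrLim, sub_mul, Finset.sum_sub_distrib, Finset.mul_sum, mul_assoc, ite_mul,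
      zero_mul, one_mul, Finset.sum_ite_eq', Finset.mem_univ, if_true]
    congr 1
    split_ifs <;> simp
  simp only [h1, covLim, pairing, Finset.mul_sum]
  have h2 : ∀ c, ((if a = c then D 0 i else 0) + (∑ b, K'⁻¹ a 0 * (K' b c * D b i)
      - (if a = c then D 0 i else 0) - (if c = 0 then D a i else 0))) * σ c
      = K'⁻¹ a 0 * ((∑ b, K' b c * D b i) * σ c) - (if c = 0 then D a i * σ c else 0) := by
    intro c
    rw [← Finset.mul_sum]
    split_ifs <;> ring
  simp only [h2, Finset.sum_sub_distrib, Finset.sum_ite_eq', Finset.mem_univ, if_true]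
  ring

theorem sum_chrLim_trace {K : Matrix (Fin (d + 1)) (Fin (d + 1)) ℝ} (hdet : K.det ≠ 0)
    (hs : K.IsSymm) (ξ : Fin (d + 1) → ℝ) :
    ∑ i, ∑ j, K⁻¹ i j * ((if i = 0 then ξ j else 0) + ∑ k, chrLim K k i j * ξ k)
      = d * ∑ k, K⁻¹ k 0 * ξ k := by
  have hsi := inv_apply_comm hs
  have h1 : ∑ i, ∑ j, K⁻¹ i j * (if i = 0 then ξ j else 0) = ∑ k, K⁻¹ k 0 * ξ k := by
    rw [Finset.sum_comm]
    refine Finset.sum_congr rfl fun k _ => ?_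
    simp [hsi k 0]
  have htr : ∑ i, ∑ j, K⁻¹ i j * K i j = d + 1 := by
    have h : ∀ i, ∑ j, K⁻¹ i j * K i j = 1 := fun i => by
      have h2 := congrFun (congrFun (Matrix.nonsing_inv_mul K (isUnit_iff_ne_zero.2 hdet)) i) i
      rw [Matrix.mul_apply, Matrix.one_apply_eq] at h2
      rw [← h2]
      exact Finset.sum_congr rfl fun j _ => by rw [hs.apply j i]
    simp [h]
  have h2 : ∀ k, ∑ i, ∑ j, K⁻¹ i j * chrLim K k i j = (d - 1) * K⁻¹ k 0 := by
    intro k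
    have h3 : ∀ i j, K⁻¹ i j * chrLim K k i j = K⁻¹ k 0 * (K⁻¹ i j * K i j)
        - (if i = 0 then if k = j then K⁻¹ i j else 0 else 0)
        - (if j = 0 then if k = i then K⁻¹ i j else 0 else 0) := by
      intro i j
      rw [chrLim]
      split_ifs <;> ring
    simp only [h3, Finset.sum_sub_distrib, ← Finset.mul_sum, htr]
    have h4 : ∑ i, ∑ j, (if i = 0 then if k = j then K⁻¹ i j else 0 else 0) = K⁻¹ k 0 := by
      rw [Finset.sum_comm]
      simp [hsi k 0]
    have h5 : ∑ i, ∑ j, (if j = 0 then if k = i then K⁻¹ i j else 0 else 0) = K⁻¹ k 0 := by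
      simp
    rw [h4, h5]
    ring
  have h6 : ∑ i, ∑ j, K⁻¹ i j * ∑ k, chrLim K k i j * ξ k
      = ∑ k, (∑ i, ∑ j, K⁻¹ i j * chrLim K k i j) * ξ k := by
    simp only [Finset.mul_sum, Finset.sum_mul]
    have : ∀ i, ∑ j, ∑ k, K⁻¹ i j * (chrLim K k i j * ξ k)
        = ∑ k, ∑ j, K⁻¹ i j * chrLim K k i j * ξ k := fun i => by
      rw [Finset.sum_comm]
      simp only [mul_assoc]
    simp only [this]
    rw [Finset.sum_comm]
  simp only [mul_add, Finset.sum_add_distrib, h1, h6, h2]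
  rw [Finset.mul_sum, ← Finset.sum_add_distrib]
  exact Finset.sum_congr rfl fun k _ => by ring

theorem sum_mul_row_zero {D : Matrix (Fin (e + 1)) (Fin (d + 1)) ℝ}
    (h : ∀ j, D 0 j = if j = 0 then 1 else 0) (f : Fin (d + 1) → ℝ) :
    ∑ j, f j * D 0 j = f 0 := by
  simp [h]

theorem pairing_normal {K' : Matrix (Fin (e + 1)) (Fin (e + 1)) ℝ} (hdet : K'.det ≠ 0)
    (D : Matrix (Fin (e + 1)) (Fin (d + 1)) ℝ) (i : Fin (d + 1)) :
    pairing K' D i (fun a => K'⁻¹ a 0) = D 0 i := by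
  have h : ∀ b, ∑ c, K' b c * K'⁻¹ c 0 = if b = 0 then 1 else 0 := fun b => by
    rw [← Matrix.mul_apply, Matrix.mul_nonsing_inv K' (isUnit_iff_ne_zero.2 hdet), Matrix.one_apply]
  simp only [pairing, Finset.sum_mul]
  rw [Finset.sum_comm]
  have h2 : ∀ b, ∑ c, K' b c * D b i * K'⁻¹ c 0 = D b i * ∑ c, K' b c * K'⁻¹ c 0 := fun b => by
    rw [Finset.mul_sum]
    exact Finset.sum_congr rfl fun c _ => by ring
  simp [h2, h]

theorem pairing_sub_smul (K' : Matrix (Fin (e + 1)) (Fin (e + 1)) ℝ)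
    (D : Matrix (Fin (e + 1)) (Fin (d + 1)) ℝ) (i : Fin (d + 1)) (σ ρ : Fin (e + 1) → ℝ)
    (s t : ℝ) :
    pairing K' D i (fun a => σ a * s - t * ρ a) = s * pairing K' D i σ - t * pairing K' D i ρ := by
  simp only [pairing, Finset.mul_sum, ← Finset.sum_sub_distrib]
  exact Finset.sum_congr rfl fun c _ => by ring

end BoundaryModel

namespace BoundaryModel

variable {d e : ℕ} {z₀ : Coord d} {w₀ : Coord e}
  {G : Coord d → Matrix (Fin (d + 1)) (Fin (d + 1)) ℝ}
  {H : Coord e → Matrix (Fin (e + 1)) (Fin (e + 1)) ℝ} {U : Coord d → Coord e}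
  {K : Matrix (Fin (d + 1)) (Fin (d + 1)) ℝ} {K' : Matrix (Fin (e + 1)) (Fin (e + 1)) ℝ}
  {D : Matrix (Fin (e + 1)) (Fin (d + 1)) ℝ}

theorem zReg_comp (m : BoundaryModel z₀ w₀ G H U K K' D) {F : Coord e → ℝ} {c : ℝ}
    (hF : ZReg w₀ F c) : ZReg z₀ (fun z => F (U z)) c :=
  fun k => (hF k).comp m.tendsto m.diff m.zeroDiff

theorem det_ne (m : BoundaryModel z₀ w₀ G H U K K' D) : K.det ≠ 0 := m.posDef.det_pos.ne'

theorem det_ne' (m : BoundaryModel z₀ w₀ G H U K K' D) : K'.det ≠ 0 := m.posDef'.det_pos.ne'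

theorem eventually_zeroFrameAt (m : BoundaryModel z₀ w₀ G H U K K' D) :
    ∀ᶠ z in 𝓝[posHalf d] z₀, ZeroFrameAt G U z := by
  filter_upwards [eventually_mem_posHalf, m.metric.det.tendsto.eventually_ne m.det_ne,
    m.tendsto.eventually eventually_mem_posHalf, m.diff,
    eventually_all.2 fun a => eventually_all.2 fun j => (m.zeroDiff a j).differentiable]
    with z h1 h2 h3 h4 h5 using ⟨h1, h2, h3, h4, h5⟩

theorem zReg_connMat (m : BoundaryModel z₀ w₀ G H U K K' D) (i : Fin (d + 1))
    (a c : Fin (e + 1)) : ZReg z₀ (fun z => connMat H U i z a c)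
      ((if a = c then D 0 i else 0) + ∑ b, chrLim K' a b c * D b i) := by
  have h1 : ZReg z₀ (fun z => if a = c then SimpleBMap.zeroDiff U z 0 i else 0)
      (if a = c then D 0 i else 0) := by
    by_cases h : a = c
    · simpa only [h, if_true] using m.zeroDiff 0 i
    · simpa only [h, if_false] using ZReg.const 0
  exact h1.add (ZReg.sum fun b _ =>
    (m.zReg_comp (zReg_christoffel m.metric' m.det_ne' (isSymm_of_posDef m.posDef') a b c)).mul
      (m.zeroDiff b i))

theorem zReg_zeroCov (m : BoundaryModel z₀ w₀ G H U K K' D) {σ : Coord d → Fin (e + 1) → ℝ}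
    {σ₀ : Fin (e + 1) → ℝ} (hσ : ∀ c, ZReg z₀ (fun w => σ w c) (σ₀ c)) (i : Fin (d + 1))
    (a : Fin (e + 1)) : ZReg z₀ (fun z => zeroCov H U i σ z a) (covLim K' D i σ₀ a) := by
  have h := ((hσ a).zeroDeriv i).add
    (ZReg.sum (s := Finset.univ) fun c _ => (m.zReg_connMat i a c).mul (hσ c))
  rwa [sum_connLim_mul, zero_add] at h

theorem zReg_zeroTrace (m : BoundaryModel z₀ w₀ G H U K K' D)
    {ξ : Fin (d + 1) → Coord d → Fin (e + 1) → ℝ} {ξ₀ : Fin (d + 1) → Fin (e + 1) → ℝ}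
    (hξ : ∀ j c, ZReg z₀ (fun w => ξ j w c) (ξ₀ j c)) (a : Fin (e + 1)) :
    ZReg z₀ (fun z => zeroTrace G H U ξ z a)
      (∑ i, ∑ j, K⁻¹ i j * covLim K' D i (ξ₀ j) a - d * ∑ k, K⁻¹ k 0 * ξ₀ k a) := by
  have hif : ∀ i j : Fin (d + 1), ZReg z₀ (fun z => if i = 0 then ξ j z a else 0)
      (if i = 0 then ξ₀ j a else 0) := by
    intro i j
    by_cases h : i = 0
    · simpa only [h, if_true] using hξ j a
    · simpa only [h, if_false] using ZReg.const 0
  have hs := isSymm_of_posDef m.posDef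
  have h : ZReg z₀ (fun z => zeroTrace G H U ξ z a) (∑ i, ∑ j, K⁻¹ i j *
      (covLim K' D i (ξ₀ j) a - (if i = 0 then ξ₀ j a else 0)
        - ∑ k, chrLim K k i j * ξ₀ k a)) :=
    ZReg.sum fun i _ => ZReg.sum fun j _ => (m.metric.inv m.det_ne i j).mul
      (((m.zReg_zeroCov (hξ j) i a).sub (hif i j)).sub (ZReg.sum fun k _ =>
        (zReg_christoffel m.metric m.det_ne hs k i j).mul (hξ k a)))
  have h2 := sum_chrLim_trace m.det_ne hs fun k => ξ₀ k a
  rw [← h2, ← Finset.sum_sub_distrib]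
  simp only [← Finset.sum_sub_distrib, ← mul_sub, ← sub_sub]
  exact h

theorem zReg_zeroTension (m : BoundaryModel z₀ w₀ G H U K K' D) (a : Fin (e + 1)) :
    ZReg z₀ (fun z => zeroTension G H U z a) (tensionLim K K' D a) := by
  have h := m.zReg_zeroTrace (ξ := fun j w a => SimpleBMap.zeroDiff U w a j)
    (ξ₀ := fun j a => D a j) (fun j c => m.zeroDiff c j) a
  have h1 : ∑ i, ∑ j, K⁻¹ i j * covLim K' D i (fun a => D a j) a
      = energy K K' D * K'⁻¹ a 0 - imageNormal K D a := by
    rw [energy, imageNormal, Finset.sum_mul, ← Finset.sum_sub_distrib]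
    refine Finset.sum_congr rfl fun i _ => ?_
    have h2 := sum_mul_row_zero m.row_zero fun j => K⁻¹ i j * D a i
    rw [← h2, Finset.sum_mul, ← Finset.sum_sub_distrib]
    exact Finset.sum_congr rfl fun j _ => by rw [covLim]; ring
  rw [h1] at h
  have h3 : energy K K' D * K'⁻¹ a 0 - imageNormal K D a - d * ∑ k, K⁻¹ k 0 * D a k
      = tensionLim K K' D a := by
    rw [tensionLim, imageNormal]; ring
  rw [h3] at h
  refine h.congr ?_
  filter_upwards [m.eventually_zeroFrameAt] with z hz using (zeroTension_eq hz a).symm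

theorem zReg_zeroCurv (m : BoundaryModel z₀ w₀ G H U K K' D) {σ : Coord d → Fin (e + 1) → ℝ}
    {σ₀ : Fin (e + 1) → ℝ} (hσ : ∀ c, ZReg z₀ (fun w => σ w c) (σ₀ c)) (a : Fin (e + 1)) :
    ZReg z₀ (fun z => zeroCurv G H U σ z a) (K'⁻¹ 0 0 * (energy K K' D * σ₀ a
      - ∑ i, ∑ j, K⁻¹ i j * (pairing K' D j σ₀ * D a i))) := by
  have hs' := isSymm_of_posDef m.posDef'
  have h : ZReg z₀ (fun z => zeroCurv G H U σ z a) (∑ i, ∑ j, K⁻¹ i j * ∑ b, ∑ c, ∑ f,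
      riemLim K' a b c f * D b i * σ₀ c * D f j) :=
    ZReg.sum fun i _ => ZReg.sum fun j _ => (m.metric.inv m.det_ne i j).mul
      (ZReg.sum fun b _ => ZReg.sum fun c _ => ZReg.sum fun f _ =>
        (((m.zReg_comp (zReg_riemann m.metric' m.det_ne' hs' a b c f)).mul
          (m.zeroDiff b i)).mul (hσ c)).mul (m.zeroDiff f j))
  have h1 : ∀ i j, ∑ b, ∑ c, ∑ f, riemLim K' a b c f * D b i * σ₀ c * D f j
      = K'⁻¹ 0 0 * (σ₀ a * pairing K' D i (fun a => D a j) - pairing K' D j σ₀ * D a i) := by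
    intro i j
    have h2 : ∀ b c f, riemLim K' a b c f * D b i * σ₀ c * D f j
        = K'⁻¹ 0 0 * ((if a = c then σ₀ c * (K' b f * D b i * D f j) else 0)
          - (if a = b then D b i * (K' f c * D f j * σ₀ c) else 0)) := by
      intro b c f
      rw [riemLim, hs'.apply f c]
      split_ifs <;> ring
    have h3 : ∑ b, ∑ c, ∑ f, (if a = c then σ₀ c * (K' b f * D b i * D f j) else 0)
        = σ₀ a * pairing K' D i fun a => D a j := by
      have h4 : ∀ b, ∑ c, ∑ f, (if a = c then σ₀ c * (K' b f * D b i * D f j) else 0)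
          = ∑ f, σ₀ a * (K' b f * D b i * D f j) := fun b => by
        rw [Finset.sum_comm]
        simp
      simp only [h4, pairing, Finset.mul_sum, Finset.sum_mul]
      rw [Finset.sum_comm]
    have h5 : ∑ b, ∑ c, ∑ f, (if a = b then D b i * (K' f c * D f j * σ₀ c) else 0)
        = pairing K' D j σ₀ * D a i := by
      have h6 : ∀ b, ∑ c, ∑ f, (if a = b then D b i * (K' f c * D f j * σ₀ c) else 0)
          = if a = b then D b i * pairing K' D j σ₀ else 0 := fun b => by
        split_ifs
        · simp only [pairing, Finset.mul_sum, Finset.sum_mul]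
        · simp
      simp only [h6, Finset.sum_ite_eq, Finset.mem_univ, if_true]
      ring
    simp only [h2, ← Finset.mul_sum, Finset.sum_sub_distrib, h3, h5]
  have h7 : ∑ i, ∑ j, K⁻¹ i j * ∑ b, ∑ c, ∑ f, riemLim K' a b c f * D b i * σ₀ c * D f j
      = K'⁻¹ 0 0 * (energy K K' D * σ₀ a
      - ∑ i, ∑ j, K⁻¹ i j * (pairing K' D j σ₀ * D a i)) := by
    simp only [h1, energy, Finset.sum_mul, ← Finset.sum_sub_distrib, Finset.mul_sum]
    exact Finset.sum_congr rfl fun i _ => Finset.sum_congr rfl fun j _ => by ring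
  rwa [h7] at h

/-- The contraction of two covariant derivatives of a constant section. The mixed term is cancelled
by the curvature term of the Jacobi operator. -/
theorem sum_covLim_covLim (m : BoundaryModel z₀ w₀ G H U K K' D) (σ : Fin (e + 1) → ℝ)
    (a : Fin (e + 1)) :
    ∑ i, ∑ j, K⁻¹ i j * covLim K' D i (covLim K' D j σ) a
      = (normalPairing K K' D σ - σ 0 * energy K K' D) * K'⁻¹ a 0
        - K'⁻¹ 0 0 * ∑ i, ∑ j, K⁻¹ i j * (pairing K' D j σ * D a i)
        + σ 0 * imageNormal K D a := by
  have hs := isSymm_of_posDef m.posDef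
  have h1 : ∀ i j, covLim K' D i (covLim K' D j σ) a
      = (pairing K' D j σ * D 0 i - σ 0 * pairing K' D i fun a => D a j) * K'⁻¹ a 0
        - (K'⁻¹ 0 0 * pairing K' D j σ - σ 0 * D 0 j) * D a i := by
    intro i j
    have h2 : pairing K' D i (covLim K' D j σ)
        = pairing K' D j σ * D 0 i - σ 0 * pairing K' D i fun a => D a j := by
      have := pairing_sub_smul K' D i (fun a => K'⁻¹ a 0) (fun a => D a j) (pairing K' D j σ) (σ 0)
      rw [pairing_normal m.det_ne'] at this
      exact this
    rw [covLim, h2, covLim]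
    ring
  have h3 : normalPairing K K' D σ = ∑ i, ∑ j, K⁻¹ i j * pairing K' D j σ * D 0 i := by
    rw [normalPairing, Finset.sum_comm]
    refine Finset.sum_congr rfl fun j _ => ?_
    rw [sum_mul_row_zero m.row_zero fun i => K⁻¹ i j * pairing K' D j σ, inv_apply_comm hs]
  have h4 : imageNormal K D a = ∑ i, ∑ j, K⁻¹ i j * D a i * D 0 j := by
    rw [imageNormal]
    refine Finset.sum_congr rfl fun i _ => ?_
    rw [sum_mul_row_zero m.row_zero fun j => K⁻¹ i j * D a i]
  rw [h3, h4, energy]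
  simp only [h1, Finset.mul_sum, Finset.sum_mul, ← Finset.sum_sub_distrib,
    ← Finset.sum_add_distrib]
  exact Finset.sum_congr rfl fun i _ => Finset.sum_congr rfl fun j _ => by ring

theorem sum_covLim (σ : Fin (e + 1) → ℝ) (a : Fin (e + 1)) :
    ∑ k, K⁻¹ k 0 * covLim K' D k σ a
      = normalPairing K K' D σ * K'⁻¹ a 0 - σ 0 * imageNormal K D a := by
  simp only [covLim, normalPairing, imageNormal, Finset.mul_sum, Finset.sum_mul,
    ← Finset.sum_sub_distrib]
  exact Finset.sum_congr rfl fun k _ => by ring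

theorem zReg_zeroJacobi (m : BoundaryModel z₀ w₀ G H U K K' D) {σ : Coord d → Fin (e + 1) → ℝ}
    {σ₀ : Fin (e + 1) → ℝ} (hσ : ∀ c, ZReg z₀ (fun w => σ w c) (σ₀ c)) (a : Fin (e + 1)) :
    ZReg z₀ (fun z => zeroJacobi G H U σ z a) (jacobiLim K K' D σ₀ a) := by
  have h := (m.zReg_zeroTrace (fun j c => m.zReg_zeroCov hσ j c) a).neg.add
    (m.zReg_zeroCurv hσ a)
  rw [m.sum_covLim_covLim, sum_covLim] at h
  have h1 : -((normalPairing K K' D σ₀ - σ₀ 0 * energy K K' D) * K'⁻¹ a 0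
        - K'⁻¹ 0 0 * ∑ i, ∑ j, K⁻¹ i j * (pairing K' D j σ₀ * D a i)
        + σ₀ 0 * imageNormal K D a
        - d * (normalPairing K K' D σ₀ * K'⁻¹ a 0 - σ₀ 0 * imageNormal K D a))
      + K'⁻¹ 0 0 * (energy K K' D * σ₀ a - ∑ i, ∑ j, K⁻¹ i j * (pairing K' D j σ₀ * D a i))
      = jacobiLim K K' D σ₀ a := by
    rw [jacobiLim]; ring
  rw [h1] at h
  refine h.congr ?_
  filter_upwards [m.eventually_zeroFrameAt, eventually_nhds_of_eventually m.diff,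
    eventually_all.2 fun c => eventually_nhds_of_eventually (hσ c).differentiable,
    eventually_all.2 fun j => (m.zReg_zeroCov hσ j a).differentiable] with z h2 h3 h4 h5
  exact (zeroJacobi_eq h2 h3 h4 a h5).symm

/-- The biharmonic map equation at the boundary. -/
theorem jacobiLim_tensionLim (m : BoundaryModel z₀ w₀ G H U K K' D)
    (hbi : ∀ᶠ z in 𝓝[posHalf d] z₀, ∀ a, jacobi G H U (tension G H U) z a = 0)
    (a : Fin (e + 1)) : jacobiLim K K' D (tensionLim K K' D) a = 0 := by
  have h := (m.zReg_zeroJacobi (fun c => m.zReg_zeroTension c) a).tendsto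
  have h2 : (fun z => zeroJacobi G H U (fun z a => zeroTension G H U z a) z a)
      =ᶠ[𝓝[posHalf d] z₀] fun _ => 0 := by
    filter_upwards [hbi, m.eventually_zeroFrameAt] with z h3 h4
    exact zeroJacobi_zeroTension (h4.eventually_ne.mono fun w hw => hw.2) a (h3 a)
  have := nhdsWithin_posHalf_neBot (z₀ := z₀) m.source_zero.ge
  exact tendsto_nhds_unique (h.congr' h2) tendsto_const_nhds

end BoundaryModel

/-! ### The indicial polynomial of the Jacobi operator -/

section Indicial

variable {d e : ℕ}

theorem hasFDerivAt_log_ratio {z w : Coord d} (hz : 0 < z 0) (hw : 0 < w 0) :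
    HasFDerivAt (fun v : Coord d => Real.log (v 0 / z 0))
      ((w 0)⁻¹ • (EuclideanSpace.proj 0 : Coord d →L[ℝ] ℝ)) w := by
  have h1 : HasDerivAt (fun t : ℝ => Real.log (t / z 0)) ((1 / z 0) / (w 0 / z 0)) (w 0) :=
    ((hasDerivAt_id (w 0)).div_const (z 0)).log (div_pos hw hz).ne'
  have h2 : (1 / z 0) / (w 0 / z 0) = (w 0)⁻¹ := by
    field_simp
  rw [h2] at h1
  exact h1.comp_hasFDerivAt w (EuclideanSpace.proj 0 : Coord d →L[ℝ] ℝ).hasFDerivAt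

theorem zD_log_ratio {z w : Coord d} (hz : 0 < z 0) (hw : 0 < w 0) (i : Fin (d + 1)) :
    zD i (fun v : Coord d => Real.log (v 0 / z 0)) w = if i = 0 then 1 else 0 := by
  rw [zD, pd, (hasFDerivAt_log_ratio hz hw).fderiv]
  have := hw.ne'
  by_cases hi : i = 0
  · subst hi; simp [basisVec, this]
  · simp [basisVec, hi, Ne.symm hi]

variable {G : Coord d → Matrix (Fin (d + 1)) (Fin (d + 1)) ℝ}
  {H : Coord e → Matrix (Fin (e + 1)) (Fin (e + 1)) ℝ} {U : Coord d → Coord e} {z : Coord d}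

/-- The Jacobi operator on a section `s E_b`, at a zero `z` of a function `s` of `x` with
`x ∂_x s = s₁` and `x ∂_x s₁ = s₂`. -/
theorem zeroJacobi_mul_frame (h : ZeroFrameAt G U z)
    (hd : ∀ᶠ w in 𝓝 z, DifferentiableAt ℝ U w)
    (hA : ∀ i a c, ∀ᶠ w in 𝓝 z, DifferentiableAt ℝ (fun w => connMat H U i w a c) w)
    {s s₁ : Coord d → ℝ} {s₂ : ℝ} (hs0 : s z = 0)
    (hs : ∀ᶠ w in 𝓝 z, DifferentiableAt ℝ s w ∧ ∀ i, zD i s w = if i = 0 then s₁ w else 0)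
    (hs₁ : DifferentiableAt ℝ s₁ z) (hs₂ : ∀ i, zD i s₁ z = if i = 0 then s₂ else 0)
    (a b : Fin (e + 1)) :
    zeroJacobi G H U (fun w c => if c = b then s w else 0) z a
      = -(∑ i, ∑ j, (zeroMetric G z)⁻¹ i j * (if i = 0 then
            (if j = 0 then if a = b then s₂ else 0 else 0) + connMat H U j z a b * s₁ z else 0)
          + zeroTrace G H U (fun j _ c => if j = 0 then if c = b then s₁ z else 0 else 0) z a) := by
  have hsec : ∀ c w, DifferentiableAt ℝ s w →
      DifferentiableAt ℝ (fun v => if c = b then s v else 0) w := by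
    intro c w hw
    by_cases hc : c = b
    · simpa only [hc, if_true] using hw
    · simp only [hc, if_false]
      exact differentiableAt_const 0
  have hcov : ∀ j c, (fun w => zeroCov H U j (fun w c => if c = b then s w else 0) w c)
      =ᶠ[𝓝 z] fun w => (if j = 0 then if c = b then s₁ w else 0 else 0)
        + connMat H U j w c b * s w := by
    intro j c
    filter_upwards [hs] with w hw
    have h1 : zD j (fun v => if c = b then s v else 0) w
        = if j = 0 then if c = b then s₁ w else 0 else 0 := by
      by_cases hc : c = b
      · simp only [hc, if_true, hw.2]
      · simp [hc, zD_const]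
    rw [zeroCov, h1]
    simp
  have hite : ∀ (j : Fin (d + 1)) (c : Fin (e + 1)),
      DifferentiableAt ℝ (fun w => if j = 0 then if c = b then s₁ w else 0 else 0) z ∧
      ∀ i, zD i (fun w => if j = 0 then if c = b then s₁ w else 0 else 0) z
        = if i = 0 then if j = 0 then if c = b then s₂ else 0 else 0 else 0 := by
    intro j c
    by_cases hj : j = 0 <;> by_cases hc : c = b
    · simp only [hj, hc, if_true]
      exact ⟨hs₁, hs₂⟩
    all_goals simp [hj, hc, zD_const]
  have hsz := hs.self_of_nhds
  have hAz : ∀ i a c, DifferentiableAt ℝ (fun w => connMat H U i w a c) z :=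
    fun i a c => (hA i a c).self_of_nhds
  have hprod : ∀ j c, DifferentiableAt ℝ (fun w => connMat H U j w c b * s w) z :=
    fun j c => (hAz j c b).mul hsz.1
  rw [zeroJacobi_eq h hd (fun c => hs.mono fun w hw => hsec c w hw.1) a
    (fun j => ((hite j a).1.fun_add (hprod j a)).congr_of_eventuallyEq (hcov j a))]
  have hcurv : zeroCurv G H U (fun w c => if c = b then s w else 0) z a = 0 := by
    simp [zeroCurv, hs0]
  rw [hcurv, add_zero]
  congr 1
  rw [zeroTrace, zeroTrace, ← Finset.sum_add_distrib]
  refine Finset.sum_congr rfl fun i _ => ?_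
  rw [← Finset.sum_add_distrib]
  refine Finset.sum_congr rfl fun j _ => ?_
  rw [← mul_add]
  congr 1
  have hv : ∀ j c, zeroCov H U j (fun w c => if c = b then s w else 0) z c
      = if j = 0 then if c = b then s₁ z else 0 else 0 := fun j c => by
    have := (hcov j c).self_of_nhds
    simpa [hs0] using this
  have h2 : zeroCov H U i (zeroCov H U j fun w c => if c = b then s w else 0) z a
      = (if i = 0 then
          (if j = 0 then if a = b then s₂ else 0 else 0) + connMat H U j z a b * s₁ z else 0)
        + zeroCov H U i (fun _ c => if j = 0 then if c = b then s₁ z else 0 else 0) z a := by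
    rw [zeroCov, zeroCov, zD_congr (hcov j a), zD_add (hite j a).1 (hprod j a), (hite j a).2 i,
      zD_mul (hAz j a b) hsz.1, hsz.2 i, hs0, zD_const]
    simp only [hv]
    split_ifs <;> ring
  rw [h2]
  simp only [hv]
  ring

end Indicial

namespace BoundaryModel

variable {d e : ℕ} {z₀ : Coord d} {w₀ : Coord e}
  {G : Coord d → Matrix (Fin (d + 1)) (Fin (d + 1)) ℝ}
  {H : Coord e → Matrix (Fin (e + 1)) (Fin (e + 1)) ℝ} {U : Coord d → Coord e}
  {K : Matrix (Fin (d + 1)) (Fin (d + 1)) ℝ} {K' : Matrix (Fin (e + 1)) (Fin (e + 1)) ℝ}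
  {D : Matrix (Fin (e + 1)) (Fin (d + 1)) ℝ}

/-- The limit of the right-hand side of `zeroJacobi_mul_frame` when `s₁` and `s₂` take fixed
values. -/
theorem tendsto_mul_frame (m : BoundaryModel z₀ w₀ G H U K K' D) (s₁ s₂ : ℝ)
    (a b : Fin (e + 1)) :
    Tendsto (fun z => -(∑ i, ∑ j, (zeroMetric G z)⁻¹ i j * (if i = 0 then
            (if j = 0 then if a = b then s₂ else 0 else 0) + connMat H U j z a b * s₁ else 0)
          + zeroTrace G H U (fun j _ c => if j = 0 then if c = b then s₁ else 0 else 0) z a))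
      (𝓝[posHalf d] z₀)
      (𝓝 (s₁ * ((if a = b then d * K⁻¹ 0 0 else 0)
        - 2 * (normalPairing K K' D (fun c => if c = b then 1 else 0) * K'⁻¹ a 0
          - (if 0 = b then imageNormal K D a else 0)))
        - s₂ * (if a = b then K⁻¹ 0 0 else 0))) := by
  have hs := isSymm_of_posDef m.posDef
  set E : Fin (e + 1) → ℝ := fun c => if c = b then 1 else 0 with hE
  have hconn : ∀ j, ZReg z₀ (fun z => connMat H U j z a b) (covLim K' D j E a) := by
    intro j
    have h := m.zReg_connMat j a b
    have h2 := sum_connLim_mul (K' := K') (D := D) j E a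
    have h3 : ∑ c, ((if a = c then D 0 j else 0) + ∑ b, chrLim K' a b c * D b j) * E c
        = (if a = b then D 0 j else 0) + ∑ c, chrLim K' a c b * D c j := by
      simp [hE]
    rw [h3] at h2
    rwa [h2] at h
  have h1 : ZReg z₀ (fun z => ∑ i, ∑ j, (zeroMetric G z)⁻¹ i j * (if i = 0 then
            (if j = 0 then if a = b then s₂ else 0 else 0) + connMat H U j z a b * s₁ else 0))
      (∑ i, ∑ j, K⁻¹ i j * (if i = 0 then
            (if j = 0 then if a = b then s₂ else 0 else 0) + covLim K' D j E a * s₁ else 0)) := by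
    refine ZReg.sum fun i _ => ZReg.sum fun j _ => (m.metric.inv m.det_ne i j).mul ?_
    by_cases hi : i = 0
    · simp only [hi, if_true]
      exact (ZReg.const _).add ((hconn j).mul (ZReg.const _))
    · simp only [hi, if_false]
      exact ZReg.const 0
  have h2 := m.zReg_zeroTrace
    (ξ := fun j _ c => if j = 0 then if c = b then s₁ else 0 else 0)
    (ξ₀ := fun j c => if j = 0 then if c = b then s₁ else 0 else 0) (fun j c => ZReg.const _) a
  have hcov : ∀ i j : Fin (d + 1),
      covLim K' D i (fun c => if j = 0 then if c = b then s₁ else 0 else 0) a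
      = if j = 0 then s₁ * covLim K' D i E a else 0 := by
    intro i j
    by_cases hj : j = 0
    · simp only [hj, if_true, covLim, pairing, hE, mul_ite, mul_one, mul_zero, Finset.sum_ite_eq',
        Finset.mem_univ]
      split_ifs <;> ring
    · simp [hj, covLim, pairing]
  have h3 := (h1.add h2).neg.tendsto
  have hsum1 : ∑ i, ∑ j, K⁻¹ i j * (if i = 0 then
            (if j = 0 then if a = b then s₂ else 0 else 0) + covLim K' D j E a * s₁ else 0)
      = (if a = b then K⁻¹ 0 0 * s₂ else 0) + s₁ * ∑ k, K⁻¹ k 0 * covLim K' D k E a := by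
    rw [Finset.sum_comm, Finset.mul_sum]
    simp only [mul_ite, mul_zero, Finset.sum_ite_eq', Finset.mem_univ, if_true, mul_add,
      Finset.sum_add_distrib]
    congr 1
    exact Finset.sum_congr rfl fun j _ => by rw [inv_apply_comm hs 0 j]; ring
  have hsum2 : ∑ i, ∑ j, K⁻¹ i j *
        covLim K' D i (fun c => if j = 0 then if c = b then s₁ else 0 else 0) a
      = s₁ * ∑ k, K⁻¹ k 0 * covLim K' D k E a := by
    simp only [hcov, mul_ite, mul_zero, Finset.sum_ite_eq', Finset.mem_univ, if_true,
      Finset.mul_sum]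
    exact Finset.sum_congr rfl fun j _ => by ring
  have hsum3 : ∑ k, K⁻¹ k 0 * (if k = 0 then if a = b then s₁ else 0 else 0)
      = if a = b then K⁻¹ 0 0 * s₁ else 0 := by
    simp
  rw [hsum1, hsum2, hsum3, sum_covLim] at h3
  convert h3 using 2
  simp only [hE]
  split_ifs <;> ring

theorem eventually_zeroJacobi_mul_frame (m : BoundaryModel z₀ w₀ G H U K K' D) :
    ∀ᶠ z in 𝓝[posHalf d] z₀, ZeroFrameAt G U z ∧ (∀ᶠ w in 𝓝 z, DifferentiableAt ℝ U w) ∧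
      ∀ i a c, ∀ᶠ w in 𝓝 z, DifferentiableAt ℝ (fun w => connMat H U i w a c) w :=
  m.eventually_zeroFrameAt.and ((eventually_nhds_of_eventually m.diff).and
    (eventually_all.2 fun i => eventually_all.2 fun a => eventually_all.2 fun c =>
      eventually_nhds_of_eventually (m.zReg_connMat i a c).differentiable))

/-- The indicial polynomial of the Jacobi operator, in terms of the boundary values of the metrics
and of the differential. -/
theorem hasIndicialPolynomial (m : BoundaryModel z₀ w₀ G H U K K' D) :
    HasIndicialPolynomial (zeroJacobi G H U) z₀
      ![Matrix.of fun a b => jacobiLim K K' D (fun c => if c = b then 1 else 0) a,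
        Matrix.of fun a b => (if a = b then d * K⁻¹ 0 0 else 0)
          - 2 * (normalPairing K K' D (fun c => if c = b then 1 else 0) * K'⁻¹ a 0
            - (if 0 = b then imageNormal K D a else 0)),
        Matrix.of fun a b => -(if a = b then K⁻¹ 0 0 else 0)] := by
  intro j
  refine tendsto_pi_nhds.2 fun a => tendsto_pi_nhds.2 fun b => ?_
  -- The test sections are `1`, `log (x / x(z))` and `log (x / x(z)) ^ 2 / 2` times a frame section.
  fin_cases j
  · have h := (m.zReg_zeroJacobi (σ := fun _ c => if c = b then 1 else 0)
      (σ₀ := fun c => if c = b then 1 else 0) (fun c => ZReg.const _) a).tendsto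
    simpa [zeroCoeff] using h
  · have h := m.tendsto_mul_frame 1 0 a b
    rw [one_mul, zero_mul, sub_zero] at h
    refine h.congr' ?_
    filter_upwards [m.eventually_zeroJacobi_mul_frame] with z hz
    have h1 := zeroJacobi_mul_frame (H := H) (s := fun w => Real.log (w 0 / z 0)) (s₁ := fun _ => 1)
      (s₂ := 0) hz.1 hz.2.1 hz.2.2 (by simp [hz.1.pos.ne'])
      (by
        filter_upwards [(isOpen_posHalf d).mem_nhds (mem_posHalf.2 hz.1.pos)] with w hw
        exact ⟨(hasFDerivAt_log_ratio hz.1.pos hw).differentiableAt, zD_log_ratio hz.1.pos hw⟩)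
      (differentiableAt_const _) (by simp [zD_const]) a b
    rw [← h1]
    simp [zeroCoeff]
  · have h := m.tendsto_mul_frame 0 1 a b
    rw [one_mul, zero_mul, zero_sub] at h
    refine h.congr' ?_
    filter_upwards [m.eventually_zeroJacobi_mul_frame] with z hz
    have h1 := zeroJacobi_mul_frame (H := H)
      (s := fun w => Real.log (w 0 / z 0) ^ 2 / 2) (s₁ := fun w => Real.log (w 0 / z 0))
      (s₂ := 1) hz.1 hz.2.1 hz.2.2 (by simp [hz.1.pos.ne'])
      (by
        filter_upwards [(isOpen_posHalf d).mem_nhds (mem_posHalf.2 hz.1.pos)] with w hw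
        have hl := (hasFDerivAt_log_ratio hz.1.pos hw).differentiableAt
        have hsq : (fun w : Coord d => Real.log (w 0 / z 0) ^ 2 / 2)
            = fun w => (1 / 2 * Real.log (w 0 / z 0)) * Real.log (w 0 / z 0) := by
          funext v; ring
        have hc : DifferentiableAt ℝ (fun _ : Coord d => (1 / 2 : ℝ)) w := differentiableAt_const _
        rw [hsq]
        refine ⟨(hc.fun_mul hl).fun_mul hl, fun i => ?_⟩
        rw [zD_mul (hc.fun_mul hl) hl, zD_mul hc hl, zD_const, zD_log_ratio hz.1.pos hw]
        split_ifs <;> ring)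
      (hasFDerivAt_log_ratio hz.1.pos hz.1.pos).differentiableAt (zD_log_ratio hz.1.pos hz.1.pos)
      a b
    have hlog : Real.log (z 0 / z 0) = 0 := by simp [hz.1.pos.ne']
    rw [hlog] at h1
    rw [← h1]
    simp [zeroCoeff]

end BoundaryModel

/-! ### Linear algebra of the boundary model -/

section PosDefAlgebra

open scoped MatrixOrder ComplexOrder in
theorem exists_eq_transpose_mul_self_of_posDef {ι : Type*} [Fintype ι] [DecidableEq ι]
    {A : Matrix ι ι ℝ} (hA : A.PosDef) : ∃ C : Matrix ι ι ℝ, IsUnit C ∧ A = Cᵀ * C := by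
  obtain ⟨C, hC, rfl⟩ := CStarAlgebra.isStrictlyPositive_iff_eq_star_mul_self.mp
    hA.isStrictlyPositive
  exact ⟨C, hC, by rw [Matrix.star_eq_conjTranspose, Matrix.conjTranspose_eq_transpose_of_trivial]⟩

/-- `tr (A Lᵀ B L)` is the squared Frobenius norm of a matrix equivalent to `L`. -/
theorem trace_mul_transpose_mul_mul {ι κ : Type*} [Fintype ι] [DecidableEq ι] [Fintype κ]
    [DecidableEq κ] {A : Matrix ι ι ℝ} {B : Matrix κ κ ℝ} (hA : A.PosDef) (hB : B.PosDef)
    (L : Matrix κ ι ℝ) :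
    0 ≤ (A * Lᵀ * B * L).trace ∧ ((A * Lᵀ * B * L).trace = 0 → L = 0) := by
  obtain ⟨C, hC, rfl⟩ := exists_eq_transpose_mul_self_of_posDef hA
  obtain ⟨C', hC', rfl⟩ := exists_eq_transpose_mul_self_of_posDef hB
  have h : (Cᵀ * C * Lᵀ * (C'ᵀ * C') * L).trace
      = ((C' * L * Cᵀ)ᴴ * (C' * L * Cᵀ)).trace := by
    rw [Matrix.conjTranspose_eq_transpose_of_trivial, Matrix.transpose_mul, Matrix.transpose_mul,
      Matrix.transpose_transpose]
    simp only [Matrix.mul_assoc]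
    rw [Matrix.trace_mul_comm]
    simp only [Matrix.mul_assoc]
  rw [h]
  refine ⟨(Matrix.posSemidef_conjTranspose_mul_self _).trace_nonneg, fun h0 => ?_⟩
  have h1 := Matrix.trace_conjTranspose_mul_self_eq_zero_iff.1 h0
  have hCt : IsUnit Cᵀ := (Matrix.isUnit_transpose C).2 hC
  have h2 : C' * L = 0 := by
    have := congrArg (· * (Cᵀ)⁻¹) h1
    simpa [Matrix.mul_assoc,
      Matrix.mul_nonsing_inv _ ((Matrix.isUnit_iff_isUnit_det _).1 hCt)] using this
  have := congrArg (C'⁻¹ * ·) h2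
  simpa [← Matrix.mul_assoc,
    Matrix.nonsing_inv_mul _ ((Matrix.isUnit_iff_isUnit_det _).1 hC')] using this

variable {d e : ℕ}

/-- The inverse of the Gram matrix on `ker (dx / x)` is the Schur complement in `K⁻¹` of the entry
`K⁻¹ 0 0`. -/
theorem inv_submatrix_succ {K : Matrix (Fin (d + 1)) (Fin (d + 1)) ℝ} (hK : K.PosDef)
    (i j : Fin d) :
    (K.submatrix Fin.succ Fin.succ)⁻¹ i j
      = K⁻¹ i.succ j.succ - K⁻¹ i.succ 0 * K⁻¹ j.succ 0 / K⁻¹ 0 0 := by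
  have hs := isSymm_of_posDef hK
  have hpos : K⁻¹ 0 0 ≠ 0 := hK.inv.diag_pos.ne'
  have hinv : ∀ i j, ∑ k : Fin d, K i k.succ * K⁻¹ k.succ j
      = (if i = j then 1 else 0) - K i 0 * K⁻¹ 0 j := fun i j => by
    have h := congrFun (congrFun (Matrix.mul_nonsing_inv K
      (isUnit_iff_ne_zero.2 hK.det_pos.ne')) i) j
    rw [Matrix.mul_apply, Fin.sum_univ_succ, Matrix.one_apply] at h
    linarith
  have h : K.submatrix Fin.succ Fin.succ * Matrix.of (fun i j : Fin d =>
      K⁻¹ i.succ j.succ - K⁻¹ i.succ 0 * K⁻¹ j.succ 0 / K⁻¹ 0 0) = 1 := by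
    ext i j
    rw [Matrix.mul_apply, Matrix.one_apply]
    have h1 : ∀ k : Fin d, K i.succ k.succ *
        (K⁻¹ k.succ j.succ - K⁻¹ k.succ 0 * K⁻¹ j.succ 0 / K⁻¹ 0 0)
        = K i.succ k.succ * K⁻¹ k.succ j.succ
          - (K i.succ k.succ * K⁻¹ k.succ 0) * (K⁻¹ j.succ 0 / K⁻¹ 0 0) := fun k => by ring
    simp only [Matrix.submatrix_apply, Matrix.of_apply, h1, Finset.sum_sub_distrib,
      ← Finset.sum_mul, hinv, Fin.succ_inj, Fin.succ_ne_zero, if_false]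
    rw [inv_apply_comm hs 0 j.succ]
    field_simp
    ring
  rw [Matrix.inv_eq_right_inv h, Matrix.of_apply]

/-- The trace of `Λ^* Λ`, up to the normalization of the metrics. -/
def tangentialEnergy (K : Matrix (Fin (d + 1)) (Fin (d + 1)) ℝ)
    (K' : Matrix (Fin (e + 1)) (Fin (e + 1)) ℝ) (D : Matrix (Fin (e + 1)) (Fin (d + 1)) ℝ) : ℝ :=
  ((K.submatrix Fin.succ Fin.succ)⁻¹ * (lambdaMat D)ᵀ * K'.submatrix Fin.succ Fin.succ
    * lambdaMat D).trace

theorem trace_lambdaAdj_mul {K : Matrix (Fin (d + 1)) (Fin (d + 1)) ℝ} (hK : K.PosDef)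
    (K' : Matrix (Fin (e + 1)) (Fin (e + 1)) ℝ) (D : Matrix (Fin (e + 1)) (Fin (d + 1)) ℝ) :
    (lambdaAdj K K' D * lambdaMat D).trace
      = (K⁻¹ 0 0)⁻¹ * K'⁻¹ 0 0 * tangentialEnergy K K' D := by
  have hpos : K⁻¹ 0 0 ≠ 0 := hK.inv.diag_pos.ne'
  have hsub : (K.submatrix Fin.succ Fin.succ).PosDef := hK.submatrix (Fin.succ_injective d)
  have h1 : (kerGram K)⁻¹ = (K⁻¹ 0 0)⁻¹ • (K.submatrix Fin.succ Fin.succ)⁻¹ := by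
    refine Matrix.inv_eq_right_inv ?_
    rw [kerGram, conormalSq, Matrix.smul_mul, Matrix.mul_smul, smul_smul, mul_inv_cancel₀ hpos,
      one_smul, Matrix.mul_nonsing_inv _ (isUnit_iff_ne_zero.2 hsub.det_pos.ne')]
  rw [lambdaAdj, h1, kerGram, conormalSq, tangentialEnergy]
  simp only [Matrix.smul_mul, Matrix.mul_smul, Matrix.trace_smul, smul_eq_mul]
  ring

theorem tangentialEnergy_nonneg {K : Matrix (Fin (d + 1)) (Fin (d + 1)) ℝ} (hK : K.PosDef)
    {K' : Matrix (Fin (e + 1)) (Fin (e + 1)) ℝ} (hK' : K'.PosDef)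
    (D : Matrix (Fin (e + 1)) (Fin (d + 1)) ℝ) : 0 ≤ tangentialEnergy K K' D :=
  (trace_mul_transpose_mul_mul (hK.submatrix (Fin.succ_injective d)).inv
    (hK'.submatrix (Fin.succ_injective e)) (lambdaMat D)).1

theorem lambdaMat_eq_zero_of_tangentialEnergy {K : Matrix (Fin (d + 1)) (Fin (d + 1)) ℝ}
    (hK : K.PosDef) {K' : Matrix (Fin (e + 1)) (Fin (e + 1)) ℝ} (hK' : K'.PosDef)
    {D : Matrix (Fin (e + 1)) (Fin (d + 1)) ℝ} (h : tangentialEnergy K K' D = 0) :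
    lambdaMat D = 0 :=
  (trace_mul_transpose_mul_mul (hK.submatrix (Fin.succ_injective d)).inv
    (hK'.submatrix (Fin.succ_injective e)) (lambdaMat D)).2 h

/-- The inner product with Gram matrix `K'`. -/
def gramInner (K' : Matrix (Fin (e + 1)) (Fin (e + 1)) ℝ) (v σ : Fin (e + 1) → ℝ) : ℝ :=
  ∑ c, (∑ b, K' b c * v b) * σ c

theorem normalPairing_eq (K : Matrix (Fin (d + 1)) (Fin (d + 1)) ℝ)
    (K' : Matrix (Fin (e + 1)) (Fin (e + 1)) ℝ) (D : Matrix (Fin (e + 1)) (Fin (d + 1)) ℝ)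
    (σ : Fin (e + 1) → ℝ) : normalPairing K K' D σ = gramInner K' (imageNormal K D) σ := by
  simp only [normalPairing, pairing, gramInner, imageNormal, Finset.mul_sum, Finset.sum_mul]
  rw [Finset.sum_comm]
  refine Finset.sum_congr rfl fun c _ => ?_
  rw [Finset.sum_comm]
  exact Finset.sum_congr rfl fun b _ => Finset.sum_congr rfl fun k _ => by ring

theorem gramInner_sub_smul_left (K' : Matrix (Fin (e + 1)) (Fin (e + 1)) ℝ)
    (v v' σ : Fin (e + 1) → ℝ) (t : ℝ) :
    gramInner K' (fun a => v a - t * v' a) σ = gramInner K' v σ - t * gramInner K' v' σ := by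
  simp only [gramInner, Finset.mul_sum, Finset.sum_mul, ← Finset.sum_sub_distrib]
  exact Finset.sum_congr rfl fun c _ => Finset.sum_congr rfl fun b _ => by ring

theorem gramInner_comm {K' : Matrix (Fin (e + 1)) (Fin (e + 1)) ℝ} (hs : K'.IsSymm)
    (v σ : Fin (e + 1) → ℝ) : gramInner K' v σ = gramInner K' σ v := by
  simp only [gramInner, Finset.sum_mul]
  rw [Finset.sum_comm]
  exact Finset.sum_congr rfl fun c _ => Finset.sum_congr rfl fun b _ => by
    rw [hs.apply b c]; ring

theorem gramInner_normal {K' : Matrix (Fin (e + 1)) (Fin (e + 1)) ℝ} (hK : K'.PosDef)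
    (v : Fin (e + 1) → ℝ) : gramInner K' v (fun a => K'⁻¹ a 0) = v 0 := by
  have h := fun b => congrFun (congrFun (Matrix.mul_nonsing_inv K'
    (isUnit_iff_ne_zero.2 hK.det_pos.ne')) b) 0
  simp only [Matrix.mul_apply, Matrix.one_apply] at h
  simp only [gramInner, Finset.sum_mul]
  rw [Finset.sum_comm]
  have h2 : ∀ b, ∑ c, K' b c * v b * K'⁻¹ c 0 = v b * ∑ c, K' b c * K'⁻¹ c 0 := fun b => by
    rw [Finset.mul_sum]
    exact Finset.sum_congr rfl fun c _ => by ring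
  simp [h2, h]

theorem gramInner_self_pos {K' : Matrix (Fin (e + 1)) (Fin (e + 1)) ℝ} (hK : K'.PosDef)
    {v : Fin (e + 1) → ℝ} (hv : v ≠ 0) : 0 < gramInner K' v v := by
  have h := hK.dotProduct_mulVec_pos hv
  have h2 : star v ⬝ᵥ (K' *ᵥ v) = gramInner K' v v := by
    simp only [dotProduct, Matrix.mulVec, gramInner, star_trivial, Finset.mul_sum, Finset.sum_mul]
    rw [Finset.sum_comm]
    exact Finset.sum_congr rfl fun c _ => Finset.sum_congr rfl fun b _ => by ring
  rwa [h2] at h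

/-- The energy density splits into its normal and its tangential part. -/
theorem energy_eq {K : Matrix (Fin (d + 1)) (Fin (d + 1)) ℝ} (hK : K.PosDef)
    {K' : Matrix (Fin (e + 1)) (Fin (e + 1)) ℝ} (hs' : K'.IsSymm)
    {D : Matrix (Fin (e + 1)) (Fin (d + 1)) ℝ} (hD : ∀ j, D 0 j = if j = 0 then 1 else 0) :
    energy K K' D = gramInner K' (imageNormal K D) (imageNormal K D) / K⁻¹ 0 0
      + tangentialEnergy K K' D := by
  have hs := isSymm_of_posDef hK
  have hpos : K⁻¹ 0 0 ≠ 0 := hK.inv.diag_pos.ne'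
  set p : Fin (d + 1) → Fin (d + 1) → ℝ := fun i j => pairing K' D i fun a => D a j with hp
  have h1 : gramInner K' (imageNormal K D) (imageNormal K D)
      = ∑ i, ∑ j, K⁻¹ i 0 * K⁻¹ j 0 * p i j := by
    rw [← normalPairing_eq, normalPairing]
    refine Finset.sum_congr rfl fun i _ => ?_
    simp only [hp, pairing, imageNormal, Finset.mul_sum]
    rw [Finset.sum_comm]
    exact Finset.sum_congr rfl fun j _ => Finset.sum_congr rfl fun c _ => by ring
  have h2 : tangentialEnergy K K' D = ∑ i : Fin d, ∑ j : Fin d,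
      (K.submatrix Fin.succ Fin.succ)⁻¹ i j * p i.succ j.succ := by
    have hps : ∀ i j : Fin d, p i.succ j.succ = ((lambdaMat D)ᵀ *
        (K'.submatrix Fin.succ Fin.succ * lambdaMat D)) j i := by
      intro i j
      simp only [hp, pairing, Matrix.mul_apply, Fin.sum_univ_succ (n := e), hD, Fin.succ_ne_zero,
        if_false, mul_zero, zero_add, Matrix.transpose_apply, lambdaMat, Matrix.submatrix_apply]
      exact Finset.sum_congr rfl fun c _ => by
        rw [mul_comm]
        congr 1
        exact Finset.sum_congr rfl fun b _ => by rw [hs'.apply c.succ b.succ]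
    rw [tangentialEnergy, Matrix.mul_assoc, Matrix.mul_assoc, Matrix.trace]
    simp only [Matrix.diag_apply]
    refine Finset.sum_congr rfl fun i _ => ?_
    rw [Matrix.mul_apply]
    have hpc : ∀ i j, p i j = p j i := fun i j =>
      gramInner_comm hs' (fun a => D a i) (fun a => D a j)
    exact Finset.sum_congr rfl fun j _ => by rw [← hps, hpc]
  have h3 : energy K K' D - (∑ i, ∑ j, K⁻¹ i 0 * K⁻¹ j 0 * p i j) / K⁻¹ 0 0
      = ∑ i, ∑ j, (K⁻¹ i j - K⁻¹ i 0 * K⁻¹ j 0 / K⁻¹ 0 0) * p i j := by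
    rw [energy]
    simp only [Finset.sum_div, ← Finset.sum_sub_distrib]
    exact Finset.sum_congr rfl fun i _ => Finset.sum_congr rfl fun j _ => by
      simp only [hp]; ring
  have h4 : ∑ i, ∑ j, (K⁻¹ i j - K⁻¹ i 0 * K⁻¹ j 0 / K⁻¹ 0 0) * p i j
      = tangentialEnergy K K' D := by
    have h5 : ∀ j, K⁻¹ 0 j - K⁻¹ 0 0 * K⁻¹ j 0 / K⁻¹ 0 0 = 0 := fun j => by
      rw [inv_apply_comm hs 0 j]; field_simp; ring
    have h6 : ∀ i, K⁻¹ i 0 - K⁻¹ i 0 * K⁻¹ 0 0 / K⁻¹ 0 0 = 0 := fun i => by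
      field_simp; ring
    rw [h2]
    simp only [Fin.sum_univ_succ (n := d), h5, h6, zero_mul, zero_add, Finset.sum_const_zero,
      ← inv_submatrix_succ hK]
  rw [h1, ← h4, ← h3]
  ring

end PosDefAlgebra

/-! ### Consequences of the biharmonic map equation at the boundary -/

namespace BoundaryModel

variable {d e : ℕ} {z₀ : Coord d} {w₀ : Coord e}
  {G : Coord d → Matrix (Fin (d + 1)) (Fin (d + 1)) ℝ}
  {H : Coord e → Matrix (Fin (e + 1)) (Fin (e + 1)) ℝ} {U : Coord d → Coord e}
  {K : Matrix (Fin (d + 1)) (Fin (d + 1)) ℝ} {K' : Matrix (Fin (e + 1)) (Fin (e + 1)) ℝ}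
  {D : Matrix (Fin (e + 1)) (Fin (d + 1)) ℝ}

theorem imageNormal_zero (m : BoundaryModel z₀ w₀ G H U K K' D) : imageNormal K D 0 = K⁻¹ 0 0 := by
  rw [imageNormal, sum_mul_row_zero m.row_zero fun k => K⁻¹ k 0]

/-- The dichotomy at a boundary point. The component of the boundary equation in the direction of
`β` forces either `β = 0` or a value of the energy which the component along `dX / X` excludes; when
`β = 0`, the latter component is a quadratic equation for the tangential energy. -/
theorem dichotomy (m : BoundaryModel z₀ w₀ G H U K K' D) (hd : 1 ≤ d)
    (h : ∀ a, jacobiLim K K' D (tensionLim K K' D) a = 0) :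
    (∀ a, imageNormal K D a = K⁻¹ 0 0 / K'⁻¹ 0 0 * K'⁻¹ a 0) ∧
      (tangentialEnergy K K' D = 0 ∨ K'⁻¹ 0 0 * tangentialEnergy K K' D = d * K⁻¹ 0 0) := by
  have hs' := isSymm_of_posDef m.posDef'
  have hk : 0 < K⁻¹ 0 0 := m.posDef.inv.diag_pos
  have hk' : 0 < K'⁻¹ 0 0 := m.posDef'.inv.diag_pos
  have hT := tangentialEnergy_nonneg m.posDef m.posDef' D
  have hE := energy_eq m.posDef hs' m.row_zero
  have hd' : (1 : ℝ) ≤ d := by exact_mod_cast hd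
  have hw0 := m.imageNormal_zero
  set w := imageNormal K D with hw
  set n : Fin (e + 1) → ℝ := fun a => K'⁻¹ a 0 with hn
  set W := gramInner K' w w with hW
  set E := energy K K' D with hEdef
  set T := tangentialEnergy K K' D with hTdef
  set k := K⁻¹ 0 0 with hkdef
  set k' := K'⁻¹ 0 0 with hkdef'
  set β : Fin (e + 1) → ℝ := fun a => w a - k / k' * n a with hβ
  have hwn : gramInner K' w n = k := (gramInner_normal m.posDef' w).trans hw0
  have hnn : gramInner K' n n = k' := gramInner_normal m.posDef' n
  have hββ : gramInner K' β β = W - k ^ 2 / k' := by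
    have h1 : gramInner K' β β = gramInner K' w β - k / k' * gramInner K' n β :=
      gramInner_sub_smul_left K' w n β (k / k')
    rw [h1, gramInner_comm hs' w β, gramInner_comm hs' n β, hβ, gramInner_sub_smul_left,
      gramInner_sub_smul_left, gramInner_comm hs' n w, hwn, hnn]
    field_simp
    ring
  have hNP : normalPairing K K' D (tensionLim K K' D) = E * k - (d + 1) * W := by
    have h1 : tensionLim K K' D = fun a => E * n a - (d + 1) * w a := rfl
    rw [normalPairing_eq, h1]
    simp only [gramInner, mul_sub, Finset.sum_sub_distrib]
    rw [← hwn, hW]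
    simp only [gramInner, Finset.mul_sum]
    congr 1
    · exact Finset.sum_congr rfl fun c _ => by ring
    · exact Finset.sum_congr rfl fun c _ => by ring
  have ht0 : tensionLim K K' D 0 = E * k' - (d + 1) * k := by
    rw [tensionLim, ← hw, hw0]
  have heq : ∀ a, (d - 1) * (E * k - (d + 1) * W) * n a + (E * k' - (d + 1) * k) * E * n a
      - (d + 1) * (E * k' - (d + 1) * k) * w a + k' * E * (E * n a - (d + 1) * w a) = 0 := by
    intro a
    have h1 := h a
    rw [jacobiLim, hNP, ht0, tensionLim] at h1
    exact h1
  have heq0 : (d - 1) * (E * k - (d + 1) * W) * k' + (E * k' - (d + 1) * k) * E * k'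
      - (d + 1) * (E * k' - (d + 1) * k) * k + k' * E * (E * k' - (d + 1) * k) = 0 := by
    have h1 := heq 0
    rwa [hw0] at h1
  have hEk : E * k = W + T * k := by
    rw [hE]; field_simp
  have hβ0 : β = 0 := by
    by_contra hne
    -- The Cauchy-Schwarz inequality for `w` and `n` is strict.
    have hB : 0 < W * k' - k ^ 2 := by
      have h1 := gramInner_self_pos m.posDef' hne
      rw [hββ, sub_pos, div_lt_iff₀ hk'] at h1
      linarith
    obtain ⟨a, ha⟩ : ∃ a, β a ≠ 0 := by
      by_contra hcon
      push Not at hcon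
      exact hne (funext hcon)
    have ha' : k' * w a - k * n a ≠ 0 := by
      intro h0
      refine ha ?_
      simp only [hβ]
      field_simp
      linarith
    -- Eliminating `n` between the equations `heq` and `heq0` leaves a multiple of `β`.
    have h1 : (d + 1) * (2 * (E * k') - (d + 1) * k) * (k' * w a - k * n a) = 0 := by
      linear_combination (-k') * heq a + n a * heq0
    have h2 : 2 * (E * k') = (d + 1) * k := by
      rcases mul_eq_zero.1 h1 with h1 | h1
      · rcases mul_eq_zero.1 h1 with h1 | h1
        · exact absurd h1 (by positivity)
        · linarith
      · exact absurd h1 ha'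
    -- With this value of `E` the equation `heq0` is `(d - 1) (d + 1)` times a positive number, which
    -- leaves only `d = 1`; then `E * k' = k` contradicts `E * k ≥ W` and the strict inequality.
    have h3 : (d - 1) * (d + 1) * (k ^ 2 / 2 + (W * k' - k ^ 2)) = 0 := by
      linear_combination (-1) * heq0 + ((d - 1) * k / 2 + E * k'
        - (d + 1) * k) * h2
    have h4 : (d : ℝ) = 1 := by
      rcases mul_eq_zero.1 h3 with h3 | h3
      · rcases mul_eq_zero.1 h3 with h3 | h3
        · linarith
        · exact absurd h3 (by positivity)
      · exact absurd h3 (by positivity)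
    rw [h4] at h2
    have h5 : E * k' = k := by linarith
    have h6 : k ^ 2 = W * k' + T * k * k' := by
      linear_combination (-k) * h5 + k' * hEk
    have h7 : 0 ≤ T * k * k' := by positivity
    linarith
  have hwa : ∀ a, w a = k / k' * n a := fun a => sub_eq_zero.1 (congrFun hβ0 a)
  refine ⟨hwa, ?_⟩
  have hWk : W * k' = k ^ 2 := by
    have h1 : gramInner K' β β = 0 := by rw [hβ0]; simp [gramInner]
    rw [hββ] at h1
    field_simp at h1
    linarith
  have hEk' : E * k' = k + k' * T := by
    have h1 : k * (E * k' - (k + k' * T)) = 0 := by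
      linear_combination k' * hEk + hWk
    rcases mul_eq_zero.1 h1 with h1 | h1
    · exact absurd h1 hk.ne'
    · linarith
  have h1 : k' * T * (k' * T - d * k) = 0 := by
    have h2 : (E * k' - (d + 1) * k) * (E * k' - k) = 0 := by
      linear_combination (1 / 2) * heq0 + (d - 1) * (d + 1) / 2 * hWk
    rw [hEk'] at h2
    linear_combination h2
  rcases mul_eq_zero.1 h1 with h1 | h1
  · rcases mul_eq_zero.1 h1 with h1 | h1
    · exact absurd h1 hk'.ne'
    · exact Or.inl h1
  · exact Or.inr (by linarith)

theorem betaVec_eq_zero (m : BoundaryModel z₀ w₀ G H U K K' D)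
    (h : ∀ a, imageNormal K D a = K⁻¹ 0 0 / K'⁻¹ 0 0 * K'⁻¹ a 0) : betaVec K K' D = 0 := by
  have hk : K⁻¹ 0 0 ≠ 0 := m.posDef.inv.diag_pos.ne'
  funext a
  have h1 : (D *ᵥ normalVec K) a = imageNormal K D a / K⁻¹ 0 0 := by
    simp only [Matrix.mulVec, dotProduct, normalVec, imageNormal, Finset.sum_div]
    exact Finset.sum_congr rfl fun k _ => by ring
  rw [betaVec, Pi.sub_apply, h1, h a, normalVec, Pi.zero_apply]
  field_simp
  ring

theorem normalPairing_eq_of_imageNormal (m : BoundaryModel z₀ w₀ G H U K K' D)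
    (hw : ∀ a, imageNormal K D a = K⁻¹ 0 0 / K'⁻¹ 0 0 * K'⁻¹ a 0) (σ : Fin (e + 1) → ℝ) :
    normalPairing K K' D σ = K⁻¹ 0 0 / K'⁻¹ 0 0 * σ 0 := by
  have hs' := isSymm_of_posDef m.posDef'
  rw [normalPairing_eq]
  have h1 : imageNormal K D = fun a => (fun _ => (0 : ℝ)) a
      - (-(K⁻¹ 0 0 / K'⁻¹ 0 0)) * (fun a => K'⁻¹ a 0) a := by
    funext a; rw [hw a]; ring
  rw [h1, gramInner_sub_smul_left, gramInner_comm hs' (fun a => K'⁻¹ a 0),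
    gramInner_normal m.posDef']
  simp [gramInner]

theorem energy_eq_of_imageNormal (m : BoundaryModel z₀ w₀ G H U K K' D)
    (hw : ∀ a, imageNormal K D a = K⁻¹ 0 0 / K'⁻¹ 0 0 * K'⁻¹ a 0)
    (hT : K'⁻¹ 0 0 * tangentialEnergy K K' D = d * K⁻¹ 0 0) :
    energy K K' D = (d + 1) * (K⁻¹ 0 0 / K'⁻¹ 0 0) := by
  have hk : K⁻¹ 0 0 ≠ 0 := m.posDef.inv.diag_pos.ne'
  have hk' : K'⁻¹ 0 0 ≠ 0 := m.posDef'.inv.diag_pos.ne'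
  rw [energy_eq m.posDef (isSymm_of_posDef m.posDef') m.row_zero, ← normalPairing_eq,
    m.normalPairing_eq_of_imageNormal hw, m.imageNormal_zero]
  field_simp
  linarith

theorem tensionLim_eq_zero (m : BoundaryModel z₀ w₀ G H U K K' D)
    (hw : ∀ a, imageNormal K D a = K⁻¹ 0 0 / K'⁻¹ 0 0 * K'⁻¹ a 0)
    (hT : K'⁻¹ 0 0 * tangentialEnergy K K' D = d * K⁻¹ 0 0) (a : Fin (e + 1)) :
    tensionLim K K' D a = 0 := by
  rw [tensionLim, m.energy_eq_of_imageNormal hw hT, hw a]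
  ring

theorem trace_lambda_eq (m : BoundaryModel z₀ w₀ G H U K K' D)
    (hT : K'⁻¹ 0 0 * tangentialEnergy K K' D = d * K⁻¹ 0 0) :
    (lambdaAdj K K' D * lambdaMat D).trace = d := by
  have hk : K⁻¹ 0 0 ≠ 0 := m.posDef.inv.diag_pos.ne'
  rw [trace_lambdaAdj_mul m.posDef, mul_assoc, hT]
  field_simp

theorem target_dim_ne_zero (m : BoundaryModel z₀ w₀ G H U K K' D) (hd : 1 ≤ d)
    (hT : K'⁻¹ 0 0 * tangentialEnergy K K' D = d * K⁻¹ 0 0) : e ≠ 0 := by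
  rintro rfl
  have h : lambdaMat D = 0 := Subsingleton.elim _ _
  rw [tangentialEnergy, h, Matrix.mul_zero, Matrix.trace_zero, mul_zero] at hT
  have h1 : (0 : ℝ) < d * K⁻¹ 0 0 := mul_pos (by exact_mod_cast hd) m.posDef.inv.diag_pos
  exact h1.ne hT

/-- A rank one perturbation of a multiple of the identity of size at least two is singular exactly
when one of its two eigenvalues vanishes. -/
theorem not_isUnit_smul_one_add_iff (he : e ≠ 0) {κ : ℂ} (hκ : κ ≠ 0) (α γ : ℂ)
    {ν : Fin (e + 1) → ℂ} (hν : ν 0 = 1) :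
    ¬ IsUnit (Matrix.of fun a b => κ * ((if a = b then α else 0) + if 0 = b then γ * ν a else 0) :
      Matrix (Fin (e + 1)) (Fin (e + 1)) ℂ) ↔ α = 0 ∨ α + γ = 0 := by
  set M : Matrix (Fin (e + 1)) (Fin (e + 1)) ℂ :=
    Matrix.of fun a b => κ * ((if a = b then α else 0) + if 0 = b then γ * ν a else 0) with hM
  have hmul : ∀ v a, (M *ᵥ v) a = κ * (α * v a + γ * ν a * v 0) := by
    intro v a
    simp only [hM, Matrix.mulVec, dotProduct, Matrix.of_apply]
    have : ∀ b, κ * ((if a = b then α else 0) + if 0 = b then γ * ν a else 0) * v b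
        = κ * (if a = b then α * v b else 0) + κ * (if 0 = b then γ * ν a * v b else 0) :=
      fun b => by split_ifs <;> ring
    simp only [this, Finset.sum_add_distrib, ← Finset.mul_sum, Finset.sum_ite_eq, Finset.mem_univ,
      if_true]
    ring
  rw [Matrix.isUnit_iff_isUnit_det, isUnit_iff_ne_zero, not_not, ← Matrix.exists_mulVec_eq_zero_iff]
  constructor
  · rintro ⟨v, hv, h0⟩
    have h1 : ∀ a, α * v a + γ * ν a * v 0 = 0 := fun a => by
      have h2 := hmul v a
      rw [h0, Pi.zero_apply] at h2
      exact (mul_eq_zero.1 h2.symm).resolve_left hκ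
    by_cases hv0 : v 0 = 0
    · obtain ⟨a, ha⟩ := Function.ne_iff.1 hv
      have h2 := h1 a
      rw [hv0, mul_zero, add_zero] at h2
      exact Or.inl ((mul_eq_zero.1 h2).resolve_right ha)
    · have h2 := h1 0
      rw [hν, mul_one, ← add_mul] at h2
      exact Or.inr ((mul_eq_zero.1 h2).resolve_right hv0)
  · rintro (h | h)
    · obtain ⟨j, hj⟩ : ∃ j : Fin (e + 1), j ≠ 0 :=
        ⟨Fin.last e, fun h => he (by simpa using congrArg Fin.val h)⟩
      refine ⟨Pi.single j 1, by simp, funext fun a => ?_⟩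
      rw [hmul, h, Pi.single_eq_of_ne hj.symm]
      simp
    · refine ⟨ν, fun h0 => ?_, funext fun a => ?_⟩
      · rw [h0] at hν
        simp at hν
      · rw [hmul, hν, Pi.zero_apply]
        linear_combination κ * ν a * h

theorem indicialEval_eq (m : BoundaryModel z₀ w₀ G H U K K' D)
    (hw : ∀ a, imageNormal K D a = K⁻¹ 0 0 / K'⁻¹ 0 0 * K'⁻¹ a 0)
    (hT : K'⁻¹ 0 0 * tangentialEnergy K K' D = d * K⁻¹ 0 0) (ζ : ℂ) :
    indicialEval
      ![Matrix.of fun a b => jacobiLim K K' D (fun c => if c = b then 1 else 0) a,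
        Matrix.of fun a b => (if a = b then d * K⁻¹ 0 0 else 0)
          - 2 * (normalPairing K K' D (fun c => if c = b then 1 else 0) * K'⁻¹ a 0
            - (if 0 = b then imageNormal K D a else 0)),
        Matrix.of fun a b => -(if a = b then K⁻¹ 0 0 else 0)] ζ
      = Matrix.of fun a b => ((K⁻¹ 0 0 : ℝ) : ℂ) *
        ((if a = b then -ζ ^ 2 + d * ζ + (d + 1) else 0)
          + if 0 = b then (d - 1) * ((K'⁻¹ a 0 / K'⁻¹ 0 0 : ℝ) : ℂ) else 0) := by
  have hk' : K'⁻¹ 0 0 ≠ 0 := m.posDef'.inv.diag_pos.ne'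
  have h0 : ∀ a b, jacobiLim K K' D (fun c => if c = b then 1 else 0) a
      = K⁻¹ 0 0 * ((if a = b then (d + 1 : ℝ) else 0)
        + if 0 = b then (d - 1) * (K'⁻¹ a 0 / K'⁻¹ 0 0) else 0) := by
    intro a b
    rw [jacobiLim, m.normalPairing_eq_of_imageNormal hw, m.energy_eq_of_imageNormal hw hT, hw a]
    split_ifs <;> field_simp <;> ring
  have h1 : ∀ a b, ((if a = b then d * K⁻¹ 0 0 else 0)
          - 2 * (normalPairing K K' D (fun c => if c = b then 1 else 0) * K'⁻¹ a 0
            - (if 0 = b then imageNormal K D a else 0))) = if a = b then d * K⁻¹ 0 0 else 0 := by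
    intro a b
    rw [m.normalPairing_eq_of_imageNormal hw, hw a]
    split_ifs <;> ring
  ext a b
  simp only [indicialEval, Fin.sum_univ_three, Matrix.add_apply, Matrix.smul_apply,
    Matrix.map_apply, Matrix.cons_val_zero, Matrix.cons_val_one, Matrix.cons_val_two,
    Matrix.of_apply, h0, h1, smul_eq_mul, Matrix.head_cons, Matrix.tail_cons]
  simp only [Fin.val_zero, Fin.val_one, Fin.val_two]
  split_ifs <;> push_cast <;> ring

theorem setOf_indicial_roots (d : ℕ) :
    {ζ : ℂ | -ζ ^ 2 + d * ζ + (d + 1) = 0 ∨ -ζ ^ 2 + d * ζ + (d + 1) + ((d : ℂ) - 1) = 0}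
      = {(((((d : ℝ) + Real.sqrt ((d : ℝ) ^ 2 + 8 * d)) / 2 : ℝ)) : ℂ),
            (((((d : ℝ) - Real.sqrt ((d : ℝ) ^ 2 + 8 * d)) / 2 : ℝ)) : ℂ),
            (-1 : ℂ), ((d : ℂ) + 1)} := by
  have hr : ((Real.sqrt ((d : ℝ) ^ 2 + 8 * d) : ℝ) : ℂ) ^ 2 = (d : ℂ) ^ 2 + 8 * d := by
    have := Real.sq_sqrt (by positivity : (0 : ℝ) ≤ (d : ℝ) ^ 2 + 8 * d)
    exact_mod_cast congrArg (fun x : ℝ => (x : ℂ)) this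
  set r := Real.sqrt ((d : ℝ) ^ 2 + 8 * d)
  have h1 : ∀ ζ : ℂ, -ζ ^ 2 + d * ζ + (d + 1) = -((ζ - (-1)) * (ζ - (d + 1))) := fun ζ => by ring
  have h2 : ∀ ζ : ℂ, -ζ ^ 2 + d * ζ + (d + 1) + ((d : ℂ) - 1)
      = -((ζ - ((((d : ℝ) + r) / 2 : ℝ) : ℂ)) * (ζ - ((((d : ℝ) - r) / 2 : ℝ) : ℂ))) := fun ζ => by
    push_cast
    linear_combination (-1 / 4 : ℂ) * hr
  ext ζ
  simp only [mem_ofPred_eq, mem_insert_iff, mem_singleton_iff]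
  rw [h2, h1, neg_eq_zero, neg_eq_zero, mul_eq_zero, mul_eq_zero, sub_eq_zero, sub_eq_zero,
    sub_eq_zero, sub_eq_zero]
  tauto

theorem hasIndicialRoots (m : BoundaryModel z₀ w₀ G H U K K' D) (hd : 1 ≤ d)
    (hw : ∀ a, imageNormal K D a = K⁻¹ 0 0 / K'⁻¹ 0 0 * K'⁻¹ a 0)
    (hT : K'⁻¹ 0 0 * tangentialEnergy K K' D = d * K⁻¹ 0 0) :
    HasIndicialRoots (zeroJacobi G H U) z₀
      {(((((d : ℝ) + Real.sqrt ((d : ℝ) ^ 2 + 8 * d)) / 2 : ℝ)) : ℂ),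
            (((((d : ℝ) - Real.sqrt ((d : ℝ) ^ 2 + 8 * d)) / 2 : ℝ)) : ℂ),
            (-1 : ℂ), ((d : ℂ) + 1)} := by
  have hk : ((K⁻¹ 0 0 : ℝ) : ℂ) ≠ 0 := Complex.ofReal_ne_zero.2 m.posDef.inv.diag_pos.ne'
  have hk' : K'⁻¹ 0 0 ≠ 0 := m.posDef'.inv.diag_pos.ne'
  refine ⟨_, m.hasIndicialPolynomial, ?_⟩
  rw [← setOf_indicial_roots]
  ext ζ
  rw [mem_ofPred_eq, mem_ofPred_eq, m.indicialEval_eq hw hT,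
    not_isUnit_smul_one_add_iff (m.target_dim_ne_zero hd hT) hk _ _ (by simp [hk'])]

end BoundaryModel

/-! ### Charts of manifolds with boundary -/

section Charts

variable {d e : ℕ} {M N : Type*} [TopologicalSpace M] [TopologicalSpace N]
  {φ φ' : OpenPartialHomeomorph M (EuclideanHalfSpace (d + 1))}
  {ψ : OpenPartialHomeomorph N (EuclideanHalfSpace (e + 1))} {p : M} {u : M → N}

theorem toCoord_nonneg (φ : OpenPartialHomeomorph M (EuclideanHalfSpace (d + 1))) (p : M) :
    0 ≤ toCoord φ p 0 := (φ p).2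

theorem ofCoord_toCoord (hp : p ∈ φ.source) : ofCoord φ (toCoord φ p) = p :=
  φ.extend_left_inv hp

theorem toCoord_mem_coordTarget (hp : p ∈ φ.source) : toCoord φ p ∈ coordTarget φ :=
  (φ.extend (𝓡∂ (d + 1))).map_source (by rwa [φ.extend_source])

theorem toCoord_ofCoord {z : Coord d} (hz : z ∈ coordTarget φ) : toCoord φ (ofCoord φ z) = z :=
  (φ.extend (𝓡∂ (d + 1))).right_inv hz

theorem ofCoord_mem_source {z : Coord d} (hz : z ∈ coordTarget φ) : ofCoord φ z ∈ φ.source := by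
  have := (φ.extend (𝓡∂ (d + 1))).map_target hz
  rwa [φ.extend_source] at this

theorem continuousAt_toCoord (hp : p ∈ φ.source) : ContinuousAt (toCoord φ) p :=
  φ.continuousAt_extend hp

theorem continuousAt_ofCoord {z : Coord d} (hz : z ∈ coordTarget φ) :
    ContinuousAt (ofCoord φ) z :=
  φ.continuousAt_extend_symm' hz

/-- An open subset of `ℝ ^ (d + 1)` whose intersection with the half-space is the domain of the
coordinate expression of `u`. -/
def chartDomain (u : M → N) (φ : OpenPartialHomeomorph M (EuclideanHalfSpace (d + 1)))
    (ψ : OpenPartialHomeomorph N (EuclideanHalfSpace (e + 1))) : Set (Coord d) :=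
  (𝓡∂ (d + 1)).symm ⁻¹' (φ.target ∩ φ.symm ⁻¹' (u ⁻¹' ψ.source))

theorem isOpen_chartDomain (hu : Continuous u) : IsOpen (chartDomain u φ ψ) :=
  (φ.isOpen_inter_preimage_symm (ψ.open_source.preimage hu)).preimage
    (𝓡∂ (d + 1)).continuous_symm

theorem mem_coordTarget_of_mem_chartDomain {z : Coord d} (hz : z ∈ chartDomain u φ ψ)
    (h0 : 0 ≤ z 0) : z ∈ coordTarget φ ∧ u (ofCoord φ z) ∈ ψ.source := by
  refine ⟨?_, hz.2⟩
  rw [coordTarget, φ.extend_target, range_modelWithCornersEuclideanHalfSpace]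
  exact ⟨hz.1, h0⟩

theorem toCoord_mem_chartDomain (hp : p ∈ φ.source) (hup : u p ∈ ψ.source) :
    toCoord φ p ∈ chartDomain u φ ψ := by
  have h1 : (𝓡∂ (d + 1)).symm (toCoord φ p) = φ p := (𝓡∂ (d + 1)).left_inv (φ p)
  rw [chartDomain, mem_preimage, h1]
  refine ⟨φ.map_source hp, ?_⟩
  rw [mem_preimage, mem_preimage, φ.left_inv hp]
  exact hup

theorem continuousAt_chartMap (hu : Continuous u) {z : Coord d} (hz : z ∈ chartDomain u φ ψ)
    (h0 : 0 ≤ z 0) : ContinuousAt (chartMap u φ ψ) z := by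
  obtain ⟨h1, h2⟩ := mem_coordTarget_of_mem_chartDomain hz h0
  have h3 : ContinuousAt (fun w => u (ofCoord φ w)) z :=
    hu.continuousAt.comp (continuousAt_ofCoord h1)
  exact ContinuousAt.comp (g := toCoord ψ) (continuousAt_toCoord h2) h3

variable [ChartedSpace (EuclideanHalfSpace (d + 1)) M]

/-- Smooth charts agree on which points have positive first coordinate, because the differential of
a coordinate change is surjective. -/
theorem toCoord_pos_of_toCoord_pos (hφ : φ ∈ smoothCharts d M)
    (hφ' : φ' ∈ smoothCharts d M) (hp : p ∈ φ.source) (hp' : p ∈ φ'.source)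
    (h : 0 < toCoord φ p 0) : 0 < toCoord φ' p 0 := by
  have hint : interior (range (𝓡∂ (d + 1))) = {y | 0 < y 0} :=
    interior_range_modelWithCornersEuclideanHalfSpace (d + 1)
  have hn : (∞ : WithTop ℕ∞) ≠ 0 := by simp
  let χ := (𝓡∂ (d + 1)).extendCoordChange φ φ'
  have hχ : ContDiffOn ℝ ∞ χ χ.source :=
    ModelWithCorners.contDiffOn_extendCoordChange hφ hφ'
  have hx : φ.extend (𝓡∂ (d + 1)) p ∈ interior (φ.extend (𝓡∂ (d + 1))).target := by
    refine φ.mem_interior_extend_target (φ.map_source hp) ?_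
    rw [hint]
    exact h
  have hsrc : χ.source ∈ 𝓝 (φ.extend (𝓡∂ (d + 1)) p) := by
    simp_rw [χ, ModelWithCorners.extendCoordChange, PartialEquiv.trans_source,
      PartialEquiv.symm_source, Filter.inter_mem_iff, mem_interior_iff_mem_nhds.1 hx, true_and,
      φ'.extend_source]
    exact φ.extend_preimage_mem_nhds hp <| φ'.open_source.mem_nhds hp'
  have hsurj : Function.Surjective (fderivWithin ℝ χ χ.source (φ.extend (𝓡∂ (d + 1)) p)) :=
    (ModelWithCorners.isInvertible_fderivWithin_extendCoordChange hn hφ hφ'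
      (mem_of_mem_nhds hsrc)).surjective
  rw [fderivWithin_of_mem_nhds hsrc] at hsurj
  have hmem : φ'.extend (𝓡∂ (d + 1)) p ∈ interior (range (𝓡∂ (d + 1))) := by
    rw [show φ'.extend (𝓡∂ (d + 1)) p = χ (φ.extend (𝓡∂ (d + 1)) p) by
      change _ = φ'.extend (𝓡∂ (d + 1)) ((φ.extend (𝓡∂ (d + 1))).symm (φ.extend (𝓡∂ (d + 1)) p))
      rw [φ.extend_left_inv hp]]
    exact ((hχ.differentiableOn hn).differentiableAt hsrc).mem_interior_convex_of_surjective_fderiv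
      hsrc (𝓡∂ (d + 1)).convex_range (𝓡∂ (d + 1)).isClosed_range (𝓡∂ (d + 1)).nonempty_interior
      (χ.mapsTo.mono_right <| by simp [χ, inter_assoc]) hsurj
  rw [hint] at hmem
  exact hmem

variable [IsManifold (𝓡∂ (d + 1)) ∞ M]

theorem mem_interior_iff_toCoord_pos (hφ : φ ∈ smoothCharts d M)
    (hp : p ∈ φ.source) : p ∈ (𝓡∂ (d + 1)).interior M ↔ 0 < toCoord φ p 0 := by
  have h1 : p ∈ (𝓡∂ (d + 1)).interior M ↔
      0 < toCoord (chartAt (EuclideanHalfSpace (d + 1)) p) p 0 := by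
    have hint : interior (range (𝓡∂ (d + 1))) = {y | 0 < y 0} :=
      interior_range_modelWithCornersEuclideanHalfSpace (d + 1)
    change extChartAt (𝓡∂ (d + 1)) p p ∈ interior (range (𝓡∂ (d + 1))) ↔ _
    rw [hint]
    rfl
  rw [h1]
  have hc : chartAt (EuclideanHalfSpace (d + 1)) p ∈ smoothCharts d M :=
    IsManifold.chart_mem_maximalAtlas p
  have hpc := mem_chart_source (EuclideanHalfSpace (d + 1)) p
  exact ⟨toCoord_pos_of_toCoord_pos hc hφ hpc hp, toCoord_pos_of_toCoord_pos hφ hc hp hpc⟩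

theorem mem_boundary_iff_toCoord_eq_zero
    (hφ : φ ∈ smoothCharts d M) (hp : p ∈ φ.source) :
    p ∈ (𝓡∂ (d + 1)).boundary M ↔ toCoord φ p 0 = 0 := by
  rw [← (𝓡∂ (d + 1)).compl_interior, mem_compl_iff, mem_interior_iff_toCoord_pos hφ hp, not_lt]
  exact ⟨fun h => le_antisymm h (toCoord_nonneg φ p), fun h => h.le⟩

theorem ofCoord_mem_boundary (hφ : φ ∈ smoothCharts d M) {z : Coord d} (h1 : z ∈ coordTarget φ)
    (h0 : z 0 = 0) : ofCoord φ z ∈ (𝓡∂ (d + 1)).boundary M := by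
  rwa [mem_boundary_iff_toCoord_eq_zero hφ (ofCoord_mem_source h1), toCoord_ofCoord h1]

variable [ChartedSpace (EuclideanHalfSpace (e + 1)) N]

theorem differentiableAt_chartMap (hu : IsSimpleBMap (d := d) (e := e) u)
    (hφ : φ ∈ smoothCharts d M) (hψ : ψ ∈ smoothCharts e N) {z : Coord d}
    (hz : z ∈ chartDomain u φ ψ) (h0 : 0 < z 0) : DifferentiableAt ℝ (chartMap u φ ψ) z := by
  obtain ⟨h1, h2⟩ := mem_coordTarget_of_mem_chartDomain hz h0.le
  have hp := ofCoord_mem_source h1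
  have hint : ofCoord φ z ∈ (𝓡∂ (d + 1)).interior M := by
    rwa [mem_interior_iff_toCoord_pos hφ hp, toCoord_ofCoord h1]
  have hn : (∞ : WithTop ℕ∞) ≠ 0 := by simp
  have h3 := hu.smooth_interior.contMDiffAt
    (((𝓡∂ (d + 1)).isOpen_interior (M := M) hn).mem_nhds hint)
  have h4 := ((contMDiffAt_iff_of_mem_maximalAtlas hφ hψ hp h2).1 h3).2
  have h5 : φ.extend (𝓡∂ (d + 1)) (ofCoord φ z) = z := toCoord_ofCoord h1
  rw [h5] at h4
  have h6 : range (𝓡∂ (d + 1)) ∈ 𝓝 z := by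
    rw [range_modelWithCornersEuclideanHalfSpace]
    exact mem_of_superset ((isOpen_posHalf d).mem_nhds (mem_posHalf.2 h0)) posHalf_subset
  exact (h4.contDiffAt h6).differentiableAt hn

variable [IsManifold (𝓡∂ (e + 1)) ∞ N]

theorem chartMap_pos (hu : IsSimpleBMap (d := d) (e := e) u) (hφ : φ ∈ smoothCharts d M)
    (hψ : ψ ∈ smoothCharts e N) {z : Coord d} (hz : z ∈ chartDomain u φ ψ) (h0 : 0 < z 0) :
    0 < chartMap u φ ψ z 0 := by
  obtain ⟨h1, h2⟩ := mem_coordTarget_of_mem_chartDomain hz h0.le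
  refine (mem_interior_iff_toCoord_pos hψ h2).1 (hu.maps_interior ?_)
  rwa [mem_interior_iff_toCoord_pos hφ (ofCoord_mem_source h1), toCoord_ofCoord h1]

theorem chartMap_eq_zero (hu : IsSimpleBMap (d := d) (e := e) u) (hφ : φ ∈ smoothCharts d M)
    (hψ : ψ ∈ smoothCharts e N) {z : Coord d} (hz : z ∈ chartDomain u φ ψ) (h0 : z 0 = 0) :
    chartMap u φ ψ z 0 = 0 := by
  obtain ⟨h1, h2⟩ := mem_coordTarget_of_mem_chartDomain hz h0.ge
  exact (mem_boundary_iff_toCoord_eq_zero hψ h2).1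
    (hu.maps_boundary (ofCoord_mem_boundary hφ h1 h0))

end Charts

/-! ### The boundary model of a simple `b`-map -/

section Model

theorem bdryValue_eq {d : ℕ} {ι κ : Type*} {F : Coord d → Matrix ι κ ℝ} {C : Matrix ι κ ℝ}
    {z₀ : Coord d} (h : ZRegMat z₀ F C) (h0 : 0 ≤ z₀ 0) : bdryValue F z₀ = C := by
  have := nhdsWithin_posHalf_neBot h0
  ext i j
  exact (h i j).tendsto.limUnder_eq

/-- A function with a limit at a boundary point has nearby limits at the neighbouring boundary
points, if it has limits there at all. -/
theorem eventually_abs_sub_le_of_tendsto {d : ℕ} {z₀ : Coord d} {f : Coord d → ℝ} {c ε : ℝ}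
    (h : Tendsto f (𝓝[posHalf d] z₀) (𝓝 c)) (hε : 0 < ε) :
    ∀ᶠ z in 𝓝 z₀, z 0 = 0 → ∀ c', Tendsto f (𝓝[posHalf d] z) (𝓝 c') → |c' - c| ≤ ε := by
  have h1 := eventually_nhdsWithin_iff.1 (Metric.tendsto_nhds.1 h ε hε)
  filter_upwards [eventually_eventually_nhds.2 h1] with z hz hz0 c' hc'
  have := nhdsWithin_posHalf_neBot hz0.ge
  refine le_of_tendsto (hc'.sub_const c).abs ?_
  filter_upwards [eventually_nhdsWithin_iff.2 hz] with w hw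
  exact hw.le

variable {d e : ℕ} {M N : Type*} [TopologicalSpace M] [TopologicalSpace N]
  {φ : OpenPartialHomeomorph M (EuclideanHalfSpace (d + 1))}
  {ψ : OpenPartialHomeomorph N (EuclideanHalfSpace (e + 1))} {u : M → N} {z₀ : Coord d}

theorem continuousOn_chartMap (hu : Continuous u) (a : Fin (e + 1)) :
    ContinuousOn (fun z => chartMap u φ ψ z a) (chartDomain u φ ψ ∩ {z | 0 ≤ z 0}) :=
  fun _ hz => ((EuclideanSpace.proj (𝕜 := ℝ) a).continuous.continuousAt.comp
    (continuousAt_chartMap hu hz.1 hz.2)).continuousWithinAt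

variable [ChartedSpace (EuclideanHalfSpace (d + 1)) M] [ChartedSpace (EuclideanHalfSpace (e + 1)) N]
  {g : ∀ p : M, LinearMap.BilinForm ℝ (TangentSpace (𝓡∂ (d + 1)) p)}
  {h : ∀ q : N, LinearMap.BilinForm ℝ (TangentSpace (𝓡∂ (e + 1)) q)}

theorem eventually_jacobi_tension_eq_zero (hbi : IsBiharmonic g h u) (hu : Continuous u)
    (hφ : φ ∈ smoothCharts d M) (hψ : ψ ∈ smoothCharts e N) (hz : z₀ ∈ chartDomain u φ ψ) :
    ∀ᶠ z in 𝓝[posHalf d] z₀, ∀ a, jacobi (chartMetric g φ) (chartMetric h ψ) (chartMap u φ ψ)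
      (tension (chartMetric g φ) (chartMetric h ψ) (chartMap u φ ψ)) z a = 0 := by
  filter_upwards [eventually_nhdsWithin_of_eventually_nhds
    ((isOpen_chartDomain hu).eventually_mem hz), eventually_mem_posHalf] with z h1 h2
  obtain ⟨h3, h4⟩ := mem_coordTarget_of_mem_chartDomain h1 (mem_posHalf.1 h2).le
  exact hbi φ hφ ψ hψ z ⟨h3, h2⟩ h4

variable [IsManifold (𝓡∂ (d + 1)) ∞ M]

theorem differentiableOn_chartMap (hu : IsSimpleBMap (d := d) (e := e) u)
    (hφ : φ ∈ smoothCharts d M) (hψ : ψ ∈ smoothCharts e N) (a : Fin (e + 1)) :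
    DifferentiableOn ℝ (fun z => chartMap u φ ψ z a) (chartDomain u φ ψ ∩ posHalf d) :=
  fun _ hz => ((differentiableAt_coord a _).comp _
    (differentiableAt_chartMap hu hφ hψ hz.1 hz.2)).differentiableWithinAt

variable [IsManifold (𝓡∂ (e + 1)) ∞ N]

/-- A simple `b`-map between conformally compact manifolds has a boundary model at each boundary
point. The matrix of `⁰du` is the matrix of first derivatives divided by `γ = ∂_x u⁰`, the limit of
`u⁰ / x`. -/
theorem exists_boundaryModel (hg : IsConformallyCompact g) (hh : IsConformallyCompact h)
    (hu : IsSimpleBMap (d := d) (e := e) u) (hφ : φ ∈ smoothCharts d M)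
    (hψ : ψ ∈ smoothCharts e N) (hz : z₀ ∈ chartDomain u φ ψ) (h0 : z₀ 0 = 0) :
    BoundaryModel z₀ (chartMap u φ ψ z₀) (chartMetric g φ) (chartMetric h ψ) (chartMap u φ ψ)
      (bdryValue (zeroMetric (chartMetric g φ)) z₀)
      (bdryValue (zeroMetric (chartMetric h ψ)) (chartMap u φ ψ z₀))
      (bdryValue (zeroDiff (chartMap u φ ψ)) z₀) ∧
    ∃ (c : Fin (e + 1) → Fin (d + 1) → ℝ) (γ : ℝ), 0 < γ ∧ (∀ j ≠ 0, c 0 j = 0) ∧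
      (∀ a j, Tendsto (pd j fun z => chartMap u φ ψ z a) (𝓝[posHalf d] z₀) (𝓝 (c a j))) ∧
      ∀ a j, bdryValue (zeroDiff (chartMap u φ ψ)) z₀ a j = γ⁻¹ * c a j := by
  obtain ⟨hzt, huz⟩ := mem_coordTarget_of_mem_chartDomain hz h0.ge
  have hV : IsOpen (chartDomain u φ ψ) := isOpen_chartDomain hu.continuous
  have hw0 : chartMap u φ ψ z₀ 0 = 0 := chartMap_eq_zero hu hφ hψ hz h0
  have hwt : chartMap u φ ψ z₀ ∈ coordTarget ψ := toCoord_mem_coordTarget huz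
  have hne := nhdsWithin_posHalf_neBot h0.ge
  choose K hK using fun i j => (hg.phg φ hφ z₀ hzt h0 i j).exists_zReg h0
  choose K' hK' using fun i j => (hh.phg ψ hψ _ hwt hw0 i j).exists_zReg hw0
  choose c hc using fun a j => (hu.phg_diff φ hφ ψ hψ z₀ hzt h0 huz a j).exists_zReg h0
  obtain ⟨γ, hγ, hγt⟩ := hu.transversal φ hφ ψ hψ z₀ hzt h0 huz
  have hγc : c 0 0 = γ := tendsto_nhds_unique (hc 0 0).tendsto hγt
  have hcont := continuousOn_chartMap (φ := φ) (ψ := ψ) hu.continuous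
  have hdiff := differentiableOn_chartMap hu hφ hψ
  have hb : ∀ z ∈ chartDomain u φ ψ, z 0 = 0 → chartMap u φ ψ z 0 = 0 :=
    fun z => chartMap_eq_zero hu hφ hψ
  have hrat := ZReg.div_coord hV hz h0 (hcont 0) (hdiff 0) hb (hc 0)
  have hc0 : ∀ j ≠ 0, c 0 j = 0 := fun j hj =>
    tangential_limit_eq_zero hV hz h0 (hcont 0) (hdiff 0) (fun j => (hc 0 j).tendsto)
      ((hV.eventually_mem hz).mono fun w hw hw0' => by rw [hb w hw hw0', hw0]) hj
  rw [hγc] at hrat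
  have hD : ZRegMat z₀ (zeroDiff (chartMap u φ ψ)) (Matrix.of fun a j => γ⁻¹ * c a j) := by
    intro a j
    refine ((hrat.inv hγ.ne').mul (hc a j)).congr (Eventually.of_forall fun z => ?_)
    simp [zeroDiff]
  have hDv := bdryValue_eq hD h0.ge
  have hKv : bdryValue (zeroMetric (chartMetric g φ)) z₀ = Matrix.of K := bdryValue_eq hK h0.ge
  have hKv' : bdryValue (zeroMetric (chartMetric h ψ)) (chartMap u φ ψ z₀) = Matrix.of K' :=
    bdryValue_eq hK' hw0.ge
  have hev : ∀ᶠ z in 𝓝[posHalf d] z₀, z ∈ chartDomain u φ ψ ∧ z ∈ posHalf d :=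
    (eventually_nhdsWithin_of_eventually_nhds (hV.eventually_mem hz)).and eventually_mem_posHalf
  refine ⟨⟨h0, ?_, ?_, hg.bdry_posDef φ hφ z₀ hzt h0, hh.bdry_posDef ψ hψ _ hwt hw0,
    ?_, ?_, ?_, ?_⟩, c, γ, hγ, hc0, fun a j => (hc a j).tendsto, fun a j => by rw [hDv]; rfl⟩
  · rw [hKv]; exact hK
  · rw [hKv']; exact hK'
  · refine tendsto_nhdsWithin_iff.2 ⟨?_, hev.mono fun z hz => chartMap_pos hu hφ hψ hz.1 hz.2⟩
    exact (continuousAt_chartMap hu.continuous hz h0.ge).tendsto.mono_left nhdsWithin_le_nhds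
  · exact hev.mono fun z hz => differentiableAt_chartMap hu hφ hψ hz.1 hz.2
  · rw [hDv]; exact hD
  · intro j
    rw [hDv, Matrix.of_apply]
    split_ifs with hj
    · rw [hj, hγc, inv_mul_cancel₀ hγ.ne']
    · rw [hc0 j hj, mul_zero]

end Model

/-! ### The alternative at the boundary is locally constant -/

namespace BoundaryModel

variable {d e : ℕ} {z₀ : Coord d} {w₀ : Coord e}
  {G : Coord d → Matrix (Fin (d + 1)) (Fin (d + 1)) ℝ}
  {H : Coord e → Matrix (Fin (e + 1)) (Fin (e + 1)) ℝ} {U : Coord d → Coord e}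
  {K : Matrix (Fin (d + 1)) (Fin (d + 1)) ℝ} {K' : Matrix (Fin (e + 1)) (Fin (e + 1)) ℝ}
  {D : Matrix (Fin (e + 1)) (Fin (d + 1)) ℝ}

/-- The energy density with respect to the normalized metrics, as a function of the interior, has a
limit at the boundary. -/
theorem tendsto_energy (m : BoundaryModel z₀ w₀ G H U K K' D) :
    Tendsto (fun z => (zeroMetric H (U z))⁻¹ 0 0
        * energy (zeroMetric G z) (zeroMetric H (U z)) (SimpleBMap.zeroDiff U z)
        / (zeroMetric G z)⁻¹ 0 0)
      (𝓝[posHalf d] z₀) (𝓝 (K'⁻¹ 0 0 * energy K K' D / K⁻¹ 0 0)) := by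
  have hK := fun i j => (m.metric.inv m.det_ne i j).tendsto
  have hK' := ((m.metric'.inv m.det_ne' 0 0).tendsto).comp m.tendsto
  have hH := fun b c => (m.metric' b c).tendsto.comp m.tendsto
  have hD := fun a j => (m.zeroDiff a j).tendsto
  have hE : Tendsto
      (fun z => energy (zeroMetric G z) (zeroMetric H (U z)) (SimpleBMap.zeroDiff U z))
      (𝓝[posHalf d] z₀) (𝓝 (energy K K' D)) := by
    simp only [energy, pairing]
    exact tendsto_finsetSum _ fun i _ => tendsto_finsetSum _ fun j _ => (hK i j).mul <|
      tendsto_finsetSum _ fun c _ => (tendsto_finsetSum _ fun b _ =>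
        (hH b c).mul (hD b i)).mul (hD c j)
  exact (hK'.mul hE).div (hK 0 0) m.posDef.inv.diag_pos.ne'

/-- By the dichotomy the limit of the normalized energy density takes only the values `1` and
`d + 1`. -/
theorem normalized_energy_eq (m : BoundaryModel z₀ w₀ G H U K K' D) (hd : 1 ≤ d)
    (h : ∀ a, jacobiLim K K' D (tensionLim K K' D) a = 0) :
    (tangentialEnergy K K' D = 0 ∧ K'⁻¹ 0 0 * energy K K' D / K⁻¹ 0 0 = 1) ∨
      (tangentialEnergy K K' D ≠ 0 ∧ K'⁻¹ 0 0 * energy K K' D / K⁻¹ 0 0 = d + 1) := by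
  have hk : 0 < K⁻¹ 0 0 := m.posDef.inv.diag_pos
  have hk' : 0 < K'⁻¹ 0 0 := m.posDef'.inv.diag_pos
  obtain ⟨hw, hT⟩ := m.dichotomy hd h
  rcases hT with hT | hT
  · refine Or.inl ⟨hT, ?_⟩
    rw [energy_eq m.posDef (isSymm_of_posDef m.posDef') m.row_zero, ← normalPairing_eq,
      m.normalPairing_eq_of_imageNormal hw, m.imageNormal_zero, hT]
    field_simp
    ring
  · refine Or.inr ⟨fun h0 => ?_, ?_⟩
    · rw [h0, mul_zero] at hT
      exact (mul_pos (by exact_mod_cast hd : (0 : ℝ) < d) hk).ne hT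
    · rw [m.energy_eq_of_imageNormal hw hT]
      field_simp

end BoundaryModel

section Alternative

variable {d e : ℕ} {M N : Type*} [TopologicalSpace M] [TopologicalSpace N]
  {φ : OpenPartialHomeomorph M (EuclideanHalfSpace (d + 1))}
  {ψ : OpenPartialHomeomorph N (EuclideanHalfSpace (e + 1))} {u : M → N} {z₀ : Coord d} {p : M}
  [ChartedSpace (EuclideanHalfSpace (d + 1)) M]

/-- `u` is constant on the boundary near `p`. -/
def IsLocallyConstAt (d : ℕ) {M N : Type*} [TopologicalSpace M]
    [ChartedSpace (EuclideanHalfSpace (d + 1)) M] (u : M → N) (p : M) : Prop :=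
  ∀ᶠ q in 𝓝[(𝓡∂ (d + 1)).boundary M] p, u q = u p

variable [IsManifold (𝓡∂ (d + 1)) ∞ M]

theorem isLocallyConstAt_iff (hu : Continuous u) (hφ : φ ∈ smoothCharts d M) (hp : p ∈ φ.source)
    (hup : u p ∈ ψ.source) : IsLocallyConstAt d u p ↔
      ∀ᶠ z in 𝓝 (toCoord φ p), z 0 = 0 → chartMap u φ ψ z = chartMap u φ ψ (toCoord φ p) := by
  have hz := toCoord_mem_chartDomain (φ := φ) (ψ := ψ) hp hup
  have h1 : chartMap u φ ψ (toCoord φ p) = toCoord ψ (u p) := by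
    rw [chartMap, ofCoord_toCoord hp]
  rw [IsLocallyConstAt, eventually_nhdsWithin_iff, h1]
  constructor
  · intro hc
    have h2 := continuousAt_ofCoord (toCoord_mem_coordTarget hp)
    rw [ContinuousAt, ofCoord_toCoord hp] at h2
    filter_upwards [h2.eventually hc, (isOpen_chartDomain hu).eventually_mem hz] with z h3 h4 h5
    rw [chartMap, h3 (ofCoord_mem_boundary hφ (mem_coordTarget_of_mem_chartDomain h4 h5.ge).1 h5)]
  · intro hc
    filter_upwards [(continuousAt_toCoord hp).eventually hc, φ.open_source.eventually_mem hp,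
      hu.continuousAt.eventually (ψ.open_source.eventually_mem hup)] with q h3 h4 h5 h6
    have h7 := h3 ((mem_boundary_iff_toCoord_eq_zero hφ h4).1 h6)
    rw [chartMap, ofCoord_toCoord h4] at h7
    rw [← ofCoord_toCoord h5, h7, ofCoord_toCoord hup]

variable [ChartedSpace (EuclideanHalfSpace (e + 1)) N] [IsManifold (𝓡∂ (e + 1)) ∞ N]
  {g : ∀ p : M, LinearMap.BilinForm ℝ (TangentSpace (𝓡∂ (d + 1)) p)}
  {h : ∀ q : N, LinearMap.BilinForm ℝ (TangentSpace (𝓡∂ (e + 1)) q)}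

/-- The tangential energy density of `u` at the boundary point with coordinates `z`. -/
def tangentialEnergyAt (g : ∀ p : M, LinearMap.BilinForm ℝ (TangentSpace (𝓡∂ (d + 1)) p))
    (h : ∀ q : N, LinearMap.BilinForm ℝ (TangentSpace (𝓡∂ (e + 1)) q)) (u : M → N)
    (φ : OpenPartialHomeomorph M (EuclideanHalfSpace (d + 1)))
    (ψ : OpenPartialHomeomorph N (EuclideanHalfSpace (e + 1))) (z : Coord d) : ℝ :=
  tangentialEnergy (bdryValue (zeroMetric (chartMetric g φ)) z)
    (bdryValue (zeroMetric (chartMetric h ψ)) (chartMap u φ ψ z))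
    (bdryValue (zeroDiff (chartMap u φ ψ)) z)

/-- The first derivatives of `u` have limits at boundary points, and the tangential energy density
vanishes exactly where the limits of the tangential derivatives do. -/
theorem tangentialEnergyAt_eq_zero_iff (hg : IsConformallyCompact g) (hh : IsConformallyCompact h)
    (hu : IsSimpleBMap (d := d) (e := e) u) (hφ : φ ∈ smoothCharts d M)
    (hψ : ψ ∈ smoothCharts e N) (hz : z₀ ∈ chartDomain u φ ψ) (h0 : z₀ 0 = 0) :
    ∃ c : Fin (e + 1) → Fin (d + 1) → ℝ,
      (∀ a j, Tendsto (pd j fun z => chartMap u φ ψ z a) (𝓝[posHalf d] z₀) (𝓝 (c a j))) ∧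
      (tangentialEnergyAt g h u φ ψ z₀ = 0 ↔ ∀ a, ∀ j ≠ 0, c a j = 0) := by
  obtain ⟨m, c, γ, hγ, hc0, hc, hD⟩ := exists_boundaryModel hg hh hu hφ hψ hz h0
  refine ⟨c, hc, fun hT a j hj => ?_, fun hcz => ?_⟩
  · have hΛ := lambdaMat_eq_zero_of_tangentialEnergy m.posDef m.posDef' hT
    obtain ⟨j, rfl⟩ := Fin.exists_succ_eq.2 hj
    refine Fin.cases (hc0 _ hj) (fun a => ?_) a
    have h1 := congrFun (congrFun hΛ a) j
    rw [lambdaMat, Matrix.submatrix_apply, hD, Matrix.zero_apply] at h1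
    exact (mul_eq_zero.1 h1).resolve_left (inv_ne_zero hγ.ne')
  · have hΛ : lambdaMat (bdryValue (zeroDiff (chartMap u φ ψ)) z₀) = 0 := by
      ext a j
      rw [lambdaMat, Matrix.submatrix_apply, hD, hcz _ _ (Fin.succ_ne_zero j), mul_zero,
        Matrix.zero_apply]
    rw [tangentialEnergyAt, tangentialEnergy, hΛ, Matrix.mul_zero, Matrix.trace_zero]

/-- The limit of the normalized energy density takes only two values on the boundary, according to
whether the tangential energy vanishes, so this alternative is locally constant. -/
theorem eventually_tangentialEnergyAt_iff (hd : 1 ≤ d) (hg : IsConformallyCompact g)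
    (hh : IsConformallyCompact h) (hu : IsSimpleBMap (d := d) (e := e) u)
    (hbi : IsBiharmonic g h u) (hφ : φ ∈ smoothCharts d M) (hψ : ψ ∈ smoothCharts e N)
    (hz : z₀ ∈ chartDomain u φ ψ) (h0 : z₀ 0 = 0) :
    ∀ᶠ z in 𝓝 z₀, z 0 = 0 →
      (tangentialEnergyAt g h u φ ψ z = 0 ↔ tangentialEnergyAt g h u φ ψ z₀ = 0) := by
  have key : ∀ z ∈ chartDomain u φ ψ, z 0 = 0 → _ := fun z hz h0 =>
    let m := (exists_boundaryModel hg hh hu hφ hψ hz h0).1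
    And.intro m.tendsto_energy (m.normalized_energy_eq hd (m.jacobiLim_tensionLim
      (eventually_jacobi_tension_eq_zero hbi hu.continuous hφ hψ hz)))
  obtain ⟨h1, h2⟩ := key z₀ hz h0
  have hd' : (1 : ℝ) ≤ d := by exact_mod_cast hd
  filter_upwards [eventually_abs_sub_le_of_tendsto h1 (ε := 1 / 2) (by norm_num),
    (isOpen_chartDomain hu.continuous).eventually_mem hz] with z hz1 hz2 hz0
  obtain ⟨h3, h4⟩ := key z hz2 hz0
  have h5 := abs_le.1 (hz1 hz0 _ h3)
  rw [tangentialEnergyAt, tangentialEnergyAt]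
  rcases h2 with ⟨h2, h2'⟩ | ⟨h2, h2'⟩ <;> rcases h4 with ⟨h4, h4'⟩ | ⟨h4, h4'⟩
  · exact iff_of_true h4 h2
  · rw [h2', h4'] at h5; linarith
  · rw [h2', h4'] at h5; linarith
  · exact iff_of_false h4 h2

/-- The tangential energy vanishes exactly where `u` is locally constant on the boundary. -/
theorem isLocallyConstAt_iff_tangentialEnergyAt (hd : 1 ≤ d) (hg : IsConformallyCompact g)
    (hh : IsConformallyCompact h) (hu : IsSimpleBMap (d := d) (e := e) u)
    (hbi : IsBiharmonic g h u) (hφ : φ ∈ smoothCharts d M) (hψ : ψ ∈ smoothCharts e N)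
    (hp : p ∈ φ.source) (hup : u p ∈ ψ.source) (hpb : p ∈ (𝓡∂ (d + 1)).boundary M) :
    IsLocallyConstAt d u p ↔ tangentialEnergyAt g h u φ ψ (toCoord φ p) = 0 := by
  rw [isLocallyConstAt_iff hu.continuous hφ hp hup]
  have hz := toCoord_mem_chartDomain (φ := φ) (ψ := ψ) hp hup
  have h0 := (mem_boundary_iff_toCoord_eq_zero hφ hp).1 hpb
  have hV : IsOpen (chartDomain u φ ψ) := isOpen_chartDomain hu.continuous
  have hcont := continuousOn_chartMap (φ := φ) (ψ := ψ) hu.continuous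
  have hdiff := differentiableOn_chartMap hu hφ hψ
  constructor
  · intro hc
    obtain ⟨c, hct, hciff⟩ := tangentialEnergyAt_eq_zero_iff hg hh hu hφ hψ hz h0
    refine hciff.2 fun a j hj => tangential_limit_eq_zero hV hz h0 (hcont a) (hdiff a) (hct a)
      (hc.mono fun z h1 h2 => by rw [h1 h2]) hj
  · intro hT
    obtain ⟨r, hr, hrb⟩ := Metric.eventually_nhds_iff_ball.1
      ((hV.eventually_mem hz).and (eventually_tangentialEnergyAt_iff hd hg hh hu hbi hφ hψ hz h0))
    choose! c hct hciff using fun z (hz : z ∈ chartDomain u φ ψ ∧ z 0 = 0) =>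
      tangentialEnergyAt_eq_zero_iff hg hh hu hφ hψ hz.1 hz.2
    filter_upwards [Metric.ball_mem_nhds _ hr] with z hzr hz0
    ext a
    refine const_of_tangential_limit_eq_zero hV (fun w hw => (hrb w hw).1) h0 (hcont a) (hdiff a)
      (c := fun w => c w a) (fun w hw hw0 => hct w ⟨(hrb w hw).1, hw0⟩ a)
      (fun w hw hw0 => ?_) z hzr hz0
    exact (hciff w ⟨(hrb w hw).1, hw0⟩).1 (((hrb w hw).2 hw0).2 hT) a

theorem eventually_isLocallyConstAt_iff (hd : 1 ≤ d) (hg : IsConformallyCompact g)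
    (hh : IsConformallyCompact h) (hu : IsSimpleBMap (d := d) (e := e) u)
    (hbi : IsBiharmonic g h u) (hpb : p ∈ (𝓡∂ (d + 1)).boundary M) :
    ∀ᶠ q in 𝓝[(𝓡∂ (d + 1)).boundary M] p, (IsLocallyConstAt d u p ↔ IsLocallyConstAt d u q) := by
  have hφ : chartAt (EuclideanHalfSpace (d + 1)) p ∈ smoothCharts d M :=
    IsManifold.chart_mem_maximalAtlas p
  have hψ : chartAt (EuclideanHalfSpace (e + 1)) (u p) ∈ smoothCharts e N :=
    IsManifold.chart_mem_maximalAtlas (u p)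
  have hp := mem_chart_source (EuclideanHalfSpace (d + 1)) p
  have hup := mem_chart_source (EuclideanHalfSpace (e + 1)) (u p)
  rw [eventually_nhdsWithin_iff]
  have hT := eventually_tangentialEnergyAt_iff hd hg hh hu hbi hφ hψ
    (toCoord_mem_chartDomain hp hup) ((mem_boundary_iff_toCoord_eq_zero hφ hp).1 hpb)
  filter_upwards [(continuousAt_toCoord hp).eventually hT,
    (chartAt (EuclideanHalfSpace (d + 1)) p).open_source.eventually_mem hp,
    hu.continuous.continuousAt.eventually
      ((chartAt (EuclideanHalfSpace (e + 1)) (u p)).open_source.eventually_mem hup)]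
    with q h1 hq huq hqb
  rw [isLocallyConstAt_iff_tangentialEnergyAt hd hg hh hu hbi hφ hψ hp hup hpb,
    isLocallyConstAt_iff_tangentialEnergyAt hd hg hh hu hbi hφ hψ hq huq hqb,
    h1 ((mem_boundary_iff_toCoord_eq_zero hφ hq).1 hqb)]

/-- If `u` is locally constant at one point of a boundary component, it is so on the whole
component, hence constant there. -/
theorem eq_of_isLocallyConstAt (hd : 1 ≤ d) (hg : IsConformallyCompact g)
    (hh : IsConformallyCompact h) (hu : IsSimpleBMap (d := d) (e := e) u)
    (hbi : IsBiharmonic g h u) (hpb : p ∈ (𝓡∂ (d + 1)).boundary M) (hc : IsLocallyConstAt d u p)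
    {q : M} (hq : q ∈ connectedComponentIn ((𝓡∂ (d + 1)).boundary M) p) : u q = u p := by
  have hC : IsPreconnected (connectedComponentIn ((𝓡∂ (d + 1)).boundary M) p) :=
    isPreconnected_connectedComponentIn
  have hsub := connectedComponentIn_subset ((𝓡∂ (d + 1)).boundary M) p
  have hp := mem_connectedComponentIn hpb
  have h1 : ∀ x ∈ connectedComponentIn ((𝓡∂ (d + 1)).boundary M) p, IsLocallyConstAt d u x :=
    fun x hx => (hC.induction₂ (fun x y => IsLocallyConstAt d u x ↔ IsLocallyConstAt d u y)
      (fun x hx => (eventually_isLocallyConstAt_iff hd hg hh hu hbi (hsub hx)).filter_mono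
        (nhdsWithin_mono x hsub)) (fun _ _ _ _ _ _ => Iff.trans) (fun _ _ _ _ => Iff.symm)
      hp hx).1 hc
  exact hC.induction₂ (fun x y => u y = u x)
    (fun x hx => (h1 x hx).filter_mono (nhdsWithin_mono x hsub))
    (fun _ _ _ _ _ _ hxy hyz => hyz.trans hxy) (fun _ _ _ _ => Eq.symm) hp hq

end Alternative

section Conclusion

variable {d e : ℕ} {M N : Type*} [TopologicalSpace M] [TopologicalSpace N]
  [ChartedSpace (EuclideanHalfSpace (d + 1)) M] [ChartedSpace (EuclideanHalfSpace (e + 1)) N]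
  [IsManifold (𝓡∂ (d + 1)) ∞ M] [IsManifold (𝓡∂ (e + 1)) ∞ N]
  {g : ∀ p : M, LinearMap.BilinForm ℝ (TangentSpace (𝓡∂ (d + 1)) p)}
  {h : ∀ q : N, LinearMap.BilinForm ℝ (TangentSpace (𝓡∂ (e + 1)) q)}
  {φ : OpenPartialHomeomorph M (EuclideanHalfSpace (d + 1))}
  {ψ : OpenPartialHomeomorph N (EuclideanHalfSpace (e + 1))} {u : M → N} {p : M}

/-- At a boundary point where `u` is not locally constant the dichotomy leaves only the
non-degenerate alternative, in which `β` vanishes and the tangential energy has the value that makes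
the boundary value of the tension field vanish. -/
theorem exists_nondegenerate_boundaryModel (hd : 1 ≤ d) (hg : IsConformallyCompact g)
    (hh : IsConformallyCompact h) (hu : IsSimpleBMap (d := d) (e := e) u)
    (hbi : IsBiharmonic g h u) (hφ : φ ∈ smoothCharts d M) (hψ : ψ ∈ smoothCharts e N)
    (hp : p ∈ φ.source) (hup : u p ∈ ψ.source) (hpb : p ∈ (𝓡∂ (d + 1)).boundary M)
    (hc : ¬ IsLocallyConstAt d u p) :
    ∃ (K : _) (K' : _) (D : _), bdryValue (zeroMetric (chartMetric g φ)) (toCoord φ p) = K ∧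
      bdryValue (zeroMetric (chartMetric h ψ)) (toCoord ψ (u p)) = K' ∧
      bdryValue (zeroDiff (chartMap u φ ψ)) (toCoord φ p) = D ∧
      BoundaryModel (toCoord φ p) (toCoord ψ (u p)) (chartMetric g φ) (chartMetric h ψ)
        (chartMap u φ ψ) K K' D ∧
      (∀ a, imageNormal K D a = K⁻¹ 0 0 / K'⁻¹ 0 0 * K'⁻¹ a 0) ∧
      K'⁻¹ 0 0 * tangentialEnergy K K' D = d * K⁻¹ 0 0 := by
  have hz := toCoord_mem_chartDomain (φ := φ) (ψ := ψ) hp hup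
  have h0 := (mem_boundary_iff_toCoord_eq_zero hφ hp).1 hpb
  rw [isLocallyConstAt_iff_tangentialEnergyAt hd hg hh hu hbi hφ hψ hp hup hpb,
    tangentialEnergyAt] at hc
  have m := (exists_boundaryModel hg hh hu hφ hψ hz h0).1
  obtain ⟨hw, hT⟩ := m.dichotomy hd (m.jacobiLim_tensionLim
    (eventually_jacobi_tension_eq_zero hbi hu.continuous hφ hψ hz))
  have hT := hT.resolve_left hc
  have h1 : chartMap u φ ψ (toCoord φ p) = toCoord ψ (u p) := by
    rw [chartMap, ofCoord_toCoord hp]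
  rw [h1] at m hw hT
  exact ⟨_, _, _, rfl, rfl, rfl, m, hw, hT⟩

end Conclusion

end SimpleBMap

end

theorem mainTheorem3 {m n : ℕ} (hm : 1 ≤ m)
    {M : Type*} [TopologicalSpace M] [T2Space M] [CompactSpace M]
    [ChartedSpace (EuclideanHalfSpace (m + 1)) M] [IsManifold (𝓡∂ (m + 1)) ∞ M]
    {N : Type*} [TopologicalSpace N] [T2Space N] [CompactSpace N]
    [ChartedSpace (EuclideanHalfSpace (n + 1)) N] [IsManifold (𝓡∂ (n + 1)) ∞ N]
    (g : ∀ p : M, LinearMap.BilinForm ℝ (TangentSpace (𝓡∂ (m + 1)) p))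
    (h : ∀ q : N, LinearMap.BilinForm ℝ (TangentSpace (𝓡∂ (n + 1)) q))
    (hg : SimpleBMap.IsConformallyCompact g) (hh : SimpleBMap.IsConformallyCompact h)
    (u : M → N) (hu : SimpleBMap.IsSimpleBMap (d := m) (e := n) u)
    (hbi : SimpleBMap.IsBiharmonic g h u)
    (hconst : ∀ p ∈ (𝓡∂ (m + 1)).boundary M,
      ∃ q ∈ connectedComponentIn ((𝓡∂ (m + 1)).boundary M) p, u q ≠ u p) :
    SimpleBMap.IsAsymptoticallyHarmonic g h u ∧
    ∀ p ∈ (𝓡∂ (m + 1)).boundary M,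
      ∀ φ ∈ SimpleBMap.smoothCharts m M, ∀ ψ ∈ SimpleBMap.smoothCharts n N,
      p ∈ φ.source → u p ∈ ψ.source →
        SimpleBMap.betaAt g h u φ ψ p = 0 ∧
        (SimpleBMap.lambdaStarLambdaAt g h u φ ψ p).trace = (m : ℝ) ∧
        SimpleBMap.HasIndicialRoots
          (SimpleBMap.zeroJacobi (SimpleBMap.chartMetric g φ) (SimpleBMap.chartMetric h ψ)
            (SimpleBMap.chartMap u φ ψ))
          (SimpleBMap.toCoord φ p)
          {(((((m : ℝ) + Real.sqrt ((m : ℝ) ^ 2 + 8 * m)) / 2 : ℝ)) : ℂ),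
            (((((m : ℝ) - Real.sqrt ((m : ℝ) ^ 2 + 8 * m)) / 2 : ℝ)) : ℂ),
            (-1 : ℂ), ((m : ℂ) + 1)} := by
  have hmodel := fun p hpb φ hφ ψ hψ hp hup =>
    SimpleBMap.exists_nondegenerate_boundaryModel (p := p) (φ := φ) (ψ := ψ) hm hg hh hu hbi hφ hψ
      hp hup hpb fun hc => by
        obtain ⟨q, hq, hne⟩ := hconst p hpb
        exact hne (SimpleBMap.eq_of_isLocallyConstAt hm hg hh hu hbi hpb hc hq)
  refine ⟨fun p hpb φ hφ ψ hψ hp hup a => ?_, fun p hpb φ hφ ψ hψ hp hup => ?_⟩ <;>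
    obtain ⟨K, K', D, hK, hK', hD, mod, hw, hT⟩ := hmodel p hpb φ hφ ψ hψ hp hup
  · simpa only [mod.tensionLim_eq_zero hw hT a] using (mod.zReg_zeroTension a).tendsto
  · rw [SimpleBMap.betaAt, SimpleBMap.lambdaStarLambdaAt, hK, hK', hD]
    exact ⟨mod.betaVec_eq_zero hw, mod.trace_lambda_eq hT, mod.hasIndicialRoots hm hw hT⟩
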